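/- Let $L\ge 7$ be odd and let $C_L$ be the cycle graph with vertices $v_1,\dots,v_L$. A tile is a partial matching of $C_L$, i.e. a set of edges covering each vertex at most once; let $T$ be the set of tiles. For $\mathbf n=(n_v)_v\in\mathbb Z_{\ge0}^{V}$ and $N\ge 0$, a colored $\mathbf n$-multiweb with $N$ colors is a map $m\colon\{1,\dots,N\}\to T$ such that every vertex $v$ is covered by exactly $n_v$ of the tiles $m(1),\dots,m(N)$; $\mathbf n$ is called feasible with respect to $N$ if such an $m$ exists. A random multiweb is chosen with probability proportional to its weight for the tile weights $w\equiv1$ (that is, uniformly). Write $m_t$ for the number of colors $c$ with $m(c)=t$. A local configuration is a subset $j$ of $\{v_Lv_1,\,v_1v_2,\,v_2v_3,\,v_3v_4,\,v_4v_5,\,v_5v_6\}$ covering each of $v_1,\dots,v_5$ at most once. Let $f_j$ be the number of edges of $j$, and let $\varepsilon_j\in\{0,1,2\}$ be the number of the two end edges $v_Lv_1$, $v_5v_6$ contained in $j$. Let $S_j(m)=\sum_t m_t$, where the sum is over the tiles $t$ whose set of edges among these six is exactly $j$. Let $\varphi=\frac{1+\sqrt5}{2}$, $\psi=\frac{1-\sqrt5}{2}$,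 and let $\hat\alpha_L=1-\dfrac{(\varphi^L-\psi^L)/\sqrt5}{\varphi^L+\psi^L}$ be the critical vertex density. Say that $(\mathbf n^{(k)},N_k)_{k}$ is a critical regime for $C_L$ if $N_k\to\infty$, $n^{(k)}_v\to\infty$ and $n^{(k)}_v/N_k\to\hat\alpha_L$ for every vertex $v$, and $\mathbf n^{(k)}$ is feasible with respect to $N_k$ for every $k$. **Theorem.** For every local configuration $j$ there are real numbers $\mu_j(L)$, $\sigma_j^2(L)$, depending only on $j$ and $L$, such that for every odd $L\ge7$ and every critical regime $(\mathbf n^{(k)},N_k)_k$ for $C_L$, the mean and the variance of $S_j$ for the random $\mathbf n^{(k)}$-multiweb with $N_k$ colors satisfy $$\frac{\mathbb E(S_j)}{N_k}\to\mu_j(L),\qquad \frac{\operatorname{Var}(S_j)}{N_k}\to\sigma^2_j(L)\qquad(k\to\infty),$$ and, as $L\to\infty$ through odd integers, $$\mu_j(L)\to\frac{\varphi^{-\varepsilon_j-4}}{\sqrt5},\qquad \sigma_j^2(L)\to\frac{\varphi^{-\varepsilon_j-4}}{\sqrt5}\left(1-\frac{\varepsilon_j+\varphi^{-1}f_j+\frac{11+\sqrt5}{2}}{\varphi^{\varepsilon_j+6}}\right).$$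 -/

import Mathlib

open Filter Topology MeasureTheory ProbabilityTheory

noncomputable section

namespace ColoredMultiweb

/-- A tile of `G`: a partial matching, that is, a set of edges of `G` no two of which share
a vertex (so that every vertex is covered zero or one times). -/
abbrev Tile {V : Type*} (G : SimpleGraph V) : Type _ :=
  {t : Finset (Sym2 V) //
    (∀ e ∈ t, e ∈ G.edgeSet) ∧ ∀ e ∈ t, ∀ f ∈ t, ∀ v : V, v ∈ e → v ∈ f → e = f}

/-- The vertex `v` is covered by the tile `t`. -/
def Covers {V : Type*} {G : SimpleGraph V} (t : Tile G) (v : V) : Prop :=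
  ∃ e ∈ t.1, v ∈ e

instance {V : Type*} [Finite V] (G : SimpleGraph V) : Fintype (Tile G) :=
  Fintype.ofFinite _

open Classical in
/-- The colored `n`-multiwebs on `G` with `N` colors: each color gets a tile, in such a way that
each vertex `v` is covered exactly `n v` times. -/
abbrev Multiweb {V : Type*} (G : SimpleGraph V) (n : V → ℕ) (N : ℕ) : Type _ :=
  {m : Fin N → Tile G // ∀ v, (Finset.univ.filter fun c => Covers (m c) v).card = n v}

instance {V : Type*} [Finite V] (G : SimpleGraph V) (n : V → ℕ) (N : ℕ) :
    Fintype (Multiweb G n N) :=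
  Fintype.ofFinite _

instance {V : Type*} (G : SimpleGraph V) (n : V → ℕ) (N : ℕ) :
    MeasurableSpace (Multiweb G n N) := ⊤

/-- The multiplicity vector `n` is feasible with respect to `N`: some colored multiweb
with `N` colors has vertex multiplicities `n`. -/
def Feasible {V : Type*} (G : SimpleGraph V) (n : V → ℕ) (N : ℕ) : Prop :=
  Nonempty (Multiweb G n N)

open Classical in
/-- The number `m_t` of times the tile `t` appears in the multiweb `m`. -/
def tileCount {V : Type*} {G : SimpleGraph V} {n : V → ℕ} {N : ℕ}
    (m : Multiweb G n N) (t : Tile G) : ℕ :=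
  (Finset.univ.filter fun c => m.1 c = t).card

/-- The weight `w(m) = ∏ₜ w(t) ^ m_t` of a multiweb. -/
def weight {V : Type*} [Finite V] {G : SimpleGraph V} (w : Tile G → ℝ) {n : V → ℕ} {N : ℕ}
    (m : Multiweb G n N) : ℝ :=
  ∏ t, w t ^ tileCount m t

/-- The partition function. -/
def partitionFunction {V : Type*} [Finite V] {G : SimpleGraph V} (w : Tile G → ℝ)
    (n : V → ℕ) (N : ℕ) : ℝ :=
  ∑ m : Multiweb G n N, weight w m

/-- The law of a random multiweb: `m` has probability `w(m) / Z`. -/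
def multiwebMeasure {V : Type*} [Finite V] {G : SimpleGraph V} (w : Tile G → ℝ)
    (n : V → ℕ) (N : ℕ) : Measure (Multiweb G n N) :=
  ∑ m : Multiweb G n N,
    ENNReal.ofReal (weight w m / partitionFunction w n N) • Measure.dirac m

/-- The `k`-th edge of the window, `k = 0, …, 5`, in the cycle graph with vertices `v₁, …, v_L`.
The vertex `v_i` is the residue of `i` modulo `L`, so `v_L` is `0`; the six edges are
`v_L v₁, v₁ v₂, v₂ v₃, v₃ v₄, v₄ v₅, v₅ v₆`. -/
def windowEdge (L : ℕ) [NeZero L] (k : ℕ) : Sym2 (Fin L) :=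
  s(Fin.ofNat L k, Fin.ofNat L (k + 1))

open Classical in
/-- The local configuration of a tile: the set of (positions of) window edges that it contains. -/
def localConfig {L : ℕ} [NeZero L] (t : Tile (SimpleGraph.cycleGraph L)) : Finset ℕ :=
  (Finset.range 6).filter fun k => windowEdge L k ∈ t.1

/-- A set of window edges is a local configuration if it covers each of `v₁, …, v₅` at most once:
`v_i` lies on the window edges number `i - 1` and `i`. -/
def IsLocalConfig (j : Finset ℕ) : Prop :=
  j ⊆ Finset.range 6 ∧ ∀ i ∈ Finset.Icc 1 5, ¬ (i - 1 ∈ j ∧ i ∈ j)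

/-- The local class count `S_j(m) = ∑_{t ∈ j} m_t`. -/
def localCount {L : ℕ} [NeZero L] (j : Finset ℕ) {n : Fin L → ℕ} {N : ℕ}
    (m : Multiweb (SimpleGraph.cycleGraph L) n N) : ℕ :=
  ∑ t with localConfig t = j, tileCount m t

/-- The number `f_j` of edges in the configuration `j`. -/
def edgeNumber (j : Finset ℕ) : ℕ := j.card

/-- The number `ε_j` of the endmost edges `v_L v₁`, `v₅ v₆` that the configuration `j` uses. -/
def endNumber (j : Finset ℕ) : ℕ := (j ∩ {0, 5}).card

/-- The critical vertex density of the cycle graph of (odd) length `L`. -/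
def criticalDensity (L : ℕ) : ℝ :=
  1 - ((Real.goldenRatio ^ L - Real.goldenConj ^ L) / √5) /
    (Real.goldenRatio ^ L + Real.goldenConj ^ L)

/-- The multiplicity vectors `n k` and the numbers of colors `N k` become large in such a way that
`n k` is feasible and that the fraction of colors covering each vertex of the cycle graph of length
`L` tends to the critical density. -/
def CriticalRegime (L : ℕ) (n : ℕ → Fin L → ℕ) (N : ℕ → ℕ) : Prop :=
  Tendsto N atTop atTop ∧ (∀ v, Tendsto (fun k => n k v) atTop atTop) ∧
    (∀ k, Feasible (SimpleGraph.cycleGraph L) (n k) (N k)) ∧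
    ∀ v, Tendsto (fun k => (n k v : ℝ) / N k) atTop (𝓝 (criticalDensity L))

/-- The law of a random colored `n`-multiweb on the cycle graph of length `L`, for the initial tile
weight function `w ≡ 1`. -/
def cycleMeasure (L : ℕ) (n : Fin L → ℕ) (N : ℕ) :
    Measure (Multiweb (SimpleGraph.cycleGraph L) n N) :=
  multiwebMeasure (fun _ => 1) n N

end ColoredMultiweb

end

/-!
The colors of a random multiweb are almost independent uniform tiles, and the limits are computed
from the uniform law on tiles.

*Reduction to edges.* On an odd cycle the numbers of times that the edges are used are determined
by the numbers of times that the vertices are covered (`two_mul_eq_alternating_sum`). Hence the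
multiwebs are the maps `m : Fin N → Tile` with a prescribed sum `∑_c X(m c) = x`, where `X(t)` is
the indicator vector of the edges of `t` (`multiweb_iff_mem_fiber`), and in a critical regime `x/N`
tends to the mean `η` of `X` under the uniform law (`tendsto_edge_multiplicity`).

*Averages over a fiber.* For a finite family `X` of lattice vectors containing `0` and the unit
vectors, the law of `m` given `∑_c X(m c) = x` is unchanged when the uniform weights are tilted
exponentially, and for `x/N` near `η` a small tilt makes the mean exactly `x/N` (`exists_tilt`). By
Fourier inversion (`fiberMean_prod_mul_integral`), the correlation of `f(m c)` and `g(m d)` is a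
ratio of integrals over the torus. The denominator is of order `N ^ (-|ι|/2)`, and a centred factor
gains `‖θ‖`, that is `N ^ (-1/2)`; a centred factor uncorrelated with `X` gains `‖θ‖ ^ 2`. An
additive functional `∑_c A(m c)` changes by a constant on the fiber when `A` is replaced by its
residual `A - y · X`. Choosing `y` by linear regression, the covariances between distinct colors are
negligible, and the variance is asymptotically `N` times the variance of the residual
(`tendsto_fiberMean_and_fiberVariance`).

*The regression.* Tiles are closed words in `0`, `1` without adjacent `1`s, so that means and
covariances under the uniform law are entries of powers of the matrix `!![1, 1; 1, 0]`. Up to a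
scalar and a rank-one term, the covariance matrix of the edges is inverted by the local operator
`b ↦ b (e + 1) + b (e - 1) + 3 * b e` (`edgeCov_neighbours`), which gives the regression
coefficients in closed form (`sum_regressionCoeff_mul_edgeCov`).

*Long cycles.* The local operator makes the covariances with edges outside the window exponentially
small (`classTail_eq`). Thus only the six edges of the window and their two neighbours contribute to
the limit (`tendsto_windowSum`), which becomes the stated value by an identity in `ℚ(√5)`
(`limit_identity`).
-/

noncomputable section

namespace ColoredMultiweb

section Fourier

/-! ### Fourier transform of a weighted family of lattice vectors -/

variable {T ι : Type*} [Fintype ι]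

/-- The phase `θ · (X t - ξ)`. -/
def phase (X : T → ι → ℤ) (ξ : ι → ℝ) (θ : ι → ℝ) (t : T) : ℝ :=
  ∑ i, θ i * ((X t i : ℝ) - ξ i)

lemma abs_phase_le (X : T → ι → ℤ) (ξ : ι → ℝ) {R : ℝ} (hR : ∀ t i, |(X t i : ℝ) - ξ i| ≤ R)
    (θ : ι → ℝ) (t : T) : |phase X ξ θ t| ≤ Fintype.card ι * R * ‖θ‖ := by
  calc |phase X ξ θ t| ≤ ∑ _i : ι, ‖θ‖ * R := by
        refine (Finset.abs_sum_le_sum_abs _ _).trans (Finset.sum_le_sum fun i _ => ?_)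
        rw [abs_mul]
        exact mul_le_mul (norm_le_pi_norm θ i) (hR t i) (abs_nonneg _) (norm_nonneg _)
    _ = _ := by simp; ring

variable [Fintype T]

/-- The Fourier transform `θ ↦ ∑ₜ p(t) f(t) exp(i θ·(X(t) - ξ))` of the weight `p f` placed on the
vectors `X(t)`, recentred at `ξ`. -/
def transform (X : T → ι → ℤ) (ξ : ι → ℝ) (p f : T → ℝ) (θ : ι → ℝ) : ℂ :=
  ∑ t, ((p t * f t : ℝ) : ℂ) * Complex.exp ((phase X ξ θ t : ℂ) * Complex.I)

/-- The fundamental domain `(-π, π]^ι` of the torus. -/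
def torusBox (ι : Type*) : Set (ι → ℝ) :=
  Set.pi Set.univ fun _ => Set.Ioc (-Real.pi) Real.pi

open Classical in
/-- The maps `m : Fin N → T` with `∑_c X(m c) = x`. -/
def fiber (X : T → ι → ℤ) (N : ℕ) (x : ι → ℤ) : Finset (Fin N → T) :=
  Finset.univ.filter fun m => ∀ i, ∑ c, X (m c) i = x i

lemma continuous_transform (X : T → ι → ℤ) (ξ : ι → ℝ) (p f : T → ℝ) :
    Continuous (transform X ξ p f) := by
  unfold transform phase
  fun_prop

lemma measurableSet_torusBox : MeasurableSet (torusBox ι) :=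
  MeasurableSet.univ_pi fun _ => measurableSet_Ioc

lemma integrableOn_torusBox {E : Type*} [NormedAddCommGroup E] {g : (ι → ℝ) → E}
    (hg : Continuous g) : IntegrableOn g (torusBox ι) := by
  have : IntegrableOn g (closure (torusBox ι)) :=
    hg.continuousOn.integrableOn_compact
      (Bornology.IsBounded.pi fun _ => Metric.isBounded_Ioc _ _).isCompact_closure
  exact this.mono_set subset_closure

lemma integral_exp_int_mul_I (k : ℤ) :
    ∫ θ in Set.Ioc (-Real.pi) Real.pi, Complex.exp ((θ * k : ℝ) * Complex.I) =
      if k = 0 then (2 * Real.pi : ℂ) else 0 := by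
  rw [← intervalIntegral.integral_of_le (by linarith [Real.pi_pos])]
  split_ifs with h
  · subst h
    simp
    ring
  · have hk : (k * Complex.I : ℂ) ≠ 0 := by simp [h]
    have := integral_exp_mul_complex (a := -Real.pi) (b := Real.pi) hk
    simp only [Complex.ofReal_mul, Complex.ofReal_intCast]
    have e : ∀ θ : ℝ, (θ : ℂ) * k * Complex.I = k * Complex.I * θ := fun θ => by ring
    simp_rw [e, this]
    rw [div_eq_zero_iff]
    left
    rw [sub_eq_zero, Complex.exp_eq_exp_iff_exists_int]
    exact ⟨k, by push_cast; ring⟩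

/-- Orthogonality of characters on the torus. -/
lemma integral_torusBox_exp (k : ι → ℤ) [Decidable (∀ i, k i = 0)] :
    ∫ θ in torusBox ι, Complex.exp (((∑ i, θ i * k i : ℝ) : ℂ) * Complex.I) =
      if ∀ i, k i = 0 then (2 * Real.pi : ℂ) ^ Fintype.card ι else 0 := by
  have h1 : ∀ θ : ι → ℝ, Complex.exp (((∑ i, θ i * k i : ℝ) : ℂ) * Complex.I) =
      ∏ i, Complex.exp ((θ i * k i : ℝ) * Complex.I) := by
    intro θ
    rw [← Complex.exp_sum, ← Finset.sum_mul]
    push_cast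
    rfl
  simp_rw [h1]
  rw [torusBox, volume_pi, Measure.restrict_pi_pi,
    integral_fintype_prod_eq_prod (fun i (s : ℝ) => Complex.exp ((s * k i : ℝ) * Complex.I))]
  simp_rw [integral_exp_int_mul_I]
  split_ifs with h
  · simp [h]
  · push Not at h
    obtain ⟨i, hi⟩ := h
    exact Finset.prod_eq_zero (Finset.mem_univ i) (by simp [hi])

/-- Fourier inversion: the integral of a product of transforms is a weighted sum over the fiber. -/
lemma integral_prod_transform (X : T → ι → ℤ) (N : ℕ) (x : ι → ℤ) (ξ : ι → ℝ)
    (hξ : ∀ i, N * ξ i = x i) (p : T → ℝ) (f : Fin N → T → ℝ) :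
    ∫ θ in torusBox ι, ∏ c, transform X ξ p (f c) θ =
      (2 * Real.pi : ℂ) ^ Fintype.card ι *
        ((∑ m ∈ fiber X N x, (∏ c, p (m c)) * ∏ c, f c (m c) : ℝ) : ℂ) := by
  classical
  have h1 : ∀ θ, ∏ c, transform X ξ p (f c) θ = ∑ m : Fin N → T,
      (((∏ c, p (m c)) * ∏ c, f c (m c) : ℝ) : ℂ) *
        Complex.exp (((∑ i, θ i * ((∑ c, X (m c) i - x i : ℤ) : ℝ) : ℝ) : ℂ) * Complex.I) := by
    intro θ
    unfold transform
    rw [Finset.prod_univ_sum, Fintype.piFinset_univ]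
    refine Finset.sum_congr rfl fun m _ => ?_
    rw [Finset.prod_mul_distrib, ← Complex.exp_sum, ← Finset.sum_mul, ← Complex.ofReal_sum,
      ← Complex.ofReal_prod, Finset.prod_mul_distrib]
    congr 4
    unfold phase
    rw [Finset.sum_comm]
    refine Finset.sum_congr rfl fun i _ => ?_
    rw [← Finset.mul_sum, Finset.sum_sub_distrib]
    push_cast
    rw [← hξ]
    simp
  simp_rw [h1]
  rw [integral_finsetSum _ fun m _ => integrableOn_torusBox (by fun_prop)]
  simp_rw [integral_const_mul, integral_torusBox_exp]
  rw [fiber, Finset.sum_filter, Complex.ofReal_sum, Finset.mul_sum]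
  refine Finset.sum_congr rfl fun m _ => ?_
  simp only [sub_eq_zero]
  split_ifs <;> simp [mul_comm]

/-! ### Bounds on the transform -/

lemma norm_exp_mul_I_sub_one_le (s : ℝ) : ‖Complex.exp (s * Complex.I) - 1‖ ≤ |s| := by
  rw [mul_comm]
  exact Real.norm_exp_I_mul_ofReal_sub_one_le

lemma norm_exp_mul_I_sub_one_sub_le (s : ℝ) :
    ‖Complex.exp (s * Complex.I) - 1 - s * Complex.I‖ ≤ 3 * s ^ 2 := by
  by_cases h : |s| ≤ 1
  · have := Complex.norm_exp_sub_one_sub_id_le (x := s * Complex.I) (by simpa using h)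
    simp only [norm_mul, Complex.norm_real, Complex.norm_I, mul_one, Real.norm_eq_abs,
      sq_abs] at this
    nlinarith [sq_nonneg s]
  · have h1 := norm_exp_mul_I_sub_one_le s
    have h2 : ‖(s * Complex.I : ℂ)‖ = |s| := by simp
    have h3 := norm_sub_le (Complex.exp (s * Complex.I) - 1) (s * Complex.I)
    have := sq_abs s
    nlinarith

lemma norm_transform_le (X : T → ι → ℤ) (ξ : ι → ℝ) (p f : T → ℝ) (hp : ∀ t, 0 ≤ p t)
    (hp1 : ∑ t, p t = 1) {K : ℝ} (hf : ∀ t, |f t| ≤ K) (θ : ι → ℝ) :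
    ‖transform X ξ p f θ‖ ≤ K := by
  calc ‖transform X ξ p f θ‖ ≤ ∑ t, p t * K := by
        refine norm_sum_le_of_le _ fun t _ => ?_
        rw [norm_mul, Complex.norm_exp_ofReal_mul_I, Complex.norm_real, Real.norm_eq_abs, abs_mul,
          abs_of_nonneg (hp t), mul_one]
        exact mul_le_mul_of_nonneg_left (hf t) (hp t)
    _ = K := by rw [← Finset.sum_mul, hp1, one_mul]

/-- The transform of a centred function vanishes to first order at the origin. -/
lemma norm_transform_le_of_sum_eq_zero (X : T → ι → ℤ) (ξ : ι → ℝ) (p f : T → ℝ)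
    (hp : ∀ t, 0 ≤ p t) (hp1 : ∑ t, p t = 1) {K R : ℝ} (hf : ∀ t, |f t| ≤ K)
    (hR : ∀ t i, |(X t i : ℝ) - ξ i| ≤ R) (h0 : ∑ t, p t * f t = 0) (θ : ι → ℝ) :
    ‖transform X ξ p f θ‖ ≤ K * (Fintype.card ι * R) * ‖θ‖ := by
  have e : transform X ξ p f θ = ∑ t, ((p t * f t : ℝ) : ℂ) *
      (Complex.exp ((phase X ξ θ t : ℂ) * Complex.I) - 1) := by
    simp_rw [mul_sub, mul_one, Finset.sum_sub_distrib, ← Complex.ofReal_sum, h0]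
    simp [transform]
  rw [e]
  calc _ ≤ ∑ t, p t * (K * (Fintype.card ι * R * ‖θ‖)) := by
        refine norm_sum_le_of_le _ fun t _ => ?_
        rw [norm_mul, Complex.norm_real, Real.norm_eq_abs, abs_mul, abs_of_nonneg (hp t), mul_assoc]
        refine mul_le_mul_of_nonneg_left ?_ (hp t)
        exact mul_le_mul (hf t) ((norm_exp_mul_I_sub_one_le _).trans (abs_phase_le X ξ hR θ t))
          (norm_nonneg _) ((abs_nonneg _).trans (hf t))
    _ = _ := by rw [← Finset.sum_mul, hp1]; ring

/-- If `f` is centred and almost uncorrelated with `X`, then its transform almost vanishes to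
second order at the origin. -/
lemma norm_transform_le_of_uncorrelated (X : T → ι → ℤ) (ξ : ι → ℝ) (p f : T → ℝ)
    (hp : ∀ t, 0 ≤ p t) (hp1 : ∑ t, p t = 1) {K R δ : ℝ} (hf : ∀ t, |f t| ≤ K)
    (hR : ∀ t i, |(X t i : ℝ) - ξ i| ≤ R) (h0 : ∑ t, p t * f t = 0)
    (hδ : ∀ i, |∑ t, p t * f t * (X t i - ξ i)| ≤ δ) (θ : ι → ℝ) :
    ‖transform X ξ p f θ‖ ≤
      Fintype.card ι * δ * ‖θ‖ + K * (3 * (Fintype.card ι * R) ^ 2) * ‖θ‖ ^ 2 := by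
  have e : transform X ξ p f θ = ((∑ i, θ i * ∑ t, p t * f t * (X t i - ξ i) : ℝ) : ℂ) * Complex.I +
      ∑ t, ((p t * f t : ℝ) : ℂ) *
      (Complex.exp ((phase X ξ θ t : ℂ) * Complex.I) - 1 - phase X ξ θ t * Complex.I) := by
    have : ∑ i, θ i * ∑ t, p t * f t * (X t i - ξ i) = ∑ t, p t * f t * phase X ξ θ t := by
      simp_rw [phase, Finset.mul_sum]
      rw [Finset.sum_comm]
      refine Finset.sum_congr rfl fun t _ => Finset.sum_congr rfl fun i _ => by ring
    rw [this]
    have h0' : ∑ t, ((p t * f t : ℝ) : ℂ) = 0 := by rw [← Complex.ofReal_sum, h0]; simp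
    simp_rw [mul_sub, mul_one, Finset.sum_sub_distrib, h0']
    simp only [transform, Complex.ofReal_sum, Complex.ofReal_mul, sub_zero, Finset.sum_mul,
      mul_assoc]
    ring
  rw [e]
  refine (norm_add_le _ _).trans (add_le_add ?_ ?_)
  · rw [norm_mul, Complex.norm_I, mul_one, Complex.norm_real, Real.norm_eq_abs]
    calc _ ≤ ∑ _i : ι, ‖θ‖ * δ := by
          refine (Finset.abs_sum_le_sum_abs _ _).trans (Finset.sum_le_sum fun i _ => ?_)
          rw [abs_mul]
          exact mul_le_mul (norm_le_pi_norm θ i) (hδ i) (abs_nonneg _) (norm_nonneg _)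
      _ = _ := by simp; ring
  · calc _ ≤ ∑ t, p t * (K * (3 * (Fintype.card ι * R * ‖θ‖) ^ 2)) := by
          refine norm_sum_le_of_le _ fun t _ => ?_
          rw [norm_mul, Complex.norm_real, Real.norm_eq_abs, abs_mul, abs_of_nonneg (hp t),
            mul_assoc]
          refine mul_le_mul_of_nonneg_left ?_ (hp t)
          refine mul_le_mul (hf t) ((norm_exp_mul_I_sub_one_sub_le _).trans ?_)
            (norm_nonneg _) ((abs_nonneg _).trans (hf t))
          rw [← sq_abs (phase X ξ θ t)]
          gcongr
          exact abs_phase_le X ξ hR θ t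
      _ = _ := by rw [← Finset.sum_mul, hp1]; ring

/-- Gaussian decay of the characteristic function on the whole torus. It holds because the vectors
`X(t)` include `0` and the unit vectors, so that the differences generate the lattice. -/
lemma norm_transform_one_le_exp [DecidableEq ι] (X : T → ι → ℤ) (ξ : ι → ℝ) (p : T → ℝ)
    {p₀ : ℝ} (hp₀ : 0 ≤ p₀) (hp : ∀ t, p₀ ≤ p t) (hp1 : ∑ t, p t = 1) (t₀ : T) (ht₀ : ∀ i, X t₀ i = 0)
    (e : ι → T) (he : ∀ i j, X (e i) j = if j = i then 1 else 0) {θ : ι → ℝ}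
    (hθ : θ ∈ torusBox ι) :
    ‖transform X ξ p (fun _ => 1) θ‖ ≤
      Real.exp (-(p₀ ^ 2 * (2 / Real.pi ^ 2)) * ∑ i, θ i ^ 2) := by
  classical
  have hp' : ∀ t, 0 ≤ p t := fun t => hp₀.trans (hp t)
  -- the squared modulus is a double sum of cosines of phase differences
  have key : ‖transform X ξ p (fun _ => 1) θ‖ ^ 2 =
      ∑ t, ∑ s, p t * p s * Real.cos (phase X ξ θ t - phase X ξ θ s) := by
    rw [← Complex.normSq_eq_norm_sq, Complex.normSq_apply]
    have hre : (transform X ξ p (fun _ => 1) θ).re = ∑ t, p t * Real.cos (phase X ξ θ t) := by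
      simp [transform, Complex.exp_ofReal_mul_I_re]
    have him : (transform X ξ p (fun _ => 1) θ).im = ∑ t, p t * Real.sin (phase X ξ θ t) := by
      simp [transform, Complex.exp_ofReal_mul_I_im]
    rw [hre, him, Finset.sum_mul_sum, Finset.sum_mul_sum, ← Finset.sum_add_distrib]
    refine Finset.sum_congr rfl fun t _ => ?_
    rw [← Finset.sum_add_distrib]
    refine Finset.sum_congr rfl fun s _ => ?_
    rw [Real.cos_sub]
    ring
  have hone : ∑ t, ∑ s, p t * p s = 1 := by
    rw [← Finset.sum_mul_sum, hp1, one_mul]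
  have hterm : ∀ t s, 0 ≤ p t * p s * (1 - Real.cos (phase X ξ θ t - phase X ξ θ s)) :=
    fun t s => mul_nonneg (mul_nonneg (hp' t) (hp' s)) (sub_nonneg.2 (Real.cos_le_one _))
  have hph : ∀ i, phase X ξ θ (e i) - phase X ξ θ t₀ = θ i := by
    intro i
    rw [phase, phase, ← Finset.sum_sub_distrib]
    simp [he, ht₀, mul_sub]
  have hinj : Function.Injective e := by
    intro i j hij
    by_contra hne
    have h1 := he i i
    rw [hij, he j i] at h1
    simp [hne] at h1
  have hne : ∀ i, e i ≠ t₀ := by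
    intro i h
    have h1 := he i i
    rw [h, ht₀] at h1
    simp at h1
  have hpair : ∀ i, p₀ ^ 2 * (2 / Real.pi ^ 2 * θ i ^ 2) ≤
      p (e i) * p t₀ * (1 - Real.cos (phase X ξ θ (e i) - phase X ξ θ t₀)) := by
    intro i
    rw [hph]
    have hi := hθ i (Set.mem_univ i)
    have hc : Real.cos (θ i) ≤ 1 - 2 / Real.pi ^ 2 * θ i ^ 2 :=
      Real.cos_le_one_sub_mul_cos_sq (abs_le.2 ⟨hi.1.le, hi.2⟩)
    have : p₀ ^ 2 ≤ p (e i) * p t₀ := by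
      rw [sq]
      exact mul_le_mul (hp _) (hp _) hp₀ (hp' _)
    exact mul_le_mul this (by linarith) (by positivity) (mul_nonneg (hp' _) (hp' _))
  have hsum : ∑ i, p₀ ^ 2 * (2 / Real.pi ^ 2 * θ i ^ 2) * 2 ≤
      ∑ t, ∑ s, p t * p s * (1 - Real.cos (phase X ξ θ t - phase X ξ θ s)) := by
    calc ∑ i, p₀ ^ 2 * (2 / Real.pi ^ 2 * θ i ^ 2) * 2
        ≤ ∑ i, p (e i) * p t₀ * (1 - Real.cos (phase X ξ θ (e i) - phase X ξ θ t₀)) +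
          ∑ i, p t₀ * p (e i) * (1 - Real.cos (phase X ξ θ t₀ - phase X ξ θ (e i))) := by
          rw [← Finset.sum_add_distrib]
          refine Finset.sum_le_sum fun i _ => ?_
          rw [← neg_sub (phase X ξ θ (e i)) (phase X ξ θ t₀), Real.cos_neg, mul_comm (p t₀)]
          linarith [hpair i]
      _ ≤ ∑ t ∈ Finset.univ.erase t₀, ∑ s, p t * p s *
            (1 - Real.cos (phase X ξ θ t - phase X ξ θ s)) +
          ∑ s, p t₀ * p s * (1 - Real.cos (phase X ξ θ t₀ - phase X ξ θ s)) := by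
          refine add_le_add ?_ ?_
          · rw [← Finset.sum_image (s := Finset.univ) (g := e) (f := fun t => p t * p t₀ *
              (1 - Real.cos (phase X ξ θ t - phase X ξ θ t₀))) (fun a _ b _ h => hinj h)]
            refine (Finset.sum_le_sum_of_subset_of_nonneg (t := Finset.univ.erase t₀) ?_
              fun t _ _ => hterm t t₀).trans ?_
            · intro t ht
              obtain ⟨i, -, rfl⟩ := Finset.mem_image.1 ht
              simp [hne]
            · exact Finset.sum_le_sum fun t _ => Finset.single_le_sum
                (f := fun s => p t * p s * (1 - Real.cos (phase X ξ θ t - phase X ξ θ s)))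
                (fun s _ => hterm t s) (Finset.mem_univ t₀)
          · rw [← Finset.sum_image (s := Finset.univ) (g := e) (f := fun s => p t₀ * p s *
              (1 - Real.cos (phase X ξ θ t₀ - phase X ξ θ s))) (fun a _ b _ h => hinj h)]
            exact Finset.sum_le_sum_of_subset_of_nonneg (Finset.subset_univ _)
              fun s _ _ => hterm t₀ s
      _ = _ := Finset.sum_erase_add _ _ (Finset.mem_univ t₀)
  have hsq : ‖transform X ξ p (fun _ => 1) θ‖ ^ 2 ≤
      (Real.exp (-(p₀ ^ 2 * (2 / Real.pi ^ 2)) * ∑ i, θ i ^ 2)) ^ 2 := by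
    rw [key, ← Real.exp_nat_mul]
    refine le_trans ?_ (Real.add_one_le_exp _)
    have : ∑ t, ∑ s, p t * p s * (1 - Real.cos (phase X ξ θ t - phase X ξ θ s)) =
        1 - ∑ t, ∑ s, p t * p s * Real.cos (phase X ξ θ t - phase X ξ θ s) := by
      simp_rw [mul_sub, mul_one, Finset.sum_sub_distrib, hone]
    rw [this, ← Finset.sum_mul, ← Finset.mul_sum, ← Finset.mul_sum] at hsum
    push_cast
    linarith
  exact (pow_le_pow_iff_left₀ (norm_nonneg _) (Real.exp_pos _).le two_ne_zero).1 hsq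

end Fourier

section Concentration

/-! ### Gaussian asymptotics of the inversion integral -/

variable {T ι : Type*} [Fintype ι]

lemma integrable_exp_neg_mul_sum_sq {c : ℝ} (hc : 0 < c) :
    Integrable fun u : ι → ℝ => Real.exp (-c * ∑ i, u i ^ 2) := by
  have : (fun u : ι → ℝ => Real.exp (-c * ∑ i, u i ^ 2)) =
      fun u : ι → ℝ => ∏ i, Real.exp (-c * u i ^ 2) := by
    ext u
    rw [← Real.exp_sum, Finset.mul_sum]
  rw [this]
  exact Integrable.fintype_prod (f := fun _ (x : ℝ) => Real.exp (-c * x ^ 2))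
    fun _ => integrable_exp_neg_mul_sq hc

lemma norm_sq_le_sum_sq (u : ι → ℝ) : ‖u‖ ^ 2 ≤ ∑ i, u i ^ 2 := by
  have h0 : (0 : ℝ) ≤ ∑ i, u i ^ 2 := Finset.sum_nonneg fun i _ => sq_nonneg _
  rw [← Real.le_sqrt (norm_nonneg _) h0, pi_norm_le_iff_of_nonneg (Real.sqrt_nonneg _)]
  intro i
  rw [Real.norm_eq_abs]
  apply Real.abs_le_sqrt
  exact Finset.single_le_sum (f := fun i => u i ^ 2) (fun i _ => sq_nonneg _) (Finset.mem_univ i)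

lemma integrable_norm_pow_mul_exp_neg_mul_sum_sq {c : ℝ} (hc : 0 < c) (r : ℕ) :
    Integrable fun u : ι → ℝ => ‖u‖ ^ r * Real.exp (-c * ∑ i, u i ^ 2) := by
  refine ((integrable_exp_neg_mul_sum_sq (ι := ι) (half_pos hc)).const_mul
    (1 + r.factorial / (c / 2) ^ r)).mono' (by fun_prop) (ae_of_all _ fun u => ?_)
  have h0 : (0 : ℝ) ≤ ∑ i, u i ^ 2 := Finset.sum_nonneg fun i _ => sq_nonneg _
  rw [Real.norm_of_nonneg (by positivity)]
  have hsplit : Real.exp (-c * ∑ i, u i ^ 2) =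
      Real.exp (-(c / 2) * ∑ i, u i ^ 2) * Real.exp (-(c / 2) * ∑ i, u i ^ 2) := by
    rw [← Real.exp_add]
    ring_nf
  have h1 : ‖u‖ ^ r ≤ 1 + (∑ i, u i ^ 2) ^ r := by
    have h2 := pow_le_pow_left₀ (sq_nonneg ‖u‖) (norm_sq_le_sum_sq u) r
    rw [← pow_mul, mul_comm, pow_mul] at h2
    nlinarith [sq_nonneg (‖u‖ ^ r - 1)]
  have h3 : (∑ i, u i ^ 2) ^ r * Real.exp (-(c / 2) * ∑ i, u i ^ 2) ≤
      r.factorial / (c / 2) ^ r := by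
    have := Real.pow_div_factorial_le_exp (c / 2 * ∑ i, u i ^ 2) (by positivity) r
    rw [mul_pow, div_le_iff₀ (by positivity)] at this
    rw [neg_mul, Real.exp_neg, ← div_eq_mul_inv, div_le_div_iff₀ (Real.exp_pos _) (by positivity)]
    linarith
  have h4 : Real.exp (-(c / 2) * ∑ i, u i ^ 2) ≤ 1 := by
    rw [Real.exp_le_one_iff]
    nlinarith
  rw [hsplit, ← mul_assoc]
  refine mul_le_mul_of_nonneg_right ?_ (Real.exp_pos _).le
  calc _ ≤ (1 + (∑ i, u i ^ 2) ^ r) * Real.exp (-(c / 2) * ∑ i, u i ^ 2) :=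
        mul_le_mul_of_nonneg_right h1 (Real.exp_pos _).le
    _ ≤ _ := by
        rw [add_mul, one_mul]
        exact add_le_add h4 h3

/-- Rescaling of an integral over the torus to the scale `s`. -/
lemma integral_torusBox_eq_scaled {E : Type*} [NormedAddCommGroup E] [NormedSpace ℝ E]
    (g : (ι → ℝ) → E) {s : ℝ} (hs : 0 < s) :
    s ^ Fintype.card ι • ∫ θ in torusBox ι, g θ =
      ∫ u : ι → ℝ, (torusBox ι).indicator g (s⁻¹ • u) := by
  rw [Measure.integral_comp_smul, integral_indicator measurableSet_torusBox]
  simp [abs_of_pos hs]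

lemma integral_torusBox_norm_pow_mul_exp_le {c s : ℝ} (hc : 0 < c) (hs : 0 < s) (r : ℕ) :
    s ^ Fintype.card ι * ∫ θ in torusBox ι, ‖θ‖ ^ r * Real.exp (-c * s ^ 2 * ∑ i, θ i ^ 2) ≤
      (s ^ r)⁻¹ * ∫ u : ι → ℝ, ‖u‖ ^ r * Real.exp (-c * ∑ i, u i ^ 2) := by
  rw [← smul_eq_mul, integral_torusBox_eq_scaled _ hs, ← integral_const_mul]
  refine integral_mono_of_nonneg (ae_of_all _ fun u => ?_)
    ((integrable_norm_pow_mul_exp_neg_mul_sum_sq hc r).const_mul _) (ae_of_all _ fun u => ?_)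
  · exact Set.indicator_nonneg (fun _ _ => by positivity) _
  · have : ∀ u : ι → ℝ, ‖s⁻¹ • u‖ ^ r * Real.exp (-c * s ^ 2 * ∑ i, (s⁻¹ • u) i ^ 2) =
        (s ^ r)⁻¹ * (‖u‖ ^ r * Real.exp (-c * ∑ i, u i ^ 2)) := by
      intro u
      rw [norm_smul, mul_pow, Real.norm_of_nonneg (by positivity), inv_pow, mul_assoc]
      congr 3
      simp only [Pi.smul_apply, smul_eq_mul, mul_pow, ← Finset.mul_sum]
      field_simp
    refine (Set.indicator_le_self' (fun _ _ => by positivity) _).trans (this u).le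

lemma norm_pow_sub_pow_le {a b : ℂ} (ha : ‖a‖ ≤ 1) (hb : ‖b‖ ≤ 1) (n : ℕ) :
    ‖a ^ n - b ^ n‖ ≤ n * ‖a - b‖ := by
  induction n with
  | zero => simp
  | succ n ih =>
    have e : a ^ (n + 1) - b ^ (n + 1) = a ^ n * (a - b) + (a ^ n - b ^ n) * b := by ring
    rw [e]
    refine (norm_add_le _ _).trans ?_
    rw [norm_mul, norm_mul, norm_pow]
    have h1 : ‖a‖ ^ n * ‖a - b‖ ≤ 1 * ‖a - b‖ :=
      mul_le_mul_of_nonneg_right (pow_le_one₀ (norm_nonneg _) ha) (norm_nonneg _)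
    have h2 : ‖a ^ n - b ^ n‖ * ‖b‖ ≤ n * ‖a - b‖ * 1 :=
      mul_le_mul ih hb (norm_nonneg _) (by positivity)
    push_cast
    linarith

/-- If `N (z - 1)` tends to `w` along a sequence `N → ∞`, then `z ^ N` tends to `exp w`. -/
lemma tendsto_pow_of_tendsto_mul_sub_one {N : ℕ → ℕ} (hN : Tendsto N atTop atTop) {z : ℕ → ℂ}
    (hz : ∀ᶠ k in atTop, ‖z k‖ ≤ 1) {w : ℂ} (hw : w.re ≤ 0)
    (h : Tendsto (fun k => (N k : ℂ) * (z k - 1)) atTop (𝓝 w)) :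
    Tendsto (fun k => z k ^ N k) atTop (𝓝 (Complex.exp w)) := by
  have hNC : Tendsto (fun k => (N k : ℝ)) atTop atTop := tendsto_natCast_atTop_atTop.comp hN
  have hexp : Tendsto (fun k => (N k : ℂ) * (Complex.exp (w / N k) - 1)) atTop (𝓝 w) := by
    have h1 : Tendsto (fun n : ℕ => (n : ℂ) * (Complex.exp (w / n) - 1)) atTop (𝓝 w) := by
      have hd : HasDerivAt (fun s : ℂ => Complex.exp (w * s)) w 0 := by
        simpa using ((hasDerivAt_id (0 : ℂ)).const_mul w).cexp
      have hinv : Tendsto (fun n : ℕ => ((n : ℂ))⁻¹) atTop (𝓝[≠] 0) := by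
        refine tendsto_nhdsWithin_iff.2 ⟨tendsto_inv_atTop_nhds_zero_nat (𝕜 := ℂ), ?_⟩
        filter_upwards [eventually_gt_atTop 0] with n hn
        simpa using hn.ne'
      have := (hasDerivAt_iff_tendsto_slope.1 hd).comp hinv
      refine this.congr fun n => ?_
      simp [slope, div_eq_mul_inv]
    exact h1.comp hN
  have hdiff : Tendsto (fun k => z k ^ N k - Complex.exp w) atTop (𝓝 0) := by
    have h0 : Tendsto (fun k => ‖(N k : ℂ) * (z k - 1) - (N k : ℂ) * (Complex.exp (w / N k) - 1)‖)
        atTop (𝓝 0) := by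
      simpa using (h.sub hexp).norm
    refine squeeze_zero_norm' ?_ h0
    filter_upwards [hz, hN.eventually_gt_atTop 0] with k hk hNk
    have hNk' : (N k : ℂ) ≠ 0 := by exact_mod_cast hNk.ne'
    have hb : ‖Complex.exp (w / N k)‖ ≤ 1 := by
      rw [Complex.norm_exp, Real.exp_le_one_iff, Complex.div_natCast_re]
      exact div_nonpos_of_nonpos_of_nonneg hw (Nat.cast_nonneg _)
    have he : Complex.exp w = Complex.exp (w / N k) ^ N k := by
      rw [← Complex.exp_nat_mul, mul_div_cancel₀ _ hNk']
    rw [he, ← mul_sub, sub_sub_sub_cancel_right, norm_mul, Complex.norm_natCast]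
    exact norm_pow_sub_pow_le hk hb (N k)
  simpa using hdiff.add_const (Complex.exp w)

/-- Second-order expansion of the exponential along a sequence of small phases. -/
lemma tendsto_sq_mul_exp_sub_one_sub {s v : ℕ → ℝ} (hs : Tendsto s atTop atTop) {a : ℝ}
    (hv : Tendsto v atTop (𝓝 a)) :
    Tendsto (fun k => ((s k ^ 2 : ℝ) : ℂ) * (Complex.exp (((s k)⁻¹ * v k : ℝ) * Complex.I) - 1 -
      (((s k)⁻¹ * v k : ℝ) * Complex.I))) atTop (𝓝 (-(a ^ 2 / 2 : ℝ))) := by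
  have hsmall : Tendsto (fun k => (s k)⁻¹ * v k) atTop (𝓝 0) := by
    simpa using hs.inv_tendsto_atTop.mul hv
  have hmain : Tendsto (fun k => ((-(v k ^ 2 / 2) : ℝ) : ℂ)) atTop (𝓝 (-(a ^ 2 / 2 : ℝ))) := by
    rw [← Complex.ofReal_neg]
    exact (Complex.continuous_ofReal.tendsto _).comp (((hv.pow 2).div_const 2).neg)
  have hzero : Tendsto (fun k => |v k| ^ 3 * (s k)⁻¹) atTop (𝓝 0) := by
    simpa using (hv.abs.pow 3).mul hs.inv_tendsto_atTop
  have : Tendsto (fun k => ((s k ^ 2 : ℝ) : ℂ) *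
      (Complex.exp (((s k)⁻¹ * v k : ℝ) * Complex.I) - 1 -
      (((s k)⁻¹ * v k : ℝ) * Complex.I)) - ((-(v k ^ 2 / 2) : ℝ) : ℂ)) atTop (𝓝 0) := by
    refine squeeze_zero_norm' ?_ hzero
    filter_upwards [hsmall.abs.eventually (gt_mem_nhds (show |(0 : ℝ)| < 1 by simp)),
      hs.eventually_gt_atTop 0] with k hk hsk
    set x : ℝ := (s k)⁻¹ * v k with hx
    have hvx : v k = s k * x := by rw [hx]; field_simp
    have hb := Complex.exp_bound (x := x * Complex.I) (by simpa using hk.le) (n := 3) (by norm_num)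
    have e1 : ((s k ^ 2 : ℝ) : ℂ) * (Complex.exp ((x : ℝ) * Complex.I) - 1 - ((x : ℝ) * Complex.I))
        - ((-(v k ^ 2 / 2) : ℝ) : ℂ) = ((s k ^ 2 : ℝ) : ℂ) * (Complex.exp (x * Complex.I) -
          ∑ m ∈ Finset.range 3, (x * Complex.I) ^ m / (m.factorial : ℂ)) := by
      rw [hvx]
      simp only [Finset.sum_range_succ, Finset.sum_range_zero, mul_pow, Complex.I_sq]
      push_cast
      simp [Nat.factorial]
      ring
    rw [e1, norm_mul, Complex.norm_real, Real.norm_of_nonneg (sq_nonneg _)]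
    calc _ ≤ s k ^ 2 * |x| ^ 3 := by
          refine mul_le_mul_of_nonneg_left (hb.trans ?_) (sq_nonneg _)
          rw [norm_mul, Complex.norm_I, Complex.norm_real, mul_one, Real.norm_eq_abs]
          have : (0 : ℝ) ≤ |x| ^ 3 := by positivity
          norm_num [Nat.factorial]
          nlinarith
      _ = _ := by
          have : |v k| = s k * |x| := by rw [hvx, abs_mul, abs_of_pos hsk]
          rw [this]
          field_simp
  simpa using this.add hmain

end Concentration

section Regime

/-! ### Sequences of weights with prescribed means -/

variable {T ι : Type*} [Fintype T]

/-- Probability weights `p k` on a finite family of lattice vectors `X`, with mean `ξ k`, which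
converge to strictly positive weights `q`, together with numbers of samples `N k → ∞`. -/
structure CentredRegime (X : T → ι → ℤ) (N : ℕ → ℕ) (ξ : ℕ → ι → ℝ) (p : ℕ → T → ℝ)
    (η : ι → ℝ) (q : T → ℝ) : Prop where
  tendsto_N : Tendsto N atTop atTop
  sum_eq_one : ∀ k, ∑ t, p k t = 1
  nonneg : ∀ k t, 0 ≤ p k t
  mean_eq : ∀ᶠ k in atTop, ∀ i, ∑ t, p k t * X t i = ξ k i
  tendsto_weight : ∀ t, Tendsto (fun k => p k t) atTop (𝓝 (q t))
  tendsto_mean : ∀ i, Tendsto (fun k => ξ k i) atTop (𝓝 (η i))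
  pos : ∀ t, 0 < q t

/-- The family `X` contains `0` and all unit vectors. -/
structure Spanning [DecidableEq ι] (X : T → ι → ℤ) : Prop where
  exists_zero : ∃ t, ∀ i, X t i = 0
  exists_single : ∀ i, ∃ t, ∀ j, X t j = if j = i then 1 else 0

variable {X : T → ι → ℤ} {N : ℕ → ℕ} {ξ : ℕ → ι → ℝ} {p : ℕ → T → ℝ}
  {η : ι → ℝ} {q : T → ℝ}

namespace CentredRegime

lemma tendsto_sqrt (h : CentredRegime X N ξ p η q) :
    Tendsto (fun k => √(N k : ℝ)) atTop atTop :=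
  Real.tendsto_sqrt_atTop.comp (tendsto_natCast_atTop_atTop.comp h.tendsto_N)

variable [Fintype ι]

lemma exists_norm_transform_one_le [DecidableEq ι] (h : CentredRegime X N ξ p η q) (hX : Spanning X) :
    ∃ c > 0, ∀ᶠ k in atTop, ∀ θ ∈ torusBox ι,
      ‖transform X (ξ k) (p k) (fun _ => 1) θ‖ ≤ Real.exp (-c * ∑ i, θ i ^ 2) := by
  obtain ⟨t₀, ht₀⟩ := hX.exists_zero
  choose e he using hX.exists_single
  obtain ⟨p₀, hp₀, hle⟩ : ∃ p₀ > 0, ∀ t, p₀ < q t := by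
    obtain ⟨t, ht⟩ := @Finite.exists_min T ℝ _ ⟨t₀⟩ _ q
    exact ⟨q t / 2, half_pos (h.pos t), fun s => (half_lt_self (h.pos t)).trans_le (ht s)⟩
  refine ⟨p₀ ^ 2 * (2 / Real.pi ^ 2), by positivity, ?_⟩
  have : ∀ᶠ k in atTop, ∀ t, p₀ < p k t :=
    eventually_all.2 fun t => (h.tendsto_weight t).eventually (lt_mem_nhds (hle t))
  filter_upwards [this] with k hk θ hθ
  exact norm_transform_one_le_exp X (ξ k) (p k) hp₀.le (fun t => (hk t).le) (h.sum_eq_one k)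
    t₀ ht₀ e he hθ

lemma tendsto_phase (h : CentredRegime X N ξ p η q) (u : ι → ℝ) (t : T) :
    Tendsto (fun k => phase X (ξ k) u t) atTop (𝓝 (phase X η u t)) :=
  tendsto_finsetSum _ fun i _ => (tendsto_const_nhds.sub (h.tendsto_mean i)).const_mul _

lemma tendsto_transform_pow (h : CentredRegime X N ξ p η q) (u : ι → ℝ) :
    Tendsto (fun k => transform X (ξ k) (p k) (fun _ => 1) ((√(N k : ℝ))⁻¹ • u) ^ N k) atTop
      (𝓝 ((Real.exp (-∑ t, q t * (phase X η u t ^ 2 / 2)) : ℝ) : ℂ)) := by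
  rw [Complex.ofReal_exp]
  refine tendsto_pow_of_tendsto_mul_sub_one h.tendsto_N ?_ ?_ ?_
  · exact Eventually.of_forall fun k => norm_transform_le X (ξ k) (p k) _ (h.nonneg k)
      (h.sum_eq_one k) (K := 1) (by simp) _
  · rw [Complex.ofReal_re, neg_nonpos]
    exact Finset.sum_nonneg fun t _ => mul_nonneg (h.pos t).le (by positivity)
  · have h1 : Tendsto (fun k => ∑ t, ((p k t : ℝ) : ℂ) * (((√(N k : ℝ) ^ 2 : ℝ) : ℂ) *
        (Complex.exp (((√(N k : ℝ))⁻¹ * phase X (ξ k) u t : ℝ) * Complex.I) - 1 -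
        (((√(N k : ℝ))⁻¹ * phase X (ξ k) u t : ℝ) * Complex.I)))) atTop
        (𝓝 (∑ t, (q t : ℂ) * (-(phase X η u t ^ 2 / 2 : ℝ)))) :=
      tendsto_finsetSum _ fun t _ =>
        ((Complex.continuous_ofReal.tendsto _).comp (h.tendsto_weight t)).mul
          (tendsto_sq_mul_exp_sub_one_sub h.tendsto_sqrt (h.tendsto_phase u t))
    have h2 : ((-∑ t, q t * (phase X η u t ^ 2 / 2) : ℝ) : ℂ) =
        ∑ t, (q t : ℂ) * (-(phase X η u t ^ 2 / 2 : ℝ)) := by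
      push_cast
      simp
    rw [h2]
    refine h1.congr' ?_
    filter_upwards [h.mean_eq] with k hk
    have hs : ∀ t, phase X (ξ k) ((√(N k : ℝ))⁻¹ • u) t = (√(N k : ℝ))⁻¹ * phase X (ξ k) u t := by
      intro t
      simp [phase, Finset.mul_sum, mul_assoc]
    have hmean : ∑ t, p k t * phase X (ξ k) u t = 0 := by
      simp_rw [phase, Finset.mul_sum]
      rw [Finset.sum_comm]
      refine Finset.sum_eq_zero fun i _ => ?_
      have : ∑ t, p k t * (u i * ((X t i : ℝ) - ξ k i)) =
          u i * (∑ t, p k t * X t i - (∑ t, p k t) * ξ k i) := by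
        rw [Finset.sum_mul, ← Finset.sum_sub_distrib, Finset.mul_sum]
        exact Finset.sum_congr rfl fun t _ => by ring
      rw [this, hk i, h.sum_eq_one k]
      ring
    have hmean' : ∑ t, (p k t : ℂ) *
        (((√(N k : ℝ))⁻¹ * phase X (ξ k) u t : ℝ) * Complex.I) = 0 := by
      have : ∑ t, (p k t : ℂ) * (((√(N k : ℝ))⁻¹ * phase X (ξ k) u t : ℝ) * Complex.I) =
          (((√(N k : ℝ))⁻¹ * ∑ t, p k t * phase X (ξ k) u t : ℝ) : ℂ) * Complex.I := by
        rw [Finset.mul_sum, Complex.ofReal_sum, Finset.sum_mul]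
        refine Finset.sum_congr rfl fun t _ => ?_
        push_cast
        ring
      rw [this, hmean]
      simp
    have hone : ∑ t, (p k t : ℂ) = 1 := by
      rw [← Complex.ofReal_sum, h.sum_eq_one k, Complex.ofReal_one]
    have e1 : ∀ t, ((p k t : ℝ) : ℂ) * (((√(N k : ℝ) ^ 2 : ℝ) : ℂ) *
        (Complex.exp (((√(N k : ℝ))⁻¹ * phase X (ξ k) u t : ℝ) * Complex.I) - 1 -
        (((√(N k : ℝ))⁻¹ * phase X (ξ k) u t : ℝ) * Complex.I))) = (N k : ℂ) *
        ((p k t : ℂ) * Complex.exp (((√(N k : ℝ))⁻¹ * phase X (ξ k) u t : ℝ) * Complex.I) -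
        p k t - (p k t : ℂ) * (((√(N k : ℝ))⁻¹ * phase X (ξ k) u t : ℝ) * Complex.I)) := by
      intro t
      rw [Real.sq_sqrt (Nat.cast_nonneg _)]
      push_cast
      ring
    simp_rw [e1]
    rw [← Finset.mul_sum, Finset.sum_sub_distrib, Finset.sum_sub_distrib, hmean', hone, sub_zero]
    simp [transform, hs]

/-- The inversion integral, rescaled by `√N` in each direction, has a positive limit: the
integral of a nondegenerate Gaussian density. -/
lemma exists_tendsto_integral [DecidableEq ι] (h : CentredRegime X N ξ p η q) (hX : Spanning X) :
    ∃ g > 0, Tendsto (fun k => √(N k : ℝ) ^ Fintype.card ι *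
      ‖∫ θ in torusBox ι, transform X (ξ k) (p k) (fun _ => 1) θ ^ N k‖) atTop (𝓝 g) := by
  obtain ⟨c, hc, hle⟩ := h.exists_norm_transform_one_le hX
  set F : ℕ → (ι → ℝ) → ℂ := fun k u =>
    (torusBox ι).indicator (fun θ => transform X (ξ k) (p k) (fun _ => 1) θ ^ N k)
      ((√(N k : ℝ))⁻¹ • u) with hF
  set G : (ι → ℝ) → ℝ := fun u => Real.exp (-∑ t, q t * (phase X η u t ^ 2 / 2)) with hG
  have hbound : ∀ᶠ k in atTop, ∀ u, ‖F k u‖ ≤ Real.exp (-c * ∑ i, u i ^ 2) := by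
    filter_upwards [hle, h.tendsto_N.eventually_gt_atTop 0] with k hk hNk u
    rw [hF]
    by_cases hu : (√(N k : ℝ))⁻¹ • u ∈ torusBox ι
    · simp only [Set.indicator_of_mem hu, norm_pow]
      refine (pow_le_pow_left₀ (norm_nonneg _) (hk _ hu) (N k)).trans_eq ?_
      rw [← Real.exp_nat_mul]
      congr 1
      have hN0 : (0 : ℝ) < N k := by exact_mod_cast hNk
      simp only [Pi.smul_apply, smul_eq_mul, mul_pow, ← Finset.mul_sum, inv_pow,
        Real.sq_sqrt hN0.le]
      field_simp
    · simp only [Set.indicator_of_notMem hu, norm_zero]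
      positivity
  have hlim : ∀ u, Tendsto (fun k => F k u) atTop (𝓝 (G u : ℂ)) := by
    intro u
    refine (h.tendsto_transform_pow u).congr' ?_
    have hsmall : ∀ i, Tendsto (fun k => (√(N k : ℝ))⁻¹ * u i) atTop (𝓝 0) := by
      intro i
      simpa using h.tendsto_sqrt.inv_tendsto_atTop.mul_const (u i)
    have hmem : ∀ᶠ k in atTop, ∀ i, (√(N k : ℝ))⁻¹ * u i ∈ Set.Ioc (-Real.pi) Real.pi := by
      refine eventually_all.2 fun i => (hsmall i).eventually ?_
      exact Ioc_mem_nhds (by linarith [Real.pi_pos]) Real.pi_pos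
    filter_upwards [hmem] with k hk
    rw [hF]
    simp only
    rw [Set.indicator_of_mem]
    exact fun i _ => hk i
  have hGle : ∀ u, ‖G u‖ ≤ Real.exp (-c * ∑ i, u i ^ 2) := by
    intro u
    have := le_of_tendsto (hlim u).norm (hbound.mono fun k hk => hk u)
    simpa using this
  have hGint : Integrable G := by
    refine (integrable_exp_neg_mul_sum_sq (ι := ι) hc).mono' ?_ (ae_of_all _ hGle)
    refine Continuous.aestronglyMeasurable ?_
    rw [hG]
    unfold phase
    fun_prop
  have hconv : Tendsto (fun k => ∫ u, F k u) atTop (𝓝 (∫ u, (G u : ℂ))) := by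
    refine tendsto_integral_filter_of_dominated_convergence
      (fun u => Real.exp (-c * ∑ i, u i ^ 2)) (Eventually.of_forall fun k => ?_)
      (hbound.mono fun k hk => ae_of_all _ hk) (integrable_exp_neg_mul_sum_sq hc)
      (ae_of_all _ hlim)
    exact ((((continuous_transform _ _ _ _).pow _).measurable.indicator
      measurableSet_torusBox).comp (measurable_const_smul _)).aestronglyMeasurable
  refine ⟨∫ u, G u, integral_exp_pos hGint, ?_⟩
  have := hconv.norm
  rw [integral_complex_ofReal, Complex.norm_real, Real.norm_of_nonneg
    (integral_nonneg fun u => (Real.exp_pos _).le)] at this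
  refine this.congr' ?_
  filter_upwards [h.tendsto_sqrt.eventually_gt_atTop 0] with k hk
  rw [hF]
  simp only
  rw [← integral_torusBox_eq_scaled _ hk, norm_smul, Real.norm_of_nonneg (by positivity)]

/-- Moments of the characteristic function around the origin are small relative to the inversion
integral: each power of `‖θ‖` gains a factor `N ^ (-1/2)`. -/
lemma exists_integral_norm_pow_mul_le [DecidableEq ι] (h : CentredRegime X N ξ p η q)
    (hX : Spanning X) (r : ℕ) :
    ∃ C, ∀ᶠ k in atTop, ∫ θ in torusBox ι, ‖θ‖ ^ r *
        ‖transform X (ξ k) (p k) (fun _ => 1) θ‖ ^ (N k - 2) ≤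
      C * (√(N k : ℝ) ^ r)⁻¹ *
        ‖∫ θ in torusBox ι, transform X (ξ k) (p k) (fun _ => 1) θ ^ N k‖ := by
  obtain ⟨c, hc, hle⟩ := h.exists_norm_transform_one_le hX
  obtain ⟨g, hg, hlim⟩ := h.exists_tendsto_integral hX
  set A := ∫ u : ι → ℝ, ‖u‖ ^ r * Real.exp (-(c / 2) * ∑ i, u i ^ 2) with hA
  have hA0 : 0 ≤ A := integral_nonneg fun u => by positivity
  refine ⟨A * (2 / g), ?_⟩
  filter_upwards [hle, hlim.eventually (lt_mem_nhds (half_lt_self hg)),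
    h.tendsto_sqrt.eventually_gt_atTop 0, h.tendsto_N.eventually_ge_atTop 4] with k hk hgk hsk hNk
  have hs2 : √(N k : ℝ) ^ 2 = N k := Real.sq_sqrt (Nat.cast_nonneg _)
  set s := √(N k : ℝ) with hs
  have h1 : ∫ θ in torusBox ι, ‖θ‖ ^ r *
      ‖transform X (ξ k) (p k) (fun _ => 1) θ‖ ^ (N k - 2) ≤
      ∫ θ in torusBox ι, ‖θ‖ ^ r * Real.exp (-(c / 2) * s ^ 2 * ∑ i, θ i ^ 2) := by
    refine setIntegral_mono_on ?_ ?_ measurableSet_torusBox fun θ hθ => ?_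
    · exact integrableOn_torusBox ((continuous_norm.pow r).mul
        ((continuous_transform _ _ _ _).norm.pow _))
    · exact integrableOn_torusBox (by fun_prop)
    · refine mul_le_mul_of_nonneg_left ?_ (by positivity)
      refine (pow_le_pow_left₀ (norm_nonneg _) (hk θ hθ) _).trans ?_
      rw [← Real.exp_nat_mul, Real.exp_le_exp, hs2, Nat.cast_sub (by lia)]
      have h4 : (4 : ℝ) ≤ N k := by exact_mod_cast hNk
      have h0 : (0 : ℝ) ≤ c * ∑ i, θ i ^ 2 :=
        mul_nonneg hc.le (Finset.sum_nonneg fun i _ => sq_nonneg _)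
      push_cast
      nlinarith
  have h2 := integral_torusBox_norm_pow_mul_exp_le (ι := ι) (half_pos hc) hsk r
  rw [← hA] at h2
  have hpos : 0 < s ^ Fintype.card ι := by positivity
  refine h1.trans ?_
  refine le_of_mul_le_mul_left (h2.trans ?_) hpos
  have hr : 0 ≤ (s ^ r)⁻¹ * A := by positivity
  set I := ‖∫ θ in torusBox ι, transform X (ξ k) (p k) (fun _ => 1) θ ^ N k‖
  calc (s ^ r)⁻¹ * A = (s ^ r)⁻¹ * A * (2 / g) * (g / 2) := by field_simp
    _ ≤ (s ^ r)⁻¹ * A * (2 / g) * (s ^ Fintype.card ι * I) :=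
        mul_le_mul_of_nonneg_left hgk.le (by positivity)
    _ = _ := by ring

end CentredRegime

end Regime

section FiberMean

/-! ### Averages over the fiber -/

variable {T ι : Type*} [Fintype T] [Fintype ι]

/-- The average of `F` over the maps `m : Fin N → T` with `∑_c X(m c) = x`. -/
def fiberMean (X : T → ι → ℤ) (N : ℕ) (x : ι → ℤ) (F : (Fin N → T) → ℝ) : ℝ :=
  (∑ m ∈ fiber X N x, F m) / (fiber X N x).card

lemma fiberMean_add (X : T → ι → ℤ) (N : ℕ) (x : ι → ℤ) (F G : (Fin N → T) → ℝ) :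
    fiberMean X N x (fun m => F m + G m) = fiberMean X N x F + fiberMean X N x G := by
  simp [fiberMean, Finset.sum_add_distrib, add_div]

lemma fiberMean_sum {κ : Type*} (s : Finset κ) (X : T → ι → ℤ) (N : ℕ) (x : ι → ℤ)
    (F : κ → (Fin N → T) → ℝ) :
    fiberMean X N x (fun m => ∑ c ∈ s, F c m) = ∑ c ∈ s, fiberMean X N x (F c) := by
  simp only [fiberMean]
  rw [Finset.sum_comm, Finset.sum_div]

lemma fiberMean_const {X : T → ι → ℤ} {N : ℕ} {x : ι → ℤ} (h : (fiber X N x).Nonempty) (a : ℝ) :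
    fiberMean X N x (fun _ => a) = a := by
  have : ((fiber X N x).card : ℝ) ≠ 0 := by exact_mod_cast h.card_pos.ne'
  simp [fiberMean, this]

lemma fiberMean_const_mul (X : T → ι → ℤ) (N : ℕ) (x : ι → ℤ) (a : ℝ) (F : (Fin N → T) → ℝ) :
    fiberMean X N x (fun m => a * F m) = a * fiberMean X N x F := by
  simp only [fiberMean, ← Finset.mul_sum, mul_div_assoc]

lemma fiberMean_congr {X : T → ι → ℤ} {N : ℕ} {x : ι → ℤ} {F G : (Fin N → T) → ℝ}
    (h : ∀ m ∈ fiber X N x, F m = G m) : fiberMean X N x F = fiberMean X N x G := by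
  simp only [fiberMean]
  rw [Finset.sum_congr rfl h]

/-- The variance over the fiber. -/
def fiberVariance (X : T → ι → ℤ) (N : ℕ) (x : ι → ℤ) (F : (Fin N → T) → ℝ) : ℝ :=
  fiberMean X N x (fun m => F m ^ 2) - fiberMean X N x F ^ 2

lemma fiberVariance_add_const {X : T → ι → ℤ} {N : ℕ} {x : ι → ℤ} (h : (fiber X N x).Nonempty)
    (F : (Fin N → T) → ℝ) (a : ℝ) :
    fiberVariance X N x (fun m => F m + a) = fiberVariance X N x F := by
  have e : (fun m : Fin N → T => (F m + a) ^ 2) = fun m => F m ^ 2 + (2 * a * F m + a ^ 2) := by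
    ext m
    ring
  rw [fiberVariance, e, fiberMean_add, fiberMean_add, fiberMean_add, fiberMean_const_mul,
    fiberMean_const h, fiberMean_const h, fiberVariance]
  ring

/-- The exponentially tilted uniform weights. -/
def tilt (X : T → ι → ℤ) (h : ι → ℝ) (t : T) : ℝ :=
  Real.exp (∑ i, h i * X t i) / ∑ s, Real.exp (∑ i, h i * X s i)

lemma tilt_pos (X : T → ι → ℤ) (h : ι → ℝ) (t : T) : 0 < tilt X h t :=
  div_pos (Real.exp_pos _) (Finset.sum_pos (fun _ _ => Real.exp_pos _) ⟨t, Finset.mem_univ t⟩)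

lemma sum_tilt [Nonempty T] (X : T → ι → ℤ) (h : ι → ℝ) : ∑ t, tilt X h t = 1 := by
  have : (0 : ℝ) < ∑ s, Real.exp (∑ i, h i * X s i) :=
    Finset.sum_pos (fun _ _ => Real.exp_pos _) Finset.univ_nonempty
  simp only [tilt]
  rw [← Finset.sum_div, div_self this.ne']

/-- The tilted weight is constant on the fiber, so tilting does not change averages over it. -/
lemma prod_tilt_eq {X : T → ι → ℤ} (h : ι → ℝ) {N : ℕ} {x : ι → ℤ} {m : Fin N → T}
    (hm : m ∈ fiber X N x) :
    ∏ c, tilt X h (m c) =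
      Real.exp (∑ i, h i * x i) / (∑ s, Real.exp (∑ i, h i * X s i)) ^ N := by
  have hx : ∀ i, ∑ c, X (m c) i = x i := by simpa [fiber] using hm
  simp only [tilt]
  rw [Finset.prod_div_distrib, ← Real.exp_sum, Finset.sum_comm, Finset.prod_const,
    Finset.card_univ, Fintype.card_fin]
  simp_rw [← Finset.mul_sum, ← hx]
  push_cast
  rfl

/-- Averages of product functions over the fiber are ratios of Fourier integrals. -/
lemma fiberMean_prod_mul_integral [Nonempty T] {X : T → ι → ℤ} {N : ℕ} {x : ι → ℤ} {ξ : ι → ℝ}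
    (hξ : ∀ i, N * ξ i = x i) (hne : (fiber X N x).Nonempty) (h : ι → ℝ) (f : Fin N → T → ℝ) :
    (fiberMean X N x (fun m => ∏ c, f c (m c)) : ℂ) *
        ∫ θ in torusBox ι, transform X ξ (tilt X h) (fun _ => 1) θ ^ N =
      ∫ θ in torusBox ι, ∏ c, transform X ξ (tilt X h) (f c) θ := by
  have h1 := integral_prod_transform X N x ξ hξ (tilt X h) fun _ _ => 1
  simp only [Finset.prod_const, Finset.card_univ, Fintype.card_fin, one_pow, mul_one] at h1
  rw [h1, integral_prod_transform X N x ξ hξ]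
  have h2 : ∀ m ∈ fiber X N x, (∏ c, tilt X h (m c)) * ∏ c, f c (m c) =
      Real.exp (∑ i, h i * x i) / (∑ s, Real.exp (∑ i, h i * X s i)) ^ N * ∏ c, f c (m c) :=
    fun m hm => by rw [prod_tilt_eq h hm]
  rw [Finset.sum_congr rfl fun m hm => prod_tilt_eq h hm, Finset.sum_congr rfl h2,
    ← Finset.mul_sum, fiberMean, Finset.sum_const, nsmul_eq_mul]
  have : ((fiber X N x).card : ℂ) ≠ 0 := by exact_mod_cast hne.card_pos.ne'
  push_cast
  field_simp

/-- The correlation of two samples is bounded by an integral in which the other `N - 2` samples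
contribute powers of the characteristic function. -/
lemma abs_fiberMean_pair_mul_le [Nonempty T] {X : T → ι → ℤ} {N : ℕ} {x : ι → ℤ} {ξ : ι → ℝ}
    (hξ : ∀ i, N * ξ i = x i) (hne : (fiber X N x).Nonempty) (h : ι → ℝ) (f g : T → ℝ)
    {c d : Fin N} (hcd : c ≠ d) :
    |fiberMean X N x (fun m => f (m c) * g (m d))| *
        ‖∫ θ in torusBox ι, transform X ξ (tilt X h) (fun _ => 1) θ ^ N‖ ≤
      ∫ θ in torusBox ι, ‖transform X ξ (tilt X h) f θ‖ * ‖transform X ξ (tilt X h) g θ‖ *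
        ‖transform X ξ (tilt X h) (fun _ => 1) θ‖ ^ (N - 2) := by
  set F : Fin N → T → ℝ := fun b => if b = c then f else if b = d then g else fun _ => 1 with hF
  have hsplit : ∀ {M : Type} [CommMonoid M] (G : Fin N → M) (a : M),
      (∀ b, b ≠ c → b ≠ d → G b = a) → ∏ b, G b = G c * G d * a ^ (N - 2) := by
    intro M _ G a hG
    rw [← Finset.mul_prod_erase _ _ (Finset.mem_univ c),
      ← Finset.mul_prod_erase _ _ (Finset.mem_erase.2 ⟨hcd.symm, Finset.mem_univ d⟩), mul_assoc]
    congr 2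
    rw [Finset.prod_congr rfl fun b hb => hG b (by simp at hb; tauto) (by simp at hb; tauto),
      Finset.prod_const, Finset.card_erase_of_mem (Finset.mem_erase.2 ⟨hcd.symm, Finset.mem_univ d⟩),
      Finset.card_erase_of_mem (Finset.mem_univ c), Finset.card_univ, Fintype.card_fin]
    rfl
  have hFc : F c = f := by simp [hF]
  have hFd : F d = g := by simp [hF, hcd.symm]
  have hFb : ∀ b, b ≠ c → b ≠ d → F b = fun _ => 1 := by
    intro b h1 h2
    simp [hF, h1, h2]
  have key := fiberMean_prod_mul_integral hξ hne h F
  have e1 : (fun m : Fin N → T => ∏ b, F b (m b)) = fun m => f (m c) * g (m d) := by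
    ext m
    rw [hsplit (fun b => F b (m b)) 1 fun b h1 h2 => by rw [hFb b h1 h2], hFc, hFd]
    simp
  have e2 : ∀ θ, ∏ b, transform X ξ (tilt X h) (F b) θ = transform X ξ (tilt X h) f θ *
      transform X ξ (tilt X h) g θ * transform X ξ (tilt X h) (fun _ => 1) θ ^ (N - 2) := by
    intro θ
    rw [hsplit (fun b => transform X ξ (tilt X h) (F b) θ) _ fun b h1 h2 => by rw [hFb b h1 h2],
      hFc, hFd]
  simp_rw [e1, e2] at key
  have := congrArg norm key
  rw [norm_mul, Complex.norm_real, Real.norm_eq_abs] at this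
  rw [this]
  refine (norm_integral_le_integral_norm _).trans_eq ?_
  simp_rw [norm_mul, norm_pow]

end FiberMean

section Tilt

/-! ### Existence of the tilt -/

variable {T ι : Type*} [Fintype T] [Fintype ι]

/-- The mean of `X` under the tilted weights. -/
def tiltMean (X : T → ι → ℤ) (h : ι → ℝ) (i : ι) : ℝ :=
  ∑ t, tilt X h t * X t i

lemma continuous_tilt [Nonempty T] (X : T → ι → ℤ) (t : T) : Continuous fun h => tilt X h t := by
  unfold tilt
  refine Continuous.div (by fun_prop) (by fun_prop) fun h => ?_
  exact (Finset.sum_pos (fun _ _ => Real.exp_pos _) Finset.univ_nonempty).ne'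

lemma tilt_zero (X : T → ι → ℤ) (t : T) : tilt X 0 t = (Fintype.card T : ℝ)⁻¹ := by
  simp [tilt]

/-- The covariance operator of `X` under the uniform weights. -/
def covOperator (X : T → ι → ℤ) : (ι → ℝ) →ₗ[ℝ] (ι → ℝ) where
  toFun v i := (Fintype.card T : ℝ)⁻¹ *
    ∑ t, (∑ j, v j * (X t j - tiltMean X 0 j)) * (X t i - tiltMean X 0 i)
  map_add' v w := by
    ext i
    simp only [Pi.add_apply, add_mul, Finset.sum_add_distrib, mul_add]
  map_smul' a v := by
    ext i
    simp only [Pi.smul_apply, smul_eq_mul, RingHom.id_apply, mul_assoc, ← Finset.mul_sum]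
    ring

lemma covOperator_injective [DecidableEq ι] (X : T → ι → ℤ) (hX : Spanning X) :
    Function.Injective (covOperator X) := by
  rw [injective_iff_map_eq_zero]
  intro v hv
  obtain ⟨t₀, ht₀⟩ := hX.exists_zero
  have : Nonempty T := ⟨t₀⟩
  have hcard : (0 : ℝ) < (Fintype.card T : ℝ)⁻¹ := by positivity
  set Y : T → ℝ := fun t => ∑ j, v j * (X t j - tiltMean X 0 j) with hY
  have hsq : ∑ t, Y t ^ 2 = 0 := by
    have h1 : ∑ i, v i * covOperator X v i = (Fintype.card T : ℝ)⁻¹ * ∑ t, Y t ^ 2 := by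
      simp only [covOperator, LinearMap.coe_mk, AddHom.coe_mk]
      simp_rw [Finset.mul_sum]
      rw [Finset.sum_comm]
      refine Finset.sum_congr rfl fun t _ => ?_
      have : Y t ^ 2 = ∑ i, v i * (Y t * (X t i - tiltMean X 0 i)) := by
        rw [sq]
        conv_lhs => enter [2]; rw [hY]
        simp only
        rw [Finset.mul_sum]
        exact Finset.sum_congr rfl fun i _ => by ring
      rw [this, Finset.mul_sum]
      exact Finset.sum_congr rfl fun i _ => by ring
    rw [hv] at h1
    simpa [hcard.ne'] using h1
  have hzero : ∀ t, Y t = 0 := by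
    intro t
    have := (Finset.sum_eq_zero_iff_of_nonneg fun t _ => sq_nonneg (Y t)).1 hsq t (Finset.mem_univ t)
    exact pow_eq_zero_iff two_ne_zero |>.1 this
  ext i
  obtain ⟨t, ht⟩ := hX.exists_single i
  have h1 : Y t - Y t₀ = v i := by
    simp only [hY]
    rw [← Finset.sum_sub_distrib]
    simp_rw [← mul_sub, sub_sub_sub_cancel_right, ht, ht₀]
    simp
  rw [← h1, hzero, hzero]
  simp

/-- At the uniform weights, the derivative of the mean with respect to the tilt is the covariance
operator, which is invertible. -/
lemma hasStrictFDerivAt_tiltMean [Nonempty T] (X : T → ι → ℤ) :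
    HasStrictFDerivAt (tiltMean X) (LinearMap.toContinuousLinearMap (covOperator X)) 0 := by
  rw [hasStrictFDerivAt_pi']
  intro i
  set L : T → (ι → ℝ) →L[ℝ] ℝ := fun t => ∑ j, (X t j : ℝ) • ContinuousLinearMap.proj j with hL
  have hLa : ∀ t h, L t h = ∑ j, h j * X t j := by
    intro t h
    simp [hL, mul_comm]
  have hexp : ∀ t, HasStrictFDerivAt (fun h : ι → ℝ => Real.exp (∑ j, h j * X t j)) (L t) 0 := by
    intro t
    have := (L t).hasStrictFDerivAt (x := 0) |>.exp
    simpa [hLa] using this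
  have hnum : HasStrictFDerivAt (fun h : ι → ℝ => ∑ t, Real.exp (∑ j, h j * X t j) * (X t i : ℝ))
      (∑ t, (X t i : ℝ) • L t) 0 :=
    HasStrictFDerivAt.fun_sum fun t _ => (hexp t).mul_const _
  have hden : HasStrictFDerivAt (fun h : ι → ℝ => ∑ t, Real.exp (∑ j, h j * X t j))
      (∑ t, L t) 0 :=
    HasStrictFDerivAt.fun_sum fun t _ => hexp t
  have hn : (Fintype.card T : ℝ) ≠ 0 := by positivity
  have hne : ∑ t : T, Real.exp (∑ j, (0 : ι → ℝ) j * X t j) ≠ 0 := by simp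
  have hdiv := hnum.fun_mul ((hasStrictDerivAt_inv hne).comp_hasStrictFDerivAt 0 hden)
  have e : (fun h => tiltMean X h i) = fun h : ι → ℝ =>
      (∑ t, Real.exp (∑ j, h j * X t j) * (X t i : ℝ)) * (∑ t, Real.exp (∑ j, h j * X t j))⁻¹ := by
    ext h
    simp only [tiltMean, tilt]
    rw [Finset.sum_mul]
    exact Finset.sum_congr rfl fun t _ => by ring
  rw [e]
  refine hdiv.congr_fderiv ?_
  have hv : ∀ v : ι → ℝ, ∀ t, ∑ j, v j * ((X t j : ℝ) - tiltMean X 0 j) =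
      L t v - (Fintype.card T : ℝ)⁻¹ * ∑ s, L s v := by
    intro v t
    simp only [hLa, mul_sub, Finset.sum_sub_distrib, tiltMean, tilt_zero, ← Finset.mul_sum]
    congr 1
    rw [Finset.sum_comm (s := Finset.univ (α := T))]
    simp only [Finset.mul_sum]
    exact Finset.sum_congr rfl fun j _ => Finset.sum_congr rfl fun t _ => by ring
  ext1 v
  have hr : (ContinuousLinearMap.proj i ∘SL LinearMap.toContinuousLinearMap (covOperator X)) v =
      (Fintype.card T : ℝ)⁻¹ * ∑ t, (L t v - (Fintype.card T : ℝ)⁻¹ * ∑ s, L s v) *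
        (X t i - (Fintype.card T : ℝ)⁻¹ * ∑ s, (X s i : ℝ)) := by
    simp only [← hv]
    simp [covOperator, tiltMean, tilt_zero, ← Finset.mul_sum]
  have hm : ∀ a b : ℝ, ∑ t, (L t v - a) * (X t i - b) =
      ∑ t, X t i * L t v - b * ∑ t, L t v - a * ∑ t, (X t i : ℝ) + Fintype.card T * (a * b) := by
    intro a b
    rw [Finset.mul_sum, Finset.mul_sum, ← Finset.sum_sub_distrib, ← Finset.sum_sub_distrib,
      ← nsmul_eq_mul, ← Finset.card_univ, ← Finset.sum_const, ← Finset.sum_add_distrib]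
    exact Finset.sum_congr rfl fun t _ => by ring
  rw [hr, hm]
  simp only [Pi.zero_apply, zero_mul, Finset.sum_const_zero, Real.exp_zero, one_mul,
    Finset.sum_const, Finset.card_univ, nsmul_eq_mul, mul_one, Function.comp_apply, neg_smul,
    smul_neg, add_apply, neg_apply, smul_apply, sum_apply, smul_eq_mul]
  field_simp
  ring

/-- Means close to the mean of the uniform weights are attained by small tilts. -/
lemma exists_tilt [Nonempty T] [DecidableEq ι] (X : T → ι → ℤ) (hX : Spanning X) {ξ : ℕ → ι → ℝ}
    (hξ : ∀ i, Tendsto (fun k => ξ k i) atTop (𝓝 ((Fintype.card T : ℝ)⁻¹ * ∑ t, (X t i : ℝ)))) :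
    ∃ h : ℕ → ι → ℝ, Tendsto h atTop (𝓝 0) ∧
      ∀ᶠ k in atTop, ∀ i, ∑ t, tilt X (h k) t * X t i = ξ k i := by
  set e : (ι → ℝ) ≃L[ℝ] (ι → ℝ) :=
    (LinearEquiv.ofInjectiveEndo (covOperator X)
      (covOperator_injective X hX)).toContinuousLinearEquiv with he
  have hd : HasStrictFDerivAt (tiltMean X) (e : (ι → ℝ) →L[ℝ] (ι → ℝ)) 0 := by
    exact hasStrictFDerivAt_tiltMean X
  have hξ' : Tendsto ξ atTop (𝓝 (tiltMean X 0)) := by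
    rw [tendsto_pi_nhds]
    intro i
    convert hξ i using 2
    simp only [tiltMean, tilt_zero, Finset.mul_sum]
  refine ⟨fun k => hd.localInverse _ _ _ (ξ k), hd.localInverse_tendsto.comp hξ', ?_⟩
  filter_upwards [hξ'.eventually hd.eventually_right_inverse] with k hk i
  exact congrFun hk i

end Tilt

section Asymptotics

/-! ### Decay of correlations on a fiber -/

variable {T ι : Type*} [Fintype T] [Fintype ι] [DecidableEq ι] [Nonempty T]
  {X : T → ι → ℤ} {N : ℕ → ℕ} {x : ℕ → ι → ℤ} {h : ℕ → ι → ℝ} {η : ι → ℝ} {q : T → ℝ}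

omit [DecidableEq ι] [Nonempty T] in
lemma CentredRegime.exists_abs_sub_le {ξ : ℕ → ι → ℝ} {p : ℕ → T → ℝ}
    (hR : CentredRegime X N ξ p η q) :
    ∃ R, ∀ᶠ k in atTop, ∀ t i, |(X t i : ℝ) - ξ k i| ≤ R := by
  refine ⟨∑ t, ∑ i, (|(X t i : ℝ) - η i| + 1), ?_⟩
  refine eventually_all.2 fun t => eventually_all.2 fun i => ?_
  have h1 : Tendsto (fun k => |(X t i : ℝ) - ξ k i|) atTop (𝓝 |(X t i : ℝ) - η i|) :=
    (tendsto_const_nhds.sub (hR.tendsto_mean i)).abs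
  filter_upwards [h1.eventually (gt_mem_nhds (lt_add_one _))] with k hk
  refine hk.le.trans ?_
  refine (Finset.single_le_sum (f := fun i => |(X t i : ℝ) - η i| + 1)
    (fun i _ => by positivity) (Finset.mem_univ i)).trans ?_
  exact Finset.single_le_sum (f := fun t => ∑ i, (|(X t i : ℝ) - η i| + 1))
    (fun t _ => Finset.sum_nonneg fun i _ => by positivity) (Finset.mem_univ t)

/-- A centred function of a single sample has mean of order `N ^ (-1/2)`. -/
lemma exists_abs_fiberMean_single_le
    (hR : CentredRegime X N (fun k i => (x k i : ℝ) / N k) (fun k => tilt X (h k)) η q)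
    (hX : Spanning X) (hne : ∀ k, (fiber X (N k) (x k)).Nonempty) (K : ℝ) :
    ∃ C, ∀ᶠ k in atTop, ∀ f : T → ℝ, (∀ t, |f t| ≤ K) → ∑ t, tilt X (h k) t * f t = 0 →
      ∀ c, |fiberMean X (N k) (x k) (fun m => f (m c))| ≤ C * (√(N k : ℝ))⁻¹ := by
  obtain ⟨R, hRk⟩ := hR.exists_abs_sub_le
  obtain ⟨C, hC⟩ := hR.exists_integral_norm_pow_mul_le hX 1
  obtain ⟨g, hg, hlim⟩ := hR.exists_tendsto_integral hX
  refine ⟨K * (Fintype.card ι * R) * C, ?_⟩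
  filter_upwards [hRk, hC, hlim.eventually (lt_mem_nhds hg),
    hR.tendsto_N.eventually_ge_atTop 2] with k hk hCk hgk hNk f hf hf0 c
  have hN0 : (N k : ℝ) ≠ 0 := by positivity
  -- the constant function `1` at a second sample reduces the claim to a correlation of two samples
  obtain ⟨d, hd⟩ : ∃ d, c ≠ d := by
    have : Nontrivial (Fin (N k)) := Fin.nontrivial_iff_two_le.2 hNk
    exact (exists_ne c).imp fun d hd => hd.symm
  have hI : 0 < ‖∫ θ in torusBox ι,
      transform X (fun i => (x k i : ℝ) / N k) (tilt X (h k)) (fun _ => 1) θ ^ N k‖ :=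
    pos_of_mul_pos_right hgk (by positivity)
  have hK : 0 ≤ K := (abs_nonneg _).trans (hf (Classical.arbitrary T))
  have h1 := abs_fiberMean_pair_mul_le (ξ := fun i => (x k i : ℝ) / N k)
    (fun i => mul_div_cancel₀ _ hN0) (hne k) (h k) f (fun _ => 1) hd
  simp only [mul_one] at h1
  refine le_of_mul_le_mul_right (h1.trans ?_) hI
  calc _ ≤ ∫ θ in torusBox ι, K * (Fintype.card ι * R) * (‖θ‖ ^ 1 *
        ‖transform X (fun i => (x k i : ℝ) / N k) (tilt X (h k)) (fun _ => 1) θ‖ ^ (N k - 2)) := by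
        refine setIntegral_mono_on ?_ ?_ measurableSet_torusBox fun θ _ => ?_
        · exact integrableOn_torusBox (((continuous_transform _ _ _ _).norm.mul
            (continuous_transform _ _ _ _).norm).mul ((continuous_transform _ _ _ _).norm.pow _))
        · exact integrableOn_torusBox (continuous_const.mul ((continuous_norm.pow _).mul
            ((continuous_transform _ _ _ _).norm.pow _)))
        · rw [← mul_assoc]
          refine mul_le_mul_of_nonneg_right ?_ (by positivity)
          have h2 := norm_transform_le_of_sum_eq_zero X (fun i => (x k i : ℝ) / N k)
            (tilt X (h k)) f (hR.nonneg k) (hR.sum_eq_one k) hf hk hf0 θ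
          have h3 := norm_transform_le X (fun i => (x k i : ℝ) / N k)
            (tilt X (h k)) (fun _ => 1) (hR.nonneg k) (hR.sum_eq_one k) (K := 1) (by simp) θ
          rw [pow_one]
          exact (mul_le_of_le_one_right (norm_nonneg _) h3).trans h2
    _ ≤ K * (Fintype.card ι * R) * (C * (√(N k : ℝ) ^ 1)⁻¹ * ‖∫ θ in torusBox ι,
          transform X (fun i => (x k i : ℝ) / N k) (tilt X (h k)) (fun _ => 1) θ ^ N k‖) := by
        rw [integral_const_mul]
        refine mul_le_mul_of_nonneg_left hCk (mul_nonneg hK ?_)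
        rcases isEmpty_or_nonempty ι with hι | ⟨⟨i⟩⟩
        · simp
        · exact mul_nonneg (Nat.cast_nonneg _)
            ((abs_nonneg _).trans (hk (Classical.arbitrary T) i))
    _ = _ := by rw [pow_one]; ring

/-- For a centred function whose correlations with `X` are at most `δ`, the mean at one sample is
`O(δ N ^ (-1/2) + N ^ (-1))` and the correlation between two samples is
`O(δ² N ^ (-1) + N ^ (-2))`. -/
lemma exists_abs_fiberMean_uncorrelated_le
    (hR : CentredRegime X N (fun k i => (x k i : ℝ) / N k) (fun k => tilt X (h k)) η q)
    (hX : Spanning X) (hne : ∀ k, (fiber X (N k) (x k)).Nonempty) (K : ℝ) :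
    ∃ C, ∀ᶠ k in atTop, ∀ f : T → ℝ, (∀ t, |f t| ≤ K) → ∑ t, tilt X (h k) t * f t = 0 →
      ∀ δ, 0 ≤ δ → (∀ i, |∑ t, tilt X (h k) t * f t * (X t i - (x k i : ℝ) / N k)| ≤ δ) →
      (∀ c, |fiberMean X (N k) (x k) (fun m => f (m c))| ≤
        C * (δ * (√(N k : ℝ))⁻¹ + (N k : ℝ)⁻¹)) ∧
      ∀ c d, c ≠ d → |fiberMean X (N k) (x k) (fun m => f (m c) * f (m d))| ≤
        C * (δ ^ 2 * (N k : ℝ)⁻¹ + ((N k : ℝ) ^ 2)⁻¹) := by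
  obtain ⟨R, hRk⟩ := hR.exists_abs_sub_le
  choose C hC using hR.exists_integral_norm_pow_mul_le hX
  obtain ⟨g, hg, hlim⟩ := hR.exists_tendsto_integral hX
  set a : ℝ := (Fintype.card ι : ℝ) with ha
  have ha0 : 0 ≤ a := Nat.cast_nonneg _
  set b : ℝ := |K| * (3 * (Fintype.card ι * R) ^ 2) with hb
  have hb0 : 0 ≤ b := by positivity
  refine ⟨a * |C 1| + b * |C 2| + 2 * a ^ 2 * |C 2| + 2 * b ^ 2 * |C 4|, ?_⟩
  filter_upwards [hRk, hC 1, hC 2, hC 4, hlim.eventually (lt_mem_nhds hg),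
    hR.tendsto_N.eventually_ge_atTop 2] with k hk hC1 hC2 hC4 hgk hNk f hf hf0 δ hδ hδi
  have hN0 : (0 : ℝ) < N k := by positivity
  have hs2 : √(N k : ℝ) ^ 2 = N k := Real.sq_sqrt hN0.le
  have hs4 : √(N k : ℝ) ^ 4 = (N k : ℝ) ^ 2 := by
    rw [show √(N k : ℝ) ^ 4 = (√(N k : ℝ) ^ 2) ^ 2 by ring, hs2]
  set P := transform X (fun i => (x k i : ℝ) / N k) (tilt X (h k)) (fun _ => 1) with hP
  set F := transform X (fun i => (x k i : ℝ) / N k) (tilt X (h k)) f with hF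
  have hPc : Continuous P := continuous_transform _ _ _ _
  have hFc : Continuous F := continuous_transform _ _ _ _
  have hI : 0 < ‖∫ θ in torusBox ι, P θ ^ N k‖ := pos_of_mul_pos_right hgk (by positivity)
  set I := ‖∫ θ in torusBox ι, P θ ^ N k‖ with hIdef
  have hKf : ∀ t, |f t| ≤ |K| := fun t => (hf t).trans (le_abs_self K)
  have hFle : ∀ θ, ‖F θ‖ ≤ a * δ * ‖θ‖ + b * ‖θ‖ ^ 2 :=
    norm_transform_le_of_uncorrelated X _ (tilt X (h k)) f (hR.nonneg k)
      (hR.sum_eq_one k) hKf hk hf0 hδi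
  have hPle : ∀ θ, ‖P θ‖ ≤ 1 := norm_transform_le X _ (tilt X (h k)) (fun _ => 1)
    (hR.nonneg k) (hR.sum_eq_one k) (by simp)
  have hint : ∀ (r : ℕ) (A : ℝ), IntegrableOn
      (fun θ => A * (‖θ‖ ^ r * ‖P θ‖ ^ (N k - 2))) (torusBox ι) := fun r A =>
    integrableOn_torusBox (continuous_const.mul ((continuous_norm.pow _).mul (hPc.norm.pow _)))
  have hmom : ∀ (r : ℕ) (A : ℝ), 0 ≤ A → (∫ θ in torusBox ι, ‖θ‖ ^ r * ‖P θ‖ ^ (N k - 2)) ≤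
      C r * (√(N k : ℝ) ^ r)⁻¹ * I → ∫ θ in torusBox ι, A * (‖θ‖ ^ r * ‖P θ‖ ^ (N k - 2)) ≤
      A * (|C r| * (√(N k : ℝ) ^ r)⁻¹ * I) := by
    intro r A hA hr
    rw [integral_const_mul]
    refine mul_le_mul_of_nonneg_left (hr.trans ?_) hA
    gcongr
    exact le_abs_self _
  have hs0 : 0 ≤ (√(N k : ℝ))⁻¹ := by positivity
  have hNi : 0 ≤ (N k : ℝ)⁻¹ := by positivity
  have hNi2 : 0 ≤ ((N k : ℝ) ^ 2)⁻¹ := by positivity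
  constructor
  · intro c
    obtain ⟨d, hd⟩ : ∃ d, c ≠ d := by
      have : Nontrivial (Fin (N k)) := Fin.nontrivial_iff_two_le.2 hNk
      exact (exists_ne c).imp fun d hd => hd.symm
    have h1 := abs_fiberMean_pair_mul_le (ξ := fun i => (x k i : ℝ) / N k)
      (fun i => mul_div_cancel₀ _ hN0.ne') (hne k) (h k) f (fun _ => 1) hd
    simp only [mul_one] at h1
    refine le_of_mul_le_mul_right (h1.trans ?_) hI
    calc _ ≤ ∫ θ in torusBox ι, (a * δ * (‖θ‖ ^ 1 * ‖P θ‖ ^ (N k - 2)) +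
          b * (‖θ‖ ^ 2 * ‖P θ‖ ^ (N k - 2))) := by
          refine setIntegral_mono_on ?_ ((hint 1 _).add (hint 2 _)) measurableSet_torusBox
            fun θ _ => ?_
          · exact integrableOn_torusBox ((hFc.norm.mul hPc.norm).mul (hPc.norm.pow _))
          · have h2 : ‖F θ‖ * ‖P θ‖ ≤ a * δ * ‖θ‖ + b * ‖θ‖ ^ 2 :=
              (mul_le_of_le_one_right (norm_nonneg _) (hPle θ)).trans (hFle θ)
            have h3 := mul_le_mul_of_nonneg_right h2
              (pow_nonneg (norm_nonneg (P θ)) (N k - 2))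
            rw [pow_one]
            linarith
      _ ≤ a * δ * (|C 1| * (√(N k : ℝ) ^ 1)⁻¹ * I) + b * (|C 2| * (√(N k : ℝ) ^ 2)⁻¹ * I) := by
          rw [integral_add (hint 1 _) (hint 2 _)]
          exact add_le_add (hmom 1 _ (by positivity) hC1) (hmom 2 _ hb0 hC2)
      _ = (a * |C 1| * (δ * (√(N k : ℝ))⁻¹) + b * |C 2| * (N k : ℝ)⁻¹) * I := by
          rw [hs2, pow_one]
          ring
      _ ≤ _ := by
          refine mul_le_mul_of_nonneg_right ?_ hI.le
          have e1 : 0 ≤ δ * (√(N k : ℝ))⁻¹ := by positivity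
          have e2 : 0 ≤ a * |C 1| := by positivity
          have e3 : 0 ≤ b * |C 2| := by positivity
          have e4 : 0 ≤ 2 * a ^ 2 * |C 2| := by positivity
          have e5 : 0 ≤ 2 * b ^ 2 * |C 4| := by positivity
          rw [mul_add]
          exact add_le_add (mul_le_mul_of_nonneg_right (by linarith) e1)
            (mul_le_mul_of_nonneg_right (by linarith) hNi)
  · intro c d hcd
    have h1 := abs_fiberMean_pair_mul_le (ξ := fun i => (x k i : ℝ) / N k)
      (fun i => mul_div_cancel₀ _ hN0.ne') (hne k) (h k) f f hcd
    refine le_of_mul_le_mul_right (h1.trans ?_) hI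
    calc _ ≤ ∫ θ in torusBox ι, (2 * (a * δ) ^ 2 * (‖θ‖ ^ 2 * ‖P θ‖ ^ (N k - 2)) +
          2 * b ^ 2 * (‖θ‖ ^ 4 * ‖P θ‖ ^ (N k - 2))) := by
          refine setIntegral_mono_on ?_ ((hint 2 _).add (hint 4 _)) measurableSet_torusBox
            fun θ _ => ?_
          · exact integrableOn_torusBox ((hFc.norm.mul hFc.norm).mul (hPc.norm.pow _))
          · have h2 : ‖F θ‖ * ‖F θ‖ ≤ 2 * (a * δ) ^ 2 * ‖θ‖ ^ 2 + 2 * b ^ 2 * ‖θ‖ ^ 4 := by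
              refine (mul_self_le_mul_self (norm_nonneg _) (hFle θ)).trans ?_
              nlinarith [sq_nonneg (a * δ * ‖θ‖ - b * ‖θ‖ ^ 2)]
            have h3 := mul_le_mul_of_nonneg_right h2
              (pow_nonneg (norm_nonneg (P θ)) (N k - 2))
            linarith
      _ ≤ 2 * (a * δ) ^ 2 * (|C 2| * (√(N k : ℝ) ^ 2)⁻¹ * I) +
          2 * b ^ 2 * (|C 4| * (√(N k : ℝ) ^ 4)⁻¹ * I) := by
          rw [integral_add (hint 2 _) (hint 4 _)]
          exact add_le_add (hmom 2 _ (by positivity) hC2) (hmom 4 _ (by positivity) hC4)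
      _ = (2 * a ^ 2 * |C 2| * (δ ^ 2 * (N k : ℝ)⁻¹) +
          2 * b ^ 2 * |C 4| * ((N k : ℝ) ^ 2)⁻¹) * I := by
          rw [hs2, hs4]
          ring
      _ ≤ _ := by
          refine mul_le_mul_of_nonneg_right ?_ hI.le
          have e1 : 0 ≤ δ ^ 2 * (N k : ℝ)⁻¹ := by positivity
          have e2 : 0 ≤ a * |C 1| := by positivity
          have e3 : 0 ≤ b * |C 2| := by positivity
          have e4 : 0 ≤ 2 * a ^ 2 * |C 2| := by positivity
          have e5 : 0 ≤ 2 * b ^ 2 * |C 4| := by positivity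
          rw [mul_add]
          exact add_le_add (mul_le_mul_of_nonneg_right (by linarith) e1)
            (mul_le_mul_of_nonneg_right (by linarith) hNi2)

end Asymptotics

section Limit

/-! ### Limits of the mean and of the variance over a fiber -/

variable {T ι : Type*} [Fintype T] [Fintype ι] [DecidableEq ι] [Nonempty T]
  {X : T → ι → ℤ} {N : ℕ → ℕ} {x : ℕ → ι → ℤ} {h : ℕ → ι → ℝ} {η : ι → ℝ} {q : T → ℝ}

/-- The mean of an additive functional over a fiber is asymptotically `N` times its mean under the
limiting weights. -/
lemma CentredRegime.tendsto_fiberMean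
    (hR : CentredRegime X N (fun k i => (x k i : ℝ) / N k) (fun k => tilt X (h k)) η q)
    (hX : Spanning X) (hne : ∀ k, (fiber X (N k) (x k)).Nonempty) (A : T → ℝ) :
    Tendsto (fun k => fiberMean X (N k) (x k) (fun m => ∑ c, A (m c)) / N k) atTop
      (𝓝 (∑ t, q t * A t)) := by
  set M := ∑ t, |A t| with hM
  have hAM : ∀ t, |A t| ≤ M := fun t =>
    Finset.single_le_sum (f := fun t => |A t|) (fun _ _ => abs_nonneg _) (Finset.mem_univ t)
  obtain ⟨C, hC⟩ := exists_abs_fiberMean_single_le hR hX hne (2 * M)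
  have hlim : Tendsto (fun k => ∑ t, tilt X (h k) t * A t) atTop (𝓝 (∑ t, q t * A t)) :=
    tendsto_finsetSum _ fun t _ => (hR.tendsto_weight t).mul_const _
  have hdiff : Tendsto (fun k => fiberMean X (N k) (x k) (fun m => ∑ c, A (m c)) / N k -
      ∑ t, tilt X (h k) t * A t) atTop (𝓝 0) := by
    have h0 : Tendsto (fun k => C * (√(N k : ℝ))⁻¹) atTop (𝓝 0) := by
      simpa using hR.tendsto_sqrt.inv_tendsto_atTop.const_mul C
    refine squeeze_zero_norm' ?_ h0
    filter_upwards [hC, hR.tendsto_N.eventually_gt_atTop 0] with k hk hNk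
    have hN0 : (0 : ℝ) < N k := by exact_mod_cast hNk
    set β := ∑ t, tilt X (h k) t * A t with hβ
    have hβM : |β| ≤ M := by
      refine (Finset.abs_sum_le_sum_abs _ _).trans (Finset.sum_le_sum fun t _ => ?_)
      rw [abs_mul, abs_of_pos (tilt_pos X (h k) t)]
      refine mul_le_of_le_one_left (abs_nonneg _) ?_
      rw [← sum_tilt X (h k)]
      exact Finset.single_le_sum (fun s _ => (tilt_pos X (h k) s).le) (Finset.mem_univ t)
    have hb := hk (fun t => A t - β)
      (fun t => (abs_sub _ _).trans (by linarith [hAM t]))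
      (by simp only [mul_sub, Finset.sum_sub_distrib, ← Finset.sum_mul, sum_tilt]; simp [hβ])
    have e : fiberMean X (N k) (x k) (fun m => ∑ c, A (m c)) =
        ∑ c, fiberMean X (N k) (x k) (fun m => A (m c) - β) + N k * β := by
      rw [← fiberMean_sum, ← fiberMean_const (hne k) (N k * β), ← fiberMean_add]
      refine fiberMean_congr fun m _ => ?_
      simp
    rw [e, add_div, mul_div_cancel_left₀ _ hN0.ne', add_sub_cancel_right, norm_div,
      Real.norm_of_nonneg hN0.le, div_le_iff₀ hN0]
    refine (norm_sum_le_of_le _ fun c _ => hb c).trans_eq ?_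
    simp
    ring
  simpa using hdiff.add hlim

/-- The variance of an additive functional over a fiber is asymptotically `N` times the variance
of the residual `A - y · X`, for `y` making the residual uncorrelated with `X`. Subtracting `y · X`
changes the functional by a constant only, and after the subtraction the correlations between
different samples are negligible. -/
lemma CentredRegime.tendsto_fiberVariance
    (hR : CentredRegime X N (fun k i => (x k i : ℝ) / N k) (fun k => tilt X (h k)) η q)
    (hX : Spanning X) (hne : ∀ k, (fiber X (N k) (x k)).Nonempty) (A : T → ℝ) (y : ι → ℝ)
    (hy : ∀ i, ∑ t, q t * (A t - ∑ j, y j * X t j) * (X t i - η i) = 0) (hq : ∑ t, q t = 1)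
    (hqX : ∀ i, ∑ t, q t * X t i = η i) :
    Tendsto (fun k => fiberVariance X (N k) (x k) (fun m => ∑ c, A (m c)) / N k) atTop
      (𝓝 (∑ t, q t * (A t - ∑ j, y j * X t j) ^ 2 -
        (∑ t, q t * (A t - ∑ j, y j * X t j)) ^ 2)) := by
  set B : T → ℝ := fun t => A t - ∑ j, y j * X t j with hB
  set M := ∑ t, |B t| with hM
  have hM0 : 0 ≤ M := Finset.sum_nonneg fun _ _ => abs_nonneg _
  have hBM : ∀ t, |B t| ≤ M := fun t =>
    Finset.single_le_sum (f := fun t => |B t|) (fun _ _ => abs_nonneg _) (Finset.mem_univ t)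
  obtain ⟨C₁, hC₁⟩ := exists_abs_fiberMean_single_le hR hX hne (2 * (4 * M ^ 2))
  obtain ⟨C₂, hC₂⟩ := exists_abs_fiberMean_uncorrelated_le hR hX hne (2 * M)
  -- the weighted mean `β`, variance `v` and total correlation `δ` of the residual
  set β : ℕ → ℝ := fun k => ∑ t, tilt X (h k) t * B t with hβ
  set v : ℕ → ℝ := fun k => ∑ t, tilt X (h k) t * (B t - β k) ^ 2 with hv
  set δ : ℕ → ℝ := fun k => ∑ i, |∑ t, tilt X (h k) t * (B t - β k) *
    (X t i - (x k i : ℝ) / N k)| with hδ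
  have hβlim : Tendsto β atTop (𝓝 (∑ t, q t * B t)) :=
    tendsto_finsetSum _ fun t _ => (hR.tendsto_weight t).mul_const _
  have hvlim : Tendsto v atTop (𝓝 (∑ t, q t * B t ^ 2 - (∑ t, q t * B t) ^ 2)) := by
    have h1 : Tendsto v atTop (𝓝 (∑ t, q t * (B t - ∑ s, q s * B s) ^ 2)) :=
      tendsto_finsetSum _ fun t _ => (hR.tendsto_weight t).mul
        ((tendsto_const_nhds.sub hβlim).pow 2)
    convert h1 using 2
    set b := ∑ t, q t * B t with hb
    have : ∀ t, q t * (B t - b) ^ 2 = q t * B t ^ 2 - 2 * b * (q t * B t) + b ^ 2 * q t :=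
      fun t => by ring
    simp_rw [this]
    rw [Finset.sum_add_distrib, Finset.sum_sub_distrib, ← Finset.mul_sum, ← Finset.mul_sum, hq,
      ← hb]
    ring
  have hδlim : Tendsto δ atTop (𝓝 0) := by
    have h1 : Tendsto δ atTop (𝓝 (∑ i, |∑ t, q t * (B t - ∑ s, q s * B s) * (X t i - η i)|)) :=
      tendsto_finsetSum _ fun i _ => (tendsto_finsetSum _ fun t _ =>
        ((hR.tendsto_weight t).mul (tendsto_const_nhds.sub hβlim)).mul
          (tendsto_const_nhds.sub (hR.tendsto_mean i))).abs
    convert h1 using 2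
    symm
    refine Finset.sum_eq_zero fun i _ => ?_
    rw [abs_eq_zero]
    set b := ∑ t, q t * B t
    have : ∀ t, q t * (B t - b) * (X t i - η i) =
        q t * B t * (X t i - η i) - b * (q t * X t i - q t * η i) := fun t => by ring
    simp_rw [this]
    rw [Finset.sum_sub_distrib, hy i, ← Finset.mul_sum, Finset.sum_sub_distrib, hqX,
      ← Finset.sum_mul, hq]
    ring
  have hδ0 : ∀ k, 0 ≤ δ k := fun k => Finset.sum_nonneg fun _ _ => abs_nonneg _
  have hNinv : Tendsto (fun k => (N k : ℝ)⁻¹) atTop (𝓝 0) :=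
    (tendsto_natCast_atTop_atTop.comp hR.tendsto_N).inv_tendsto_atTop
  have hsinv : Tendsto (fun k => (√(N k : ℝ))⁻¹) atTop (𝓝 0) :=
    hR.tendsto_sqrt.inv_tendsto_atTop
  have hdiff : Tendsto (fun k => fiberVariance X (N k) (x k) (fun m => ∑ c, A (m c)) / N k - v k)
      atTop (𝓝 0) := by
    have h0 : Tendsto (fun k => C₁ * (√(N k : ℝ))⁻¹ + |C₂| * (δ k ^ 2 + (N k : ℝ)⁻¹) +
        C₂ ^ 2 * (2 * (δ k ^ 2 + (N k : ℝ)⁻¹))) atTop (𝓝 0) := by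
      have := ((hsinv.const_mul C₁).add (((hδlim.pow 2).add hNinv).const_mul |C₂|)).add
        ((((hδlim.pow 2).add hNinv).const_mul 2).const_mul (C₂ ^ 2))
      simpa using this
    refine squeeze_zero_norm' ?_ h0
    filter_upwards [hC₁, hC₂, hR.tendsto_N.eventually_gt_atTop 0] with k hk₁ hk₂ hNk
    have hN0 : (0 : ℝ) < N k := by exact_mod_cast hNk
    have hN1 : (1 : ℝ) ≤ N k := by exact_mod_cast hNk
    have hw : ∀ t, 0 ≤ tilt X (h k) t := fun t => (tilt_pos X (h k) t).le
    have hw1 := sum_tilt X (h k)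
    have havg : ∀ (g : T → ℝ) (K : ℝ), (∀ t, |g t| ≤ K) → |∑ t, tilt X (h k) t * g t| ≤ K := by
      intro g K hg
      refine (Finset.abs_sum_le_sum_abs _ _).trans ?_
      calc _ ≤ ∑ t, tilt X (h k) t * K := Finset.sum_le_sum fun t _ => by
              rw [abs_mul, abs_of_nonneg (hw t)]
              exact mul_le_mul_of_nonneg_left (hg t) (hw t)
        _ = K := by rw [← Finset.sum_mul, hw1, one_mul]
    set f : T → ℝ := fun t => B t - β k with hf
    have hfM : ∀ t, |f t| ≤ 2 * M := fun t =>
      (abs_sub _ _).trans (by linarith [hBM t, havg B M hBM])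
    have hf0 : ∑ t, tilt X (h k) t * f t = 0 := by
      simp only [hf, mul_sub, Finset.sum_sub_distrib, ← Finset.sum_mul, hw1]
      simp [hβ]
    have hf2 : ∀ t, |f t ^ 2| ≤ 4 * M ^ 2 := by
      intro t
      rw [abs_pow]
      calc |f t| ^ 2 ≤ (2 * M) ^ 2 := pow_le_pow_left₀ (abs_nonneg _) (hfM t) 2
        _ = _ := by ring
    have hvk : v k = ∑ t, tilt X (h k) t * f t ^ 2 := rfl
    have hsingle := hk₁ (fun t => f t ^ 2 - v k)
      (fun t => (abs_sub _ _).trans (by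
        rw [hvk]
        linarith [hf2 t, havg (fun t => f t ^ 2) _ hf2]))
      (by simp only [mul_sub, Finset.sum_sub_distrib, ← Finset.sum_mul, hw1]; simp [hvk])
    obtain ⟨hone, htwo⟩ := hk₂ f hfM hf0 (δ k) (hδ0 k) fun i =>
      Finset.single_le_sum (f := fun i => |∑ t, tilt X (h k) t * f t *
        (X t i - (x k i : ℝ) / N k)|) (fun _ _ => abs_nonneg _) (Finset.mem_univ i)
    -- on the fiber the two functionals differ by a constant
    have hvar : fiberVariance X (N k) (x k) (fun m => ∑ c, A (m c)) =
        fiberVariance X (N k) (x k) (fun m => ∑ c, f (m c)) := by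
      rw [← fiberVariance_add_const (hne k) (fun m => ∑ c, f (m c))
        (∑ j, y j * x k j + N k * β k)]
      have hm : ∀ m ∈ fiber X (N k) (x k),
          ∑ c, A (m c) = ∑ c, f (m c) + (∑ j, y j * x k j + N k * β k) := by
        intro m hm
        have hx : ∀ i, ∑ c, X (m c) i = x k i := by simpa [fiber] using hm
        simp only [hf, hB, Finset.sum_sub_distrib]
        rw [Finset.sum_comm]
        simp_rw [← Finset.mul_sum, ← hx]
        simp
      rw [fiberVariance, fiberVariance, fiberMean_congr hm,
        fiberMean_congr fun m hm' => by rw [hm m hm']]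
    have hsq : fiberMean X (N k) (x k) (fun m => (∑ c, f (m c)) ^ 2) =
        ∑ c, ∑ d, fiberMean X (N k) (x k) (fun m => f (m c) * f (m d)) := by
      simp_rw [← fiberMean_sum, sq, Finset.sum_mul_sum]
    -- the diagonal contributes `v k`, the `N - 1` correlations with other samples are negligible
    have hrow : ∀ c, |∑ d, fiberMean X (N k) (x k) (fun m => f (m c) * f (m d)) - v k| ≤
        C₁ * (√(N k : ℝ))⁻¹ + |C₂| * (δ k ^ 2 + (N k : ℝ)⁻¹) := by
      intro c
      rw [← Finset.add_sum_erase _ _ (Finset.mem_univ c)]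
      have e : fiberMean X (N k) (x k) (fun m => f (m c) * f (m c)) =
          fiberMean X (N k) (x k) (fun m => f (m c) ^ 2 - v k) + v k := by
        conv_rhs => rw [← fiberMean_const (hne k) (v k), ← fiberMean_add]
        simp [sq, fiberMean_const (hne k)]
      rw [e, add_sub_right_comm, add_sub_cancel_right]
      refine (abs_add_le _ _).trans (add_le_add (hsingle c) ?_)
      refine (Finset.abs_sum_le_sum_abs _ _).trans ?_
      calc _ ≤ ∑ d ∈ Finset.univ.erase c,
            |C₂| * (δ k ^ 2 * (N k : ℝ)⁻¹ + ((N k : ℝ) ^ 2)⁻¹) := by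
            refine Finset.sum_le_sum fun d hd => ?_
            refine (htwo c d (Finset.ne_of_mem_erase hd).symm).trans ?_
            exact mul_le_mul_of_nonneg_right (le_abs_self _) (by positivity)
        _ ≤ ∑ d : Fin (N k), |C₂| * (δ k ^ 2 * (N k : ℝ)⁻¹ + ((N k : ℝ) ^ 2)⁻¹) :=
            Finset.sum_le_sum_of_subset_of_nonneg (Finset.erase_subset _ _)
              fun _ _ _ => by positivity
        _ = _ := by
            simp only [Finset.sum_const, Finset.card_univ, Fintype.card_fin, nsmul_eq_mul]
            field_simp
    have hmean : |fiberMean X (N k) (x k) (fun m => ∑ c, f (m c))| ≤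
        N k * |C₂ * (δ k * (√(N k : ℝ))⁻¹ + (N k : ℝ)⁻¹)| := by
      rw [fiberMean_sum]
      refine (Finset.abs_sum_le_sum_abs _ _).trans ?_
      refine (Finset.sum_le_sum fun c _ => (hone c).trans (le_abs_self _)).trans_eq ?_
      simp
    have hmean2 : fiberMean X (N k) (x k) (fun m => ∑ c, f (m c)) ^ 2 ≤
        N k * (C₂ ^ 2 * (2 * (δ k ^ 2 + (N k : ℝ)⁻¹))) := by
      rw [← sq_abs]
      refine (pow_le_pow_left₀ (abs_nonneg _) hmean 2).trans ?_
      rw [mul_pow, sq_abs]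
      have hs2 : (√(N k : ℝ))⁻¹ ^ 2 = (N k : ℝ)⁻¹ := by
        rw [inv_pow, Real.sq_sqrt hN0.le]
      have e1 : (δ k * (√(N k : ℝ))⁻¹ + (N k : ℝ)⁻¹) ^ 2 ≤
          2 * (δ k ^ 2 * (N k : ℝ)⁻¹ + ((N k : ℝ)⁻¹) ^ 2) := by
        rw [← hs2]
        nlinarith [sq_nonneg (δ k * (√(N k : ℝ))⁻¹ - (√(N k : ℝ))⁻¹ ^ 2)]
      calc (N k : ℝ) ^ 2 * (C₂ * (δ k * (√(N k : ℝ))⁻¹ + (N k : ℝ)⁻¹)) ^ 2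
          ≤ (N k : ℝ) ^ 2 * (C₂ ^ 2 * (2 * (δ k ^ 2 * (N k : ℝ)⁻¹ + ((N k : ℝ)⁻¹) ^ 2))) := by
            rw [mul_pow]
            gcongr
        _ = _ := by field_simp
    rw [hvar, fiberVariance, hsq]
    have e2 : (∑ c, ∑ d, fiberMean X (N k) (x k) (fun m => f (m c) * f (m d)) -
        fiberMean X (N k) (x k) (fun m => ∑ c, f (m c)) ^ 2) / N k - v k =
        (∑ c, (∑ d, fiberMean X (N k) (x k) (fun m => f (m c) * f (m d)) - v k)) / N k -
          fiberMean X (N k) (x k) (fun m => ∑ c, f (m c)) ^ 2 / N k := by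
      rw [Finset.sum_sub_distrib]
      simp
      field_simp
      ring
    rw [e2]
    refine (norm_sub_le _ _).trans (add_le_add ?_ ?_)
    · rw [norm_div, Real.norm_of_nonneg hN0.le, div_le_iff₀ hN0]
      refine (norm_sum_le_of_le _ fun c _ => hrow c).trans_eq ?_
      simp only [Finset.sum_const, Finset.card_univ, Fintype.card_fin, nsmul_eq_mul]
      ring
    · rw [Real.norm_of_nonneg (by positivity), div_le_iff₀ hN0]
      linarith
  simpa using hdiff.add hvlim

/-- Near the density of the uniform weights, averages over fibers are described by the uniform
weights. -/
theorem tendsto_fiberMean_and_fiberVariance (hX : Spanning X) (hN : Tendsto N atTop atTop)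
    (hη : ∀ i, η i = (Fintype.card T : ℝ)⁻¹ * ∑ t, (X t i : ℝ))
    (hx : ∀ i, Tendsto (fun k => (x k i : ℝ) / N k) atTop (𝓝 (η i)))
    (hne : ∀ k, (fiber X (N k) (x k)).Nonempty) (A : T → ℝ) (y : ι → ℝ)
    (hy : ∀ i, ∑ t, (A t - ∑ j, y j * X t j) * (X t i - η i) = 0) :
    Tendsto (fun k => fiberMean X (N k) (x k) (fun m => ∑ c, A (m c)) / N k) atTop
      (𝓝 ((Fintype.card T : ℝ)⁻¹ * ∑ t, A t)) ∧
    Tendsto (fun k => fiberVariance X (N k) (x k) (fun m => ∑ c, A (m c)) / N k) atTop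
      (𝓝 ((Fintype.card T : ℝ)⁻¹ * ∑ t, (A t - ∑ j, y j * X t j) ^ 2 -
        ((Fintype.card T : ℝ)⁻¹ * ∑ t, (A t - ∑ j, y j * X t j)) ^ 2)) := by
  obtain ⟨h, hh, hmean⟩ := exists_tilt X hX (ξ := fun k i => (x k i : ℝ) / N k)
    fun i => hη i ▸ hx i
  have hcard : (0 : ℝ) < (Fintype.card T : ℝ)⁻¹ := by positivity
  have hR : CentredRegime X N (fun k i => (x k i : ℝ) / N k) (fun k => tilt X (h k)) η
      fun _ => (Fintype.card T : ℝ)⁻¹ :=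
    { tendsto_N := hN
      sum_eq_one := fun k => sum_tilt X (h k)
      nonneg := fun k t => (tilt_pos X (h k) t).le
      mean_eq := hmean
      tendsto_weight := fun t => by
        rw [← tilt_zero X t]
        exact ((continuous_tilt X t).tendsto 0).comp hh
      tendsto_mean := hx
      pos := fun _ => hcard }
  constructor
  · simpa only [← Finset.mul_sum] using hR.tendsto_fiberMean hX hne A
  · have := hR.tendsto_fiberVariance hX hne A y
      (fun i => by simp only [mul_assoc, ← Finset.mul_sum, hy i, mul_zero])
      (by simp) (fun i => by rw [hη i, Finset.mul_sum])
    simpa only [← Finset.mul_sum] using this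

end Limit

section Words

/-! ### Tiles of a cycle as closed words, and transfer matrices -/

/-- The transfer matrix of words in the letters `0`, `1` without two consecutive letters `1`. -/
def transfer : Matrix (Fin 2) (Fin 2) ℝ := !![1, 1; 1, 0]

lemma transfer_apply (a b : Fin 2) : transfer a b = if a = 1 ∧ b = 1 then 0 else 1 := by
  fin_cases a <;> fin_cases b <;> simp [transfer]

/-- The ordered product `W 0 * W 1 * ⋯ * W (n - 1)`. -/
def orderedProd (W : ℕ → Matrix (Fin 2) (Fin 2) ℝ) : ℕ → Matrix (Fin 2) (Fin 2) ℝ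
  | 0 => 1
  | n + 1 => orderedProd W n * W n

lemma orderedProd_add (W : ℕ → Matrix (Fin 2) (Fin 2) ℝ) (m n : ℕ) :
    orderedProd W (m + n) = orderedProd W m * orderedProd (fun i => W (m + i)) n := by
  induction n with
  | zero => simp [orderedProd]
  | succ n ih => rw [← add_assoc, orderedProd, ih, orderedProd, mul_assoc]

lemma orderedProd_eq_pow {W : ℕ → Matrix (Fin 2) (Fin 2) ℝ} {V : Matrix (Fin 2) (Fin 2) ℝ} {n : ℕ}
    (h : ∀ i < n, W i = V) : orderedProd W n = V ^ n := by
  induction n with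
  | zero => simp [orderedProd]
  | succ n ih =>
    rw [orderedProd, ih fun i hi => h i (by lia), h n (by lia), pow_succ]

/-- Weighted sums over words with boundary conditions are entries of a product of matrices. -/
lemma sum_words_mul (W : ℕ → Matrix (Fin 2) (Fin 2) ℝ) (n : ℕ) (f : Fin 2 → Fin 2 → ℝ) :
    ∑ x : Fin (n + 1) → Fin 2, (∏ i : Fin n, W i (x i.castSucc) (x i.succ)) *
      f (x (Fin.last n)) (x 0) = ∑ a, ∑ b, orderedProd W n a b * f b a := by
  induction n generalizing f with
  | zero =>
    rw [← (Equiv.funUnique (Fin 1) (Fin 2)).symm.sum_comp]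
    simp [orderedProd, Matrix.one_apply]
  | succ n ih =>
    rw [← (Fin.snocEquiv fun _ => Fin 2).sum_comp, Fintype.sum_prod_type]
    have h1 : ∀ (b : Fin 2) (x : Fin (n + 1) → Fin 2),
        (∏ i : Fin (n + 1), W i ((Fin.snocEquiv fun _ => Fin 2) (b, x) i.castSucc)
          ((Fin.snocEquiv fun _ => Fin 2) (b, x) i.succ)) *
          f ((Fin.snocEquiv fun _ => Fin 2) (b, x) (Fin.last (n + 1)))
            ((Fin.snocEquiv fun _ => Fin 2) (b, x) 0) =
        (∏ i : Fin n, W i (x i.castSucc) (x i.succ)) *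
          (fun c a => W n c b * f b a) (x (Fin.last n)) (x 0) := by
      intro b x
      rw [Fin.prod_univ_castSucc]
      have h0 : (Fin.snoc x b : Fin (n + 2) → Fin 2) 0 = x 0 := by
        exact Fin.snoc_castSucc (α := fun _ => Fin 2) b x 0
      have h2 : ∀ i : Fin n, (Fin.snoc x b : Fin (n + 2) → Fin 2) i.castSucc.succ = x i.succ := by
        intro i
        rw [← Fin.castSucc_succ]
        exact Fin.snoc_castSucc (α := fun _ => Fin 2) b x i.succ
      have h3 : (Fin.snoc x b : Fin (n + 2) → Fin 2) (Fin.last n).succ = b := by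
        rw [Fin.succ_last]
        exact Fin.snoc_last (α := fun _ => Fin 2) b x
      simp only [Fin.snocEquiv_apply, Fin.snoc_castSucc, Fin.snoc_last, h0, h2, h3, Fin.val_castSucc,
        Fin.val_last]
      ring
    simp_rw [h1]
    simp_rw [fun b : Fin 2 => ih (fun c a => W n c b * f b a)]
    rw [Finset.sum_comm]
    refine Finset.sum_congr rfl fun a _ => Finset.sum_congr rfl fun b _ => ?_
    rw [orderedProd, Matrix.mul_apply, Finset.sum_mul]
    exact Finset.sum_congr rfl fun c _ => by ring

/-- Weighted sums over closed words are traces of products of matrices. -/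
lemma sum_closed_words (W : ℕ → Matrix (Fin 2) (Fin 2) ℝ) (L : ℕ) [NeZero L] :
    ∑ x : Fin L → Fin 2, ∏ i : Fin L, W i (x i) (x (i + 1)) = (orderedProd W L).trace := by
  obtain ⟨n, rfl⟩ := Nat.exists_eq_succ_of_ne_zero (NeZero.ne L)
  have h1 : ∀ x : Fin (n + 1) → Fin 2, ∏ i : Fin (n + 1), W i (x i) (x (i + 1)) =
      (∏ i : Fin n, W i (x i.castSucc) (x i.succ)) * W n (x (Fin.last n)) (x 0) := by
    intro x
    rw [Fin.prod_univ_castSucc]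
    simp [Fin.coeSucc_eq_succ]
  simp_rw [h1]
  rw [sum_words_mul W n (W n)]
  simp [Matrix.trace, orderedProd, Matrix.mul_apply]

/-- The weights of the letters of closed words without two adjacent letters `1`. -/
def letterWeight (u : ℕ → Fin 2 → ℝ) (i : ℕ) : Matrix (Fin 2) (Fin 2) ℝ :=
  Matrix.diagonal (u i) * transfer

lemma sum_closed_words_letterWeight (u : ℕ → Fin 2 → ℝ) (L : ℕ) [NeZero L] :
    ∑ x : Fin L → Fin 2, (∏ i : Fin L, u i (x i)) * ∏ i, transfer (x i) (x (i + 1)) =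
      (orderedProd (letterWeight u) L).trace := by
  rw [← sum_closed_words]
  simp_rw [← Finset.prod_mul_distrib]
  simp [letterWeight, Matrix.diagonal_mul]

variable {L : ℕ} [NeZero L]

/-- The edge of the cycle joining the vertices `e` and `e + 1`. -/
def cycleEdge (e : Fin L) : Sym2 (Fin L) := s(e, e + 1)

lemma two_ne_zero_fin (hL : 3 ≤ L) : (1 + 1 : Fin L) ≠ 0 := by
  obtain ⟨n, rfl⟩ := Nat.exists_eq_add_of_le' hL
  intro h
  have := congrArg Fin.val h
  simp [Fin.val_add] at this
  rw [Nat.mod_eq_of_lt (by lia)] at this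
  lia

lemma one_ne_zero_fin (hL : 3 ≤ L) : (1 : Fin L) ≠ 0 := by
  obtain ⟨n, rfl⟩ := Nat.exists_eq_add_of_le' hL
  intro h
  have := congrArg Fin.val h
  simp at this

lemma cycleEdge_injective (hL : 3 ≤ L) : Function.Injective (cycleEdge (L := L)) := by
  intro e f h
  rcases Sym2.eq_iff.1 h with h | ⟨h1, h2⟩
  · exact h.1
  · exfalso
    rw [h1, add_assoc] at h2
    exact two_ne_zero_fin hL (by simpa using h2)

lemma mem_edgeSet_cycleGraph (hL : 3 ≤ L) (s : Sym2 (Fin L)) :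
    s ∈ (SimpleGraph.cycleGraph L).edgeSet ↔ ∃ e, s = cycleEdge e := by
  obtain ⟨n, rfl⟩ := Nat.exists_eq_add_of_le' hL
  induction s with | _ a b
  rw [SimpleGraph.mem_edgeSet, SimpleGraph.cycleGraph_adj]
  constructor
  · rintro (h | h)
    · exact ⟨b, by rw [sub_eq_iff_eq_add] at h; rw [h, cycleEdge, add_comm 1 b, Sym2.eq_swap]⟩
    · exact ⟨a, by rw [sub_eq_iff_eq_add] at h; rw [h, cycleEdge, add_comm 1 a]⟩
  · rintro ⟨e, he⟩
    rcases Sym2.eq_iff.1 he with ⟨rfl, rfl⟩ | ⟨rfl, rfl⟩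
    · right; simp
    · left; simp

open Classical in
/-- The word of a tile: the letter at `e` is `1` if the tile contains the edge `cycleEdge e`. -/
def word (t : Tile (SimpleGraph.cycleGraph L)) (e : Fin L) : Fin 2 :=
  if cycleEdge e ∈ t.1 then 1 else 0

lemma word_eq_one_iff (t : Tile (SimpleGraph.cycleGraph L)) (e : Fin L) :
    word t e = 1 ↔ cycleEdge e ∈ t.1 := by
  simp [word]

lemma word_injective (hL : 3 ≤ L) :
    Function.Injective (word : Tile (SimpleGraph.cycleGraph L) → Fin L → Fin 2) := by
  intro t t' h
  apply Subtype.ext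
  ext s
  have key : ∀ e, cycleEdge e ∈ t.1 ↔ cycleEdge e ∈ t'.1 := fun e => by
    rw [← word_eq_one_iff, ← word_eq_one_iff, h]
  constructor
  · intro hs
    obtain ⟨e, rfl⟩ := (mem_edgeSet_cycleGraph hL s).1 (t.2.1 s hs)
    exact (key e).1 hs
  · intro hs
    obtain ⟨e, rfl⟩ := (mem_edgeSet_cycleGraph hL s).1 (t'.2.1 s hs)
    exact (key e).2 hs

lemma word_adjacent (hL : 3 ≤ L) (t : Tile (SimpleGraph.cycleGraph L)) (e : Fin L) :
    ¬ (word t e = 1 ∧ word t (e + 1) = 1) := by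
  rw [word_eq_one_iff, word_eq_one_iff]
  rintro ⟨h1, h2⟩
  have h3 := t.2.2 _ h1 _ h2 (e + 1) (by simp [cycleEdge]) (by simp [cycleEdge])
  have h4 := cycleEdge_injective hL h3
  exact one_ne_zero_fin hL (by simpa using h4.symm)

lemma exists_tile_word_eq (hL : 3 ≤ L) (x : Fin L → Fin 2)
    (hx : ∀ e, ¬ (x e = 1 ∧ x (e + 1) = 1)) :
    ∃ t : Tile (SimpleGraph.cycleGraph L), word t = x := by
  classical
  refine ⟨⟨(Finset.univ.filter fun e => x e = 1).image cycleEdge, ?_, ?_⟩, ?_⟩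
  · intro s hs
    obtain ⟨e, -, rfl⟩ := Finset.mem_image.1 hs
    exact (mem_edgeSet_cycleGraph hL _).2 ⟨e, rfl⟩
  · intro s hs s' hs' v hv hv'
    obtain ⟨e, he, rfl⟩ := Finset.mem_image.1 hs
    obtain ⟨f, hf, rfl⟩ := Finset.mem_image.1 hs'
    simp only [Finset.mem_filter, Finset.mem_univ, true_and] at he hf
    simp only [cycleEdge, Sym2.mem_iff] at hv hv'
    rcases hv with rfl | rfl <;> rcases hv' with h | h
    · rw [h]
    · exact absurd ⟨hf, h ▸ he⟩ (hx f)
    · exact absurd ⟨he, h ▸ hf⟩ (hx e)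
    · rw [add_right_cancel h]
  · ext e
    have h2 : ∀ a b : Fin 2, (a = 1 ↔ b = 1) → a = b := by decide
    refine congrArg Fin.val (h2 _ _ ?_)
    rw [word_eq_one_iff]
    simp [(cycleEdge_injective hL).eq_iff]

/-- Sums over tiles are sums over words, weighted by the transfer matrix. -/
lemma sum_tile_eq_sum_word (hL : 3 ≤ L) (g : (Fin L → Fin 2) → ℝ) :
    ∑ t : Tile (SimpleGraph.cycleGraph L), g (word t) =
      ∑ x : Fin L → Fin 2, g x * ∏ i, transfer (x i) (x (i + 1)) := by
  classical
  have h1 : ∀ x : Fin L → Fin 2, g x * ∏ i, transfer (x i) (x (i + 1)) =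
      if ∀ e, ¬ (x e = 1 ∧ x (e + 1) = 1) then g x else 0 := by
    intro x
    split_ifs with h
    · rw [Finset.prod_eq_one, mul_one]
      intro i _
      rw [transfer_apply, if_neg (h i)]
    · push Not at h
      obtain ⟨e, he⟩ := h
      rw [Finset.prod_eq_zero (Finset.mem_univ e), mul_zero]
      rw [transfer_apply, if_pos he]
  simp_rw [h1]
  rw [← Finset.sum_filter]
  refine Finset.sum_nbij word (fun t _ => ?_) (word_injective hL).injOn ?_ fun _ _ => rfl
  · simpa using fun e => not_and.1 (word_adjacent hL t e)
  · intro x hx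
    obtain ⟨t, ht⟩ := exists_tile_word_eq hL x (by simpa using hx)
    exact ⟨t, by simp, ht⟩

end Words

section Counting

/-! ### Counting tiles with prescribed edges -/

/-- The projection onto the letter `a`. -/
def pin (a : Fin 2) : Matrix (Fin 2) (Fin 2) ℝ :=
  Matrix.diagonal fun b => if b = a then 1 else 0

lemma mul_pin_mul_apply (A B : Matrix (Fin 2) (Fin 2) ℝ) (a b c : Fin 2) :
    (A * pin c * B) a b = A a c * B c b := by
  fin_cases c <;> simp [pin, Matrix.mul_apply]

lemma trace_pin_mul (A : Matrix (Fin 2) (Fin 2) ℝ) (c : Fin 2) : (pin c * A).trace = A c c := by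
  simp [pin, Matrix.trace, Matrix.diagonal_mul]

/-- The product of the transfer matrices of a word, all of whose letters are prescribed. -/
lemma orderedProd_pin {W : ℕ → Matrix (Fin 2) (Fin 2) ℝ} (s : ℕ → Fin 2) (n : ℕ)
    (h : ∀ i ≤ n, W i = pin (s i) * transfer) (a b : Fin 2) :
    orderedProd W (n + 1) a b = if a = s 0 then
      (∏ i ∈ Finset.range n, transfer (s i) (s (i + 1))) * transfer (s n) b else 0 := by
  induction n generalizing b with
  | zero =>
    simp only [orderedProd, one_mul, h 0 le_rfl, pin, Matrix.diagonal_mul, ite_mul,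
      zero_mul, Finset.range_zero, Finset.prod_empty]
    split_ifs with ha
    · rw [ha]
    · rfl
  | succ n ih =>
    rw [orderedProd, h (n + 1) le_rfl, ← mul_assoc, mul_pin_mul_apply,
      ih (fun i hi => h i (by lia)), Finset.prod_range_succ]
    split_ifs <;> simp

lemma trace_orderedProd_pin_mul {W : ℕ → Matrix (Fin 2) (Fin 2) ℝ} (s : ℕ → Fin 2) (n : ℕ)
    (h : ∀ i ≤ n, W i = pin (s i) * transfer) (hs : ∀ i < n, ¬ (s i = 1 ∧ s (i + 1) = 1))
    (V : Matrix (Fin 2) (Fin 2) ℝ) :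
    (orderedProd W (n + 1) * V).trace = (transfer * V) (s n) (s 0) := by
  have hprod : ∏ i ∈ Finset.range n, transfer (s i) (s (i + 1)) = 1 :=
    Finset.prod_eq_one fun i hi => by rw [transfer_apply, if_neg (hs i (Finset.mem_range.1 hi))]
  simp only [Matrix.trace, Matrix.diag_apply, Matrix.mul_apply, orderedProd_pin s n h, hprod,
    one_mul, ite_mul, zero_mul]
  rw [Finset.sum_eq_single (s 0)]
  · simp
  · intro b _ hb
    simp [hb]
  · simp

variable {L : ℕ} [NeZero L]

/-- The number of tiles whose words obey a condition on each letter is a trace. -/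
lemma sum_tile_indicator (hL : 3 ≤ L) (P : ℕ → Fin 2 → Prop) [∀ i a, Decidable (P i a)]
    [DecidablePred fun t : Tile (SimpleGraph.cycleGraph L) => ∀ e : Fin L, P e (word t e)] :
    ∑ t : Tile (SimpleGraph.cycleGraph L), (if ∀ e : Fin L, P e (word t e) then (1 : ℝ) else 0) =
      (orderedProd (letterWeight fun i a => if P i a then 1 else 0) L).trace := by
  rw [← sum_closed_words_letterWeight, ← sum_tile_eq_sum_word hL fun x =>
    ∏ i : Fin L, if P i (x i) then (1 : ℝ) else 0]
  refine Finset.sum_congr rfl fun t _ => ?_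
  rw [Finset.prod_boole]
  simp

lemma letterWeight_of_forall {P : ℕ → Fin 2 → Prop} [∀ i a, Decidable (P i a)] {i : ℕ}
    (h : ∀ a, P i a) : letterWeight (fun i a => if P i a then 1 else 0) i = transfer := by
  have : (fun a : Fin 2 => if P i a then (1 : ℝ) else 0) = 1 := by
    ext a
    simp [h a]
  rw [letterWeight, this, Matrix.diagonal_one', one_mul]

lemma letterWeight_of_iff {P : ℕ → Fin 2 → Prop} [∀ i a, Decidable (P i a)] {i : ℕ} {b : Fin 2}
    (h : ∀ a, P i a ↔ a = b) :
    letterWeight (fun i a => if P i a then 1 else 0) i = pin b * transfer := by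
  have : (fun a : Fin 2 => if P i a then (1 : ℝ) else 0) = fun a => if a = b then 1 else 0 := by
    ext a
    simp [h a]
  rw [letterWeight, this, pin]

/-- The indicator of an edge in a tile. -/
def edgeVec (t : Tile (SimpleGraph.cycleGraph L)) (e : Fin L) : ℤ :=
  if word t e = 1 then 1 else 0

lemma card_tile (hL : 3 ≤ L) :
    (Fintype.card (Tile (SimpleGraph.cycleGraph L)) : ℝ) = (transfer ^ L).trace := by
  have h := sum_tile_indicator (L := L) hL fun _ _ => True
  rw [orderedProd_eq_pow (V := transfer) fun i _ => letterWeight_of_forall (by simp)] at h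
  rw [← h]
  simp

/-- The number of tiles containing the edges `0` and `d`. -/
lemma sum_edge_zero_mul_edge (hL : 3 ≤ L) (d : Fin L) :
    ∑ t : Tile (SimpleGraph.cycleGraph L), (edgeVec t 0 : ℝ) * edgeVec t d =
      (transfer ^ (d : ℕ)) 1 1 * (transfer ^ (L - d)) 1 1 := by
  have h := sum_tile_indicator (L := L) hL fun i a => (i = 0 → a = 1) ∧ (i = d → a = 1)
  have e : ∀ t : Tile (SimpleGraph.cycleGraph L), (edgeVec t 0 : ℝ) * edgeVec t d =
      if ∀ i : Fin L, ((i : ℕ) = 0 → word t i = 1) ∧ ((i : ℕ) = d → word t i = 1)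
        then 1 else 0 := by
    intro t
    have : (∀ i : Fin L, ((i : ℕ) = 0 → word t i = 1) ∧ ((i : ℕ) = d → word t i = 1)) ↔
        word t 0 = 1 ∧ word t d = 1 := by
      constructor
      · exact fun h => ⟨(h 0).1 (by simp), (h d).2 rfl⟩
      · rintro ⟨h0, hd⟩ i
        refine ⟨fun hi => ?_, fun hi => ?_⟩
        · rwa [show i = 0 from Fin.ext (by simpa using hi)]
        · rwa [Fin.ext hi]
    simp only [this, edgeVec]
    split_ifs <;> simp_all
  simp_rw [e]
  rw [h]
  have hdL := d.isLt
  set W := letterWeight fun i a => if (i = 0 → a = 1) ∧ (i = (d : ℕ) → a = 1) then 1 else 0 with hW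
  have h0 : W 0 = pin 1 * transfer := letterWeight_of_iff (by simp +contextual)
  rcases Nat.eq_zero_or_pos (d : ℕ) with hd | hd
  · have hsplit : orderedProd W L = W 0 * transfer ^ (L - 1) := by
      conv_lhs => rw [show L = 1 + (L - 1) by lia, orderedProd_add]
      rw [orderedProd_eq_pow (V := transfer) (n := L - 1)]
      · simp [orderedProd]
      · intro i hi
        exact letterWeight_of_forall fun a => ⟨fun h => by lia, fun h => by lia⟩
    rw [hsplit, h0, mul_assoc, ← pow_succ', trace_pin_mul, hd]
    rw [show L - 1 + 1 = L - 0 by lia]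
    simp
  · have hd' : W d = pin 1 * transfer := letterWeight_of_iff (by simp +contextual)
    have hsplit : orderedProd W L =
        W 0 * transfer ^ ((d : ℕ) - 1) * W d * transfer ^ (L - d - 1) := by
      conv_lhs => rw [show L = 1 + ((d : ℕ) - 1) + 1 + (L - d - 1) by lia, orderedProd_add,
        orderedProd_add, orderedProd_add]
      rw [orderedProd_eq_pow (V := transfer) (n := L - d - 1),
        orderedProd_eq_pow (V := transfer) (n := (d : ℕ) - 1)]
      · simp only [orderedProd, one_mul, add_zero]
        rw [show 1 + ((d : ℕ) - 1) = d by lia]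
      · intro i hi
        exact letterWeight_of_forall fun a => ⟨fun h => by lia, fun h => by lia⟩
      · intro i hi
        exact letterWeight_of_forall fun a => ⟨fun h => by lia, fun h => by lia⟩
    have hsplit' : orderedProd W L =
        pin 1 * (transfer ^ (d : ℕ) * pin 1 * transfer ^ (L - d)) := by
      rw [hsplit, h0, hd', mul_assoc (pin 1) transfer, ← pow_succ',
        show (d : ℕ) - 1 + 1 = d by lia, mul_assoc _ _ (transfer ^ (L - d - 1)),
        mul_assoc _ transfer, ← pow_succ', show L - d - 1 + 1 = L - d by lia]
      simp only [mul_assoc]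
    rw [hsplit', trace_pin_mul, mul_pin_mul_apply]

/-- By rotation, the number of tiles containing two given edges depends on their distance only. -/
lemma sum_edge_mul_edge (hL : 3 ≤ L) (e f : Fin L) :
    ∑ t : Tile (SimpleGraph.cycleGraph L), (edgeVec t e : ℝ) * edgeVec t f =
      (transfer ^ ((f - e : Fin L) : ℕ)) 1 1 * (transfer ^ (L - (f - e : Fin L))) 1 1 := by
  rw [← sum_edge_zero_mul_edge hL]
  simp only [edgeVec]
  rw [sum_tile_eq_sum_word hL fun x => ((if x e = 1 then 1 else 0 : ℤ) : ℝ) *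
    ((if x f = 1 then 1 else 0 : ℤ) : ℝ),
    sum_tile_eq_sum_word hL fun x => ((if x 0 = 1 then 1 else 0 : ℤ) : ℝ) *
    ((if x (f - e) = 1 then 1 else 0 : ℤ) : ℝ)]
  refine Fintype.sum_equiv ((Equiv.subRight e).symm.arrowCongr (Equiv.refl _)).symm _ _ fun x => ?_
  simp only [Equiv.arrowCongr_symm, Equiv.symm_symm, Equiv.arrowCongr_apply, Function.comp_apply,
    Equiv.refl_symm, Equiv.coe_refl, id_eq, Equiv.subRight_symm_apply]
  congr 1
  · simp
  · refine Fintype.prod_equiv (Equiv.subRight e) _ _ fun i => ?_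
    simp
    rw [show i - e + 1 + e = i + 1 by abel]

lemma sum_edge (hL : 3 ≤ L) (e : Fin L) :
    ∑ t : Tile (SimpleGraph.cycleGraph L), (edgeVec t e : ℝ) = (transfer ^ L) 1 1 := by
  have h := sum_edge_mul_edge hL e e
  have h2 : ∀ t : Tile (SimpleGraph.cycleGraph L), (edgeVec t e : ℝ) * edgeVec t e = edgeVec t e := by
    intro t
    simp only [edgeVec]
    split_ifs <;> simp
  simp_rw [h2] at h
  rw [h]
  simp

/-- The letters of a configuration. -/
def configWord (j : Finset ℕ) (i : ℕ) : Fin 2 := if i ∈ j then 1 else 0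

open Classical in
/-- The indicator of the tiles with local configuration `j`. -/
def configInd (j : Finset ℕ) (t : Tile (SimpleGraph.cycleGraph L)) : ℝ :=
  if localConfig t = j then 1 else 0

lemma windowEdge_eq_cycleEdge (e : Fin L) : windowEdge L e = cycleEdge e := by
  have h1 : Fin.ofNat L (e : ℕ) = e := by simp
  have h2 : Fin.ofNat L ((e : ℕ) + 1) = e + 1 := by
    apply Fin.ext
    simp [Fin.val_add]
  rw [windowEdge, h1, h2, cycleEdge]

lemma localConfig_eq_iff (hL : 7 ≤ L) {j : Finset ℕ} (hj : j ⊆ Finset.range 6)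
    (t : Tile (SimpleGraph.cycleGraph L)) :
    localConfig t = j ↔ ∀ e : Fin L, (e : ℕ) < 6 → word t e = configWord j e := by
  classical
  have hmem : ∀ e : Fin L, (e : ℕ) < 6 → ((e : ℕ) ∈ localConfig t ↔ word t e = 1) := by
    intro e he
    rw [word_eq_one_iff, ← windowEdge_eq_cycleEdge]
    simp [localConfig, he]
  have h2 : ∀ a b : Fin 2, (a = 1 ↔ b = 1) → a = b := by decide
  constructor
  · intro h e he
    refine h2 _ _ ?_
    rw [← hmem e he, h, configWord]
    simp
  · intro h
    ext i
    by_cases hi : i < 6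
    · have h3 := hmem ⟨i, by lia⟩ hi
      have h4 := h ⟨i, by lia⟩ hi
      rw [h4] at h3
      simp only [configWord] at h3
      rw [h3]
      simp
    · have h5 : i ∉ j := fun hij => hi (Finset.mem_range.1 (hj hij))
      have h6 : i ∉ localConfig t := by simp [localConfig, hi]
      simp [h5, h6]

lemma configWord_adjacent {j : Finset ℕ} (hj : IsLocalConfig j) (i : ℕ) (hi : i < 5) :
    ¬ (configWord j i = 1 ∧ configWord j (i + 1) = 1) := by
  have := hj.2 (i + 1) (by simp; lia)
  simpa [configWord] using this

/-- The six letters of the window are prescribed and the other `L - 6` letters are free. -/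
lemma sum_configInd (hL : 7 ≤ L) {j : Finset ℕ} (hj : IsLocalConfig j) :
    ∑ t : Tile (SimpleGraph.cycleGraph L), configInd j t =
      (transfer ^ (L - 5)) (configWord j 5) (configWord j 0) := by
  classical
  have h := sum_tile_indicator (L := L) (by lia) fun i a => i < 6 → a = configWord j i
  simp only [configInd, localConfig_eq_iff hL hj.1]
  rw [h]
  set W := letterWeight fun i a => if i < 6 → a = configWord j i then (1 : ℝ) else 0 with hW
  -- the six prescribed letters leave a factor `transfer` after the last of them
  have hsplit : orderedProd W L = orderedProd W (5 + 1) * transfer ^ (L - 6) := by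
    conv_lhs => rw [show L = 5 + 1 + (L - 6) by lia, orderedProd_add]
    rw [orderedProd_eq_pow (V := transfer) (n := L - 6)]
    intro i hi
    exact letterWeight_of_forall fun a h => by lia
  rw [hsplit, trace_orderedProd_pin_mul (configWord j) 5
    (fun i hi => letterWeight_of_iff fun a => by simp [show i < 6 by lia])
    (configWord_adjacent hj), ← pow_succ', show L - 6 + 1 = L - 5 by lia]

lemma sum_configInd_mul_edge_of_lt (hL : 7 ≤ L) {j : Finset ℕ} (hj : IsLocalConfig j) (e : Fin L)
    (he : (e : ℕ) < 6) : ∑ t : Tile (SimpleGraph.cycleGraph L), configInd j t * edgeVec t e =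
      if configWord j e = 1 then ∑ t : Tile (SimpleGraph.cycleGraph L), configInd j t else 0 := by
  have h : ∀ t : Tile (SimpleGraph.cycleGraph L), configInd j t * edgeVec t e =
      if configWord j e = 1 then configInd j t else 0 := by
    intro t
    by_cases ht : localConfig t = j
    · have := (localConfig_eq_iff hL hj.1 t).1 ht e he
      simp [configInd, edgeVec, ht, this]
    · simp [configInd, ht]
  simp_rw [h]
  split_ifs <;> simp

lemma sum_configInd_mul_edge_of_le (hL : 7 ≤ L) {j : Finset ℕ} (hj : IsLocalConfig j) (e : Fin L)
    (he : 6 ≤ (e : ℕ)) : ∑ t : Tile (SimpleGraph.cycleGraph L), configInd j t * edgeVec t e =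
      (transfer ^ ((e : ℕ) - 5)) (configWord j 5) 1 *
        (transfer ^ (L - e)) 1 (configWord j 0) := by
  classical
  have heL := e.isLt
  have h := sum_tile_indicator (L := L) (by lia)
    fun i a => (i < 6 → a = configWord j i) ∧ (i = (e : ℕ) → a = 1)
  have hind : ∀ t : Tile (SimpleGraph.cycleGraph L), configInd j t * edgeVec t e =
      if ∀ i : Fin L, ((i : ℕ) < 6 → word t i = configWord j i) ∧ ((i : ℕ) = e → word t i = 1)
        then 1 else 0 := by
    intro t
    have : (∀ i : Fin L, ((i : ℕ) < 6 → word t i = configWord j i) ∧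
        ((i : ℕ) = e → word t i = 1)) ↔ localConfig t = j ∧ word t e = 1 := by
      rw [localConfig_eq_iff hL hj.1, forall_and]
      refine and_congr_right fun _ => ⟨fun h => h e rfl, fun h i hi => ?_⟩
      rwa [Fin.ext hi]
    simp only [this, configInd, edgeVec]
    split_ifs <;> simp_all
  simp_rw [hind]
  rw [h]
  set W := letterWeight fun i a =>
    if (i < 6 → a = configWord j i) ∧ (i = (e : ℕ) → a = 1) then (1 : ℝ) else 0 with hW
  have hWe : W e = pin 1 * transfer :=
    letterWeight_of_iff fun a => by simp [show ¬ (e : ℕ) < 6 by lia]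
  have hsplit : orderedProd W L = orderedProd W (5 + 1) *
      (transfer ^ ((e : ℕ) - 6) * W e * transfer ^ (L - e - 1)) := by
    conv_lhs => rw [show L = 5 + 1 + ((e : ℕ) - 6) + 1 + (L - e - 1) by lia, orderedProd_add,
      orderedProd_add, orderedProd_add]
    rw [orderedProd_eq_pow (V := transfer) (n := L - e - 1),
      orderedProd_eq_pow (V := transfer) (n := (e : ℕ) - 6)]
    · simp only [orderedProd, one_mul, add_zero]
      rw [show 5 + 1 + ((e : ℕ) - 6) = e by lia]
      simp only [mul_assoc]
    · intro i hi
      exact letterWeight_of_forall fun a => ⟨fun h => by lia, fun h => by lia⟩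
    · intro i hi
      exact letterWeight_of_forall fun a => ⟨fun h => by lia, fun h => by lia⟩
  rw [hsplit, trace_orderedProd_pin_mul (configWord j) 5
    (fun i hi => letterWeight_of_iff fun a => by
      simp [show i < 6 by lia, show i ≠ (e : ℕ) by lia])
    (configWord_adjacent hj), hWe, ← mul_assoc, ← mul_assoc, ← mul_assoc, ← pow_succ',
    mul_assoc _ transfer, ← pow_succ', mul_pin_mul_apply, show (e : ℕ) - 6 + 1 = e - 5 by lia,
    show L - e - 1 + 1 = L - e by lia]

end Counting

section Regression

/-! ### Linear regression -/

/-- If `y` solves the normal equations, then the residual of the regression of `A` on `Y` is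
uncorrelated with `Y`, and its variance is that of `A` reduced by the covariance of `A` with
the regression. -/
lemma residual_variance {T ι : Type*} [Fintype T] [Fintype ι] [Nonempty T] (A : T → ℝ)
    (Y : T → ι → ℝ) (y b η : ι → ℝ) (S : ι → ι → ℝ) (μ : ℝ)
    (hμ : (Fintype.card T : ℝ)⁻¹ * ∑ t, A t = μ)
    (hη : ∀ i, (Fintype.card T : ℝ)⁻¹ * ∑ t, Y t i = η i)
    (hb : ∀ i, (Fintype.card T : ℝ)⁻¹ * ∑ t, A t * Y t i - μ * η i = b i)
    (hS : ∀ j i, (Fintype.card T : ℝ)⁻¹ * ∑ t, Y t j * Y t i - η j * η i = S j i)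
    (hy : ∀ i, ∑ j, y j * S j i = b i) :
    (∀ i, ∑ t, (A t - ∑ j, y j * Y t j) * (Y t i - η i) = 0) ∧
    (Fintype.card T : ℝ)⁻¹ * ∑ t, (A t - ∑ j, y j * Y t j) ^ 2 -
        ((Fintype.card T : ℝ)⁻¹ * ∑ t, (A t - ∑ j, y j * Y t j)) ^ 2 =
      (Fintype.card T : ℝ)⁻¹ * ∑ t, A t ^ 2 - μ ^ 2 - ∑ i, y i * b i := by
  have hn : (Fintype.card T : ℝ) ≠ 0 := by positivity
  set n := (Fintype.card T : ℝ) with hndef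
  have hsum : ∀ f : T → ℝ, ∑ t, (∑ j, y j * Y t j) * f t = ∑ j, y j * ∑ t, Y t j * f t := by
    intro f
    simp_rw [Finset.sum_mul, Finset.mul_sum]
    rw [Finset.sum_comm]
    exact Finset.sum_congr rfl fun j _ => Finset.sum_congr rfl fun t _ => by ring
  have hAs : ∑ t, A t = n * μ := by rw [← hμ]; field_simp
  have hYs : ∀ i, ∑ t, Y t i = n * η i := fun i => by rw [← hη]; field_simp
  have hAYs : ∀ i, ∑ t, A t * Y t i = n * (b i + μ * η i) := fun i => by
    rw [← hb]; field_simp; ring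
  have hYYs : ∀ j i, ∑ t, Y t j * Y t i = n * (S j i + η j * η i) := fun j i => by
    rw [← hS]; field_simp; ring
  set g := ∑ j, y j * η j with hg
  have hR : ∑ t, (A t - ∑ j, y j * Y t j) = n * (μ - g) := by
    have := hsum fun _ => 1
    simp only [mul_one, hYs] at this
    rw [Finset.sum_sub_distrib, this, hAs, hg, mul_sub, Finset.mul_sum]
    congr 1
    exact Finset.sum_congr rfl fun j _ => by ring
  have hRY : ∀ i, ∑ t, (A t - ∑ j, y j * Y t j) * Y t i = n * (μ - g) * η i := by
    intro i
    simp_rw [sub_mul]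
    rw [Finset.sum_sub_distrib, hsum, hAYs]
    simp_rw [hYYs]
    have : ∑ j, y j * (n * (S j i + η j * η i)) = n * (∑ j, y j * S j i + g * η i) := by
      rw [hg, Finset.sum_mul, ← Finset.sum_add_distrib, Finset.mul_sum]
      exact Finset.sum_congr rfl fun j _ => by ring
    rw [this, hy]
    ring
  have hRA : ∑ t, (A t - ∑ j, y j * Y t j) * A t =
      ∑ t, A t ^ 2 - n * (∑ i, y i * b i + g * μ) := by
    simp_rw [sub_mul]
    rw [Finset.sum_sub_distrib, hsum]
    congr 1
    · exact Finset.sum_congr rfl fun t _ => by ring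
    · rw [hg, Finset.sum_mul, ← Finset.sum_add_distrib, Finset.mul_sum]
      refine Finset.sum_congr rfl fun j _ => ?_
      have := hAYs j
      simp_rw [mul_comm (A _)] at this
      rw [this]
      ring
  refine ⟨fun i => ?_, ?_⟩
  · simp_rw [mul_sub, Finset.sum_sub_distrib, ← Finset.sum_mul, hR, hRY]
    ring
  · have hRR : ∑ t, (A t - ∑ j, y j * Y t j) ^ 2 =
        ∑ t, A t ^ 2 - n * (∑ i, y i * b i + g * μ) - n * (μ - g) * g := by
      have h1 : ∀ t, (A t - ∑ j, y j * Y t j) ^ 2 = (A t - ∑ j, y j * Y t j) * A t -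
          (∑ j, y j * Y t j) * (A t - ∑ j, y j * Y t j) := fun t => by ring
      simp_rw [h1]
      rw [Finset.sum_sub_distrib, hRA, hsum]
      congr 1
      rw [hg, Finset.mul_sum]
      refine Finset.sum_congr rfl fun j _ => ?_
      have := hRY j
      simp_rw [mul_comm _ (Y _ j)] at this
      rw [this]
      ring
    rw [hRR, hR]
    field_simp
    ring

end Regression

section Covariance

/-! ### The covariance matrix of the edges -/

/-- The shape of the powers of the transfer matrix; the quadratic identity is the determinant. -/
lemma exists_transfer_pow_eq (n : ℕ) :
    ∃ a b : ℝ, transfer ^ n = !![a + b, b; b, a] ∧ a ^ 2 + a * b - b ^ 2 = (-1) ^ n := by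
  induction n with
  | zero => exact ⟨1, 0, by ext i j; fin_cases i <;> fin_cases j <;> simp, by norm_num⟩
  | succ n ih =>
    obtain ⟨a, b, h1, h2⟩ := ih
    refine ⟨b, a + b, ?_, ?_⟩
    · rw [pow_succ, h1, transfer]
      ext i j
      fin_cases i <;> fin_cases j <;> simp <;> ring
    · rw [pow_succ (-1 : ℝ), ← h2]
      ring

/-- The operator `D` (sum of the two neighbours plus three times the central value) turns the
number of words with a prescribed letter at a moving position into a constant. -/
lemma transfer_pow_neighbours (m n : ℕ) (a b : Fin 2) :
    (transfer ^ m) a 1 * (transfer ^ (n + 2)) 1 b + (transfer ^ (m + 2)) a 1 * (transfer ^ n) 1 b +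
      3 * ((transfer ^ (m + 1)) a 1 * (transfer ^ (n + 1)) 1 b) =
    (transfer ^ (m + n + 2)) a b + (transfer ^ (m + n)) a b := by
  have e1 : transfer ^ (m + n + 2) = transfer ^ m * (transfer * (transfer * transfer ^ n)) := by
    rw [← pow_succ', ← pow_succ', ← pow_add]
    congr 1
  rw [e1, pow_add transfer m n, pow_succ' transfer (n + 1), pow_succ' transfer n,
    pow_succ transfer (m + 1), pow_succ transfer m]
  simp only [Matrix.mul_apply, Fin.sum_univ_two, transfer_apply]
  simp
  ring

variable {L : ℕ} [NeZero L]

lemma apply_val_add_one {g : ℕ → ℝ} (hg : g L = g 0) (d : Fin L) :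
    g ((d + 1 : Fin L) : ℕ) = g (d + 1) := by
  rw [Fin.val_add]
  have hd := d.isLt
  rcases Nat.lt_or_ge ((d : ℕ) + 1) L with h | h
  · have : ((1 : Fin L) : ℕ) = 1 % L := Fin.val_one' L
    rw [this, Nat.add_mod_mod, Nat.mod_eq_of_lt h]
  · have h2 : (d : ℕ) + 1 = L := by lia
    have : ((1 : Fin L) : ℕ) = 1 % L := Fin.val_one' L
    rw [this, Nat.add_mod_mod, h2, Nat.mod_self, hg]

lemma val_sub_one {d : Fin L} (hd : (d : ℕ) ≠ 0) : ((d - 1 : Fin L) : ℕ) = d - 1 := by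
  have h1 : (d - 1 : Fin L) = ⟨d - 1, by lia⟩ := by
    rw [sub_eq_iff_eq_add]
    apply Fin.ext
    rw [Fin.val_add]
    have : ((1 : Fin L) : ℕ) = 1 % L := Fin.val_one' L
    rw [this, Nat.add_mod_mod]
    simp only
    rw [Nat.sub_add_cancel (by lia), Nat.mod_eq_of_lt d.isLt]
  rw [h1]

lemma val_zero_sub_one : ((0 - 1 : Fin L) : ℕ) = L - 1 := by
  obtain ⟨n, rfl⟩ := Nat.exists_eq_succ_of_ne_zero (NeZero.ne L)
  have h1 : (0 - 1 : Fin (n + 1)) = Fin.last n := by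
    rw [sub_eq_iff_eq_add]
    simp
  simp [h1]

/-- The number of tiles. -/
def tileNumber (L : ℕ) : ℝ := (transfer ^ L).trace

/-- The edge density of a uniform tile. -/
def edgeDensity (L : ℕ) : ℝ := (transfer ^ L) 1 1 / tileNumber L

/-- The covariance of the indicators of two edges of a uniform tile, at distance `d`. -/
def edgeCov (L d : ℕ) : ℝ :=
  (transfer ^ d) 1 1 * (transfer ^ (L - d)) 1 1 / tileNumber L - edgeDensity L ^ 2

lemma tileNumber_pos (hL : 3 ≤ L) : 0 < tileNumber L := by
  rw [tileNumber, ← card_tile hL, Nat.cast_pos, Fintype.card_pos_iff]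
  obtain ⟨t, -⟩ := exists_tile_word_eq hL (fun _ => 0) (by simp)
  exact ⟨t⟩

/-- Up to a scalar factor and a multiple of the all-ones matrix, the operator `D` inverts the
covariance matrix of the edge indicators. -/
lemma edgeCov_neighbours (hL : 3 ≤ L) (hodd : Odd L) (d : Fin L) :
    edgeCov L (d + 1 : Fin L) + edgeCov L (d - 1 : Fin L) + 3 * edgeCov L d =
      (if d = 0 then (transfer ^ L) 0 1 / tileNumber L else 0) - 1 / tileNumber L ^ 2 := by
  have hpos := (tileNumber_pos hL).ne'
  have hdL := d.isLt
  have hg : edgeCov L L = edgeCov L 0 := by simp [edgeCov, mul_comm]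
  rw [apply_val_add_one hg]
  obtain ⟨n, hn⟩ : ∃ n, L = n + 2 := ⟨L - 2, by lia⟩
  obtain ⟨a, b, hab, hdet⟩ := exists_transfer_pow_eq n
  -- this is where `L` odd enters: the determinant of `transfer ^ n` is `-1`
  have hnodd : Odd n := by
    rw [hn] at hodd
    exact (Nat.odd_add.1 hodd).2 (by decide)
  rw [hnodd.neg_one_pow] at hdet
  have hML : transfer ^ L = !![2 * (a + b) + b, a + 2 * b; a + 2 * b, a + b] := by
    rw [hn, pow_add, hab, sq, transfer]
    ext i j
    fin_cases i <;> fin_cases j <;> simp <;> ring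
  have htr : tileNumber L = 3 * a + 4 * b := by
    rw [tileNumber, hML]
    simp [Matrix.trace]
    ring
  have key : (transfer ^ L) 1 1 + (transfer ^ n) 1 1 =
      5 * edgeDensity L ^ 2 * tileNumber L - 1 / tileNumber L := by
    rw [edgeDensity]
    field_simp
    rw [hML, hab, htr]
    simp
    linear_combination hdet
  by_cases hd : (d : ℕ) = 0
  · have hd0 : d = 0 := Fin.ext (by simpa using hd)
    have e1 : ((d - 1 : Fin L) : ℕ) = L - 1 := by rw [hd0]; exact val_zero_sub_one
    rw [e1, if_pos hd0, hd]
    have h1 : (transfer ^ 1) 1 1 = 0 := by simp [transfer]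
    have h3 : L - (L - 1) = 1 := by lia
    simp only [edgeCov, zero_add, h1, h3, pow_zero, Nat.sub_zero]
    have h4 : 3 * (transfer ^ L) 1 1 = (transfer ^ L) 1 1 + (transfer ^ n) 1 1 +
        (transfer ^ L) 0 1 := by
      rw [hML, hab]
      simp
      ring
    rw [key] at h4
    simp only [Matrix.one_apply_eq]
    field_simp
    field_simp at h4
    linear_combination h4
  · have hd0 : d ≠ 0 := fun h => hd (by rw [h]; simp)
    rw [val_sub_one hd, if_neg hd0]
    obtain ⟨m, hm⟩ : ∃ m, (d : ℕ) = m + 1 := ⟨d - 1, by lia⟩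
    obtain ⟨k, hk⟩ : ∃ k, L - d = k + 1 := ⟨L - d - 1, by lia⟩
    have := transfer_pow_neighbours m k 1 1
    rw [show m + k + 2 = L by lia, show m + k = n by lia, key] at this
    simp only [edgeCov, hm]
    rw [show L - (m + 1 + 1) = k by lia, show L - (m + 1 - 1) = k + 2 by lia,
      show L - (m + 1) = k + 1 by lia, show m + 1 - 1 = m by lia]
    field_simp
    field_simp at this
    linear_combination this

lemma sum_edgeCov (hL : 3 ≤ L) (hodd : Odd L) :
    5 * ∑ d : Fin L, edgeCov L d =
      (transfer ^ L) 0 1 / tileNumber L - L / tileNumber L ^ 2 := by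
  have h1 : ∑ d : Fin L, edgeCov L (d + 1 : Fin L) = ∑ d : Fin L, edgeCov L d :=
    Equiv.sum_comp (Equiv.addRight (1 : Fin L)) fun d => edgeCov L d
  have h2 : ∑ d : Fin L, edgeCov L (d - 1 : Fin L) = ∑ d : Fin L, edgeCov L d :=
    Equiv.sum_comp (Equiv.subRight (1 : Fin L)) fun d => edgeCov L d
  have h := Finset.sum_congr (rfl : (Finset.univ : Finset (Fin L)) = Finset.univ)
    fun d _ => edgeCov_neighbours hL hodd d
  rw [Finset.sum_add_distrib, Finset.sum_add_distrib, h1, h2, ← Finset.mul_sum,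
    Finset.sum_sub_distrib] at h
  simp only [Finset.sum_ite_eq', Finset.mem_univ, if_true, Finset.sum_const, Finset.card_univ,
    Fintype.card_fin, nsmul_eq_mul] at h
  rw [mul_one_div] at h
  linarith

/-- The operator `D`: the sum of the two neighbouring values plus three times the central value. -/
def neighbourSum (b : Fin L → ℝ) (e : Fin L) : ℝ := b (e + 1) + b (e - 1) + 3 * b e

/-- The regression coefficients obtained by inverting the covariance matrix of the edges. -/
def regressionCoeff (b : Fin L → ℝ) (e : Fin L) : ℝ :=
  tileNumber L / (transfer ^ L) 0 1 * (neighbourSum b e +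
    5 * (∑ f, b f) / ((transfer ^ L) 0 1 * tileNumber L - L))

lemma sum_regressionCoeff_mul_edgeCov (hL : 3 ≤ L) (hodd : Odd L)
    (hF : (transfer ^ L) 0 1 ≠ 0) (hFL : (transfer ^ L) 0 1 * tileNumber L - L ≠ 0)
    (b : Fin L → ℝ) (i : Fin L) :
    ∑ e, regressionCoeff b e * edgeCov L (i - e : Fin L) = b i := by
  have hpos := (tileNumber_pos hL).ne'
  have h1 : ∑ e : Fin L, b (e + 1) * edgeCov L (i - e : Fin L) =
      ∑ e : Fin L, b e * edgeCov L (i - e + 1 : Fin L) := by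
    rw [← Equiv.sum_comp (Equiv.addRight (1 : Fin L)) fun e => b e * edgeCov L (i - e + 1 : Fin L)]
    refine Finset.sum_congr rfl fun e _ => ?_
    simp only [Equiv.coe_addRight]
    rw [show i - (e + 1) + 1 = i - e by abel]
  have h2 : ∑ e : Fin L, b (e - 1) * edgeCov L (i - e : Fin L) =
      ∑ e : Fin L, b e * edgeCov L (i - e - 1 : Fin L) := by
    rw [← Equiv.sum_comp (Equiv.subRight (1 : Fin L)) fun e => b e * edgeCov L (i - e - 1 : Fin L)]
    refine Finset.sum_congr rfl fun e _ => ?_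
    simp only [Equiv.subRight_apply]
    rw [show i - (e - 1) - 1 = i - e by abel]
  have h3 : ∑ e : Fin L, neighbourSum b e * edgeCov L (i - e : Fin L) =
      b i * ((transfer ^ L) 0 1 / tileNumber L) - (∑ e, b e) / tileNumber L ^ 2 := by
    simp only [neighbourSum, add_mul, Finset.sum_add_distrib, h1, h2]
    rw [← Finset.sum_add_distrib, ← Finset.sum_add_distrib]
    have : ∀ e : Fin L, b e * edgeCov L (i - e + 1 : Fin L) + b e * edgeCov L (i - e - 1 : Fin L) +
        3 * b e * edgeCov L (i - e : Fin L) =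
        (if i = e then b e * ((transfer ^ L) 0 1 / tileNumber L) else 0) -
          b e * (1 / tileNumber L ^ 2) := by
      intro e
      have h := edgeCov_neighbours hL hodd (i - e)
      simp only [sub_eq_zero] at h
      have h' := congrArg (b e * ·) h
      simp only [mul_sub, mul_ite, mul_zero] at h'
      rw [← h']
      ring
    rw [Finset.sum_congr rfl fun e _ => this e, Finset.sum_sub_distrib, Finset.sum_ite_eq,
      if_pos (Finset.mem_univ i), ← Finset.sum_mul, mul_one_div]
  have h4 : ∑ e : Fin L, edgeCov L (i - e : Fin L) = ∑ d : Fin L, edgeCov L d :=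
    (Equiv.subLeft i).sum_comp fun d => edgeCov L d
  have h5 := sum_edgeCov hL hodd
  have h6 : ∑ d : Fin L, edgeCov L d =
      ((transfer ^ L) 0 1 * tileNumber L - L) / (5 * tileNumber L ^ 2) := by
    rw [eq_div_iff (by positivity), ← mul_assoc, mul_comm _ (5 : ℝ), h5]
    field_simp
  have h7 : ∑ e, regressionCoeff b e * edgeCov L (i - e : Fin L) =
      tileNumber L / (transfer ^ L) 0 1 * (∑ e, neighbourSum b e * edgeCov L (i - e : Fin L) +
      5 * (∑ f, b f) / ((transfer ^ L) 0 1 * tileNumber L - L) *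
        ∑ e : Fin L, edgeCov L (i - e : Fin L)) := by
    rw [Finset.mul_sum, ← Finset.sum_add_distrib, Finset.mul_sum]
    refine Finset.sum_congr rfl fun e _ => ?_
    rw [regressionCoeff]
    ring
  have h8 : 5 * (∑ f, b f) / ((transfer ^ L) 0 1 * tileNumber L - L) *
      (((transfer ^ L) 0 1 * tileNumber L - L) / (5 * tileNumber L ^ 2)) =
      (∑ f, b f) / tileNumber L ^ 2 := by
    generalize (transfer ^ L) 0 1 * tileNumber L - L = G at hFL
    field_simp
  rw [h7, h3, h4, h6, h8]
  field_simp
  ring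

end Covariance

section Golden

/-! ### Powers of the transfer matrix and the golden ratio -/

/-- Spectral decomposition of the powers of the transfer matrix, whose eigenvalues `r`, `s` are the
roots of `X² - X - 1`. -/
lemma sub_mul_transfer_pow_apply {r s : ℝ} (hadd : r + s = 1) (hmul : r * s = -1) (n : ℕ)
    (a b : Fin 2) :
    (r - s) * (transfer ^ n) a b = r ^ n * r ^ (1 - (a : ℕ) - (b : ℕ) : ℤ) -
      s ^ n * s ^ (1 - (a : ℕ) - (b : ℕ) : ℤ) := by
  have hr : r⁻¹ = -s := inv_eq_of_mul_eq_one_right (by linarith)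
  have hs : s⁻¹ = -r := inv_eq_of_mul_eq_one_right (by linarith)
  have hr2 : r ^ 2 = r + 1 := by linear_combination r * hadd - hmul
  have hs2 : s ^ 2 = s + 1 := by linear_combination s * hadd - hmul
  induction n generalizing b with
  | zero => fin_cases a <;> fin_cases b <;> simp [hr, hs, neg_add_eq_sub]
  | succ n ih =>
    rw [pow_succ, Matrix.mul_apply, Fin.sum_univ_two, mul_add, ← mul_assoc, ← mul_assoc, ih, ih]
    fin_cases a <;> fin_cases b <;> simp [transfer_apply, hr, hs]
    · linear_combination -r ^ n * hr2 + s ^ n * hs2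
    · ring
    · linear_combination -r ^ n * hadd + s ^ n * hadd
    · linear_combination r ^ n * hmul - s ^ n * hmul

open Real in
lemma transfer_pow_apply (n : ℕ) (a b : Fin 2) :
    (transfer ^ n) a b = (goldenRatio ^ n * goldenRatio ^ (1 - (a : ℕ) - (b : ℕ) : ℤ) -
      goldenConj ^ n * goldenConj ^ (1 - (a : ℕ) - (b : ℕ) : ℤ)) / √5 := by
  have h5 : (√5 : ℝ) ≠ 0 := by positivity
  rw [eq_div_iff h5, ← sub_mul_transfer_pow_apply goldenRatio_add_goldenConj
    goldenRatio_mul_goldenConj, goldenRatio_sub_goldenConj, mul_comm]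

open Real in
lemma transfer_pow_sub_apply {k L : ℕ} (hk : k ≤ L) (a b : Fin 2) :
    (transfer ^ (L - k)) a b = (goldenRatio ^ L * goldenRatio ^ (1 - (a : ℕ) - (b : ℕ) - k : ℤ) -
      goldenConj ^ L * goldenConj ^ (1 - (a : ℕ) - (b : ℕ) - k : ℤ)) / √5 := by
  have hexp : ∀ x : ℝ, x ≠ 0 → x ^ (L - k) * x ^ (1 - (a : ℕ) - (b : ℕ) : ℤ) =
      x ^ L * x ^ (1 - (a : ℕ) - (b : ℕ) - k : ℤ) := by
    intro x hx
    rw [← zpow_natCast, ← zpow_natCast, ← zpow_add₀ hx, ← zpow_add₀ hx, Nat.cast_sub hk]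
    congr 1
    ring
  rw [transfer_pow_apply, hexp _ goldenRatio_ne_zero, hexp _ goldenConj_ne_zero]

open Real in
lemma tileNumber_eq (L : ℕ) : tileNumber L = goldenRatio ^ L + goldenConj ^ L := by
  have h5 : goldenRatio - goldenConj ≠ 0 := by rw [goldenRatio_sub_goldenConj]; positivity
  have h0 := sub_mul_transfer_pow_apply goldenRatio_add_goldenConj goldenRatio_mul_goldenConj L 0 0
  have h1 := sub_mul_transfer_pow_apply goldenRatio_add_goldenConj goldenRatio_mul_goldenConj L 1 1
  simp only [Fin.val_zero, Fin.val_one, Nat.cast_zero, Nat.cast_one, sub_zero, zpow_one, sub_self,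
    zero_sub, zpow_neg, inv_goldenRatio, inv_goldenConj] at h0 h1
  rw [tileNumber, Matrix.trace_fin_two]
  refine mul_left_cancel₀ h5 ?_
  rw [mul_add, h0, h1]
  ring

/-- The ratio of the conjugate root to the golden ratio, which governs the rate of convergence. -/
lemma tendsto_conj_div_pow :
    Tendsto (fun L : ℕ => (Real.goldenConj / Real.goldenRatio) ^ L) atTop (𝓝 0) := by
  apply tendsto_pow_atTop_nhds_zero_of_abs_lt_one
  rw [abs_div, abs_of_pos Real.goldenRatio_pos, div_lt_one Real.goldenRatio_pos,
    abs_of_neg Real.goldenConj_neg]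
  linarith [Real.neg_one_lt_goldenConj, Real.one_lt_goldenRatio]

open Real in
lemma tendsto_transfer_pow_div (k : ℕ) (a b : Fin 2) :
    Tendsto (fun L => (transfer ^ (L - k)) a b / tileNumber L) atTop
      (𝓝 (goldenRatio ^ (1 - (a : ℕ) - (b : ℕ) - k : ℤ) / √5)) := by
  have hφ := goldenRatio_ne_zero
  set r : ℕ → ℝ := fun L => (goldenConj / goldenRatio) ^ L with hr
  have hr0 : Tendsto r atTop (𝓝 0) := tendsto_conj_div_pow
  have hlim : Tendsto (fun L => (goldenRatio ^ (1 - (a : ℕ) - (b : ℕ) - k : ℤ) -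
      r L * goldenConj ^ (1 - (a : ℕ) - (b : ℕ) - k : ℤ)) / √5 / (1 + r L)) atTop
      (𝓝 ((goldenRatio ^ (1 - (a : ℕ) - (b : ℕ) - k : ℤ) -
      0 * goldenConj ^ (1 - (a : ℕ) - (b : ℕ) - k : ℤ)) / √5 / (1 + 0))) :=
    ((tendsto_const_nhds.sub (hr0.mul_const _)).div_const _).div (tendsto_const_nhds.add hr0)
      (by norm_num)
  simp only [zero_mul, sub_zero, add_zero, div_one] at hlim
  refine hlim.congr' ?_
  filter_upwards [eventually_ge_atTop k] with L hL
  have hP : goldenConj ^ L = r L * goldenRatio ^ L := by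
    rw [hr]
    simp only
    exact (div_mul_cancel₀ (goldenConj ^ L) (pow_ne_zero L hφ)).symm.trans
      (by rw [div_pow goldenConj goldenRatio])
  rw [transfer_pow_sub_apply hL, tileNumber_eq, hP]
  have hPne : goldenRatio ^ L ≠ 0 := pow_ne_zero _ hφ
  generalize goldenRatio ^ L = P at hPne
  generalize goldenRatio ^ (1 - (a : ℕ) - (b : ℕ) - k : ℤ) = u
  generalize goldenConj ^ (1 - (a : ℕ) - (b : ℕ) - k : ℤ) = v
  rw [show P + r L * P = P * (1 + r L) by ring, show P * u - r L * P * v = P * (u - r L * v) by ring,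
    mul_div_assoc, mul_div_mul_left _ _ hPne]

open Real in
lemma tendsto_div_tileNumber : Tendsto (fun L : ℕ => (L : ℝ) / tileNumber L) atTop (𝓝 0) := by
  have h1 : Tendsto (fun L : ℕ => (L : ℝ) * (goldenRatio⁻¹) ^ L) atTop (𝓝 0) :=
    tendsto_self_mul_const_pow_of_lt_one (inv_nonneg.2 goldenRatio_pos.le)
      (inv_lt_one_of_one_lt₀ one_lt_goldenRatio)
  have h2 := h1.div (tendsto_conj_div_pow.const_add 1) (by norm_num)
  rw [zero_div] at h2
  refine h2.congr fun L => ?_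
  have hφ : goldenRatio ^ L ≠ 0 := pow_ne_zero _ goldenRatio_ne_zero
  simp only [Pi.div_apply]
  rw [tileNumber_eq, div_pow, inv_pow, ← div_eq_mul_inv, div_div, mul_add, mul_one,
    mul_div_cancel₀ _ hφ]

open Real in
lemma tendsto_tileNumber_inv : Tendsto (fun L : ℕ => 1 / tileNumber L) atTop (𝓝 0) := by
  have h := tendsto_div_tileNumber.mul (tendsto_inv_atTop_nhds_zero_nat (𝕜 := ℝ))
  rw [mul_zero] at h
  refine h.congr' ?_
  filter_upwards [eventually_gt_atTop 0] with L hL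
  have : (L : ℝ) ≠ 0 := by positivity
  field_simp

open Real in
lemma transfer_pow_zero_one (L : ℕ) : (transfer ^ L) 0 1 = Nat.fib L := by
  rw [transfer_pow_apply, coe_fib_eq]
  simp

lemma le_transfer_pow_zero_one {L : ℕ} (hL : 7 ≤ L) : (L : ℝ) ≤ (transfer ^ L) 0 1 := by
  rw [transfer_pow_zero_one]
  exact_mod_cast Nat.le_fib_self (by lia)

lemma two_le_tileNumber {L : ℕ} [NeZero L] (hL : 7 ≤ L) : 2 ≤ tileNumber L := by
  have h1 : 0 ≤ (transfer ^ L) 1 1 := by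
    rw [← sum_edge (L := L) (by lia) 0]
    refine Finset.sum_nonneg fun t _ => ?_
    rw [edgeVec]
    split_ifs <;> simp
  obtain ⟨a, b, hab, -⟩ := exists_transfer_pow_eq L
  have h2 := le_transfer_pow_zero_one hL
  have h3 : (7 : ℝ) ≤ L := by exact_mod_cast hL
  rw [tileNumber, Matrix.trace_fin_two]
  rw [hab] at h1 h2 ⊢
  simp at h1 h2 ⊢
  linarith

lemma transfer_mul_tileNumber_sub_pos {L : ℕ} [NeZero L] (hL : 7 ≤ L) :
    0 < (transfer ^ L) 0 1 * tileNumber L - L := by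
  have h1 := two_le_tileNumber hL
  have h2 := le_transfer_pow_zero_one hL
  have h3 : (7 : ℝ) ≤ L := by exact_mod_cast hL
  nlinarith

end Golden

section LocalClass

/-! ### Covariances of a local configuration with the edges -/

/-- The probability that a uniform tile has local configuration `j`. -/
def classDensity (j : Finset ℕ) (L : ℕ) : ℝ :=
  (transfer ^ (L - 5)) (configWord j 5) (configWord j 0) / tileNumber L

/-- The number of tiles with local configuration `j` which contain the edge `e`, for
`0 ≤ e ≤ L`, the position `L` being identified with `0`. -/
def classEdgeNumber (j : Finset ℕ) (L e : ℕ) : ℝ :=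
  if e < 5 then
    if configWord j e = 1 then (transfer ^ (L - 5)) (configWord j 5) (configWord j 0) else 0
  else (transfer ^ (e - 5)) (configWord j 5) 1 * (transfer ^ (L - e)) 1 (configWord j 0)

/-- The covariance of the indicators of the configuration `j` and of the edge `e`. -/
def classEdgeCov (j : Finset ℕ) (L e : ℕ) : ℝ :=
  classEdgeNumber j L e / tileNumber L - classDensity j L * edgeDensity L

lemma classEdgeNumber_five (j : Finset ℕ) (L : ℕ) : classEdgeNumber j L 5 =
    if configWord j 5 = 1 then (transfer ^ (L - 5)) (configWord j 5) (configWord j 0) else 0 := by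
  rw [classEdgeNumber, if_neg (lt_irrefl 5), Nat.sub_self, pow_zero, Matrix.one_apply]
  split_ifs with h <;> simp [h]

lemma classEdgeNumber_last (j : Finset ℕ) {L : ℕ} (hL : 7 ≤ L) :
    classEdgeNumber j L L = classEdgeNumber j L 0 := by
  rw [classEdgeNumber, classEdgeNumber, if_neg (by lia), if_pos (by lia), Nat.sub_self, pow_zero,
    Matrix.one_apply]
  by_cases h : configWord j 0 = 1
  · simp [h]
  · simp [h, eq_comm]

variable {L : ℕ} [NeZero L]

lemma sum_configInd_mul_edge (hL : 7 ≤ L) {j : Finset ℕ} (hj : IsLocalConfig j) (e : Fin L) :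
    ∑ t : Tile (SimpleGraph.cycleGraph L), configInd j t * edgeVec t e =
      classEdgeNumber j L e := by
  rcases Nat.lt_or_ge (e : ℕ) 6 with he | he
  · rw [sum_configInd_mul_edge_of_lt hL hj e he, sum_configInd hL hj]
    rcases Nat.lt_or_ge (e : ℕ) 5 with he' | he'
    · rw [classEdgeNumber, if_pos he']
    · rw [show (e : ℕ) = 5 by lia, classEdgeNumber_five]
  · rw [sum_configInd_mul_edge_of_le hL hj e he, classEdgeNumber, if_neg (by lia)]

/-- The covariance of the configuration `j` with the combination `D` of three consecutive edges
outside the window. It does not depend on the position, and it is exponentially small. -/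
def classTail (j : Finset ℕ) (L : ℕ) : ℝ :=
  ((transfer ^ (L - 5)) (configWord j 5) (configWord j 0) +
    (transfer ^ (L - 7)) (configWord j 5) (configWord j 0)) / tileNumber L -
    5 * (classDensity j L * edgeDensity L)

lemma neighbourSum_classEdgeCov (hL : 7 ≤ L) (j : Finset ℕ) (e : Fin L) :
    neighbourSum (fun e : Fin L => classEdgeCov j L e) e =
      classEdgeCov j L (e + 1) + classEdgeCov j L (if (e : ℕ) = 0 then L - 1 else e - 1) +
        3 * classEdgeCov j L e := by
  have hg : classEdgeCov j L L = classEdgeCov j L 0 := by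
    rw [classEdgeCov, classEdgeCov, classEdgeNumber_last j hL]
  rw [neighbourSum, apply_val_add_one hg]
  split_ifs with h
  · have : e = 0 := Fin.ext (by simpa using h)
    rw [this, val_zero_sub_one]
  · rw [val_sub_one h]

omit [NeZero L] in
lemma classEdgeCov_neighbours (j : Finset ℕ) {e : ℕ} (he : 6 ≤ e) (heL : e < L) :
    classEdgeCov j L (e + 1) + classEdgeCov j L (e - 1) + 3 * classEdgeCov j L e =
      classTail j L := by
  have h := transfer_pow_neighbours (e - 6) (L - e - 1) (configWord j 5) (configWord j 0)
  simp only [classEdgeCov, classEdgeNumber, classTail]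
  rw [if_neg (by lia), if_neg (by lia), if_neg (by lia), show e + 1 - 5 = e - 6 + 2 by lia,
    show L - (e + 1) = L - e - 1 by lia, show e - 1 - 5 = e - 6 by lia,
    show L - (e - 1) = L - e - 1 + 2 by lia, show e - 5 = e - 6 + 1 by lia,
    show L - e = L - e - 1 + 1 by lia, show L - e - 1 + 1 - 1 = L - e - 1 by lia]
  rw [show e - 6 + (L - e - 1) + 2 = L - 5 by lia, show e - 6 + (L - e - 1) = L - 7 by lia] at h
  rw [← h]
  ring

/-- A crude bound, sufficient because it is multiplied by exponentially small factors. -/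
lemma abs_classEdgeCov_le_one (hL : 7 ≤ L) {j : Finset ℕ} (hj : IsLocalConfig j) (e : Fin L) :
    |classEdgeCov j L e| ≤ 1 := by
  have hpos := tileNumber_pos (L := L) (by lia)
  have hcard : (Fintype.card (Tile (SimpleGraph.cycleGraph L)) : ℝ) = tileNumber L :=
    card_tile (by lia)
  have hA : ∀ t : Tile (SimpleGraph.cycleGraph L), 0 ≤ configInd j t ∧ configInd j t ≤ 1 := by
    intro t
    rw [configInd]
    split_ifs <;> simp
  have hX : ∀ t : Tile (SimpleGraph.cycleGraph L), 0 ≤ (edgeVec t e : ℝ) ∧ (edgeVec t e : ℝ) ≤ 1 := by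
    intro t
    rw [edgeVec]
    split_ifs <;> simp
  have hmean : ∀ f : Tile (SimpleGraph.cycleGraph L) → ℝ, (∀ t, 0 ≤ f t ∧ f t ≤ 1) →
      0 ≤ (∑ t, f t) / tileNumber L ∧ (∑ t, f t) / tileNumber L ≤ 1 := by
    intro f hf
    refine ⟨div_nonneg (Finset.sum_nonneg fun t _ => (hf t).1) hpos.le, ?_⟩
    rw [div_le_one hpos, ← hcard]
    exact (Finset.sum_le_sum fun t _ => (hf t).2).trans_eq (by simp)
  have h1 := hmean _ hA
  have h2 := hmean _ hX
  have h3 := hmean (fun t => configInd j t * edgeVec t e) fun t =>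
    ⟨mul_nonneg (hA t).1 (hX t).1, mul_le_one₀ (hA t).2 (hX t).1 (hX t).2⟩
  rw [sum_configInd hL hj] at h1
  rw [sum_edge (by lia)] at h2
  rw [sum_configInd_mul_edge hL hj] at h3
  have h4 : classDensity j L * edgeDensity L ≤ 1 := mul_le_one₀ h1.2 h2.1 h2.2
  have h5 : 0 ≤ classDensity j L * edgeDensity L := mul_nonneg h1.1 h2.1
  rw [classEdgeCov, abs_le]
  constructor <;> linarith [h3.1, h3.2]

/-- The limiting variance per color of the number of tiles with local configuration `j`. -/
def classVariance (j : Finset ℕ) (L : ℕ) [NeZero L] : ℝ :=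
  classDensity j L - classDensity j L ^ 2 -
    ∑ e : Fin L, regressionCoeff (fun e : Fin L => classEdgeCov j L e) e * classEdgeCov j L e

end LocalClass

section LongCycles

/-! ### Long cycles -/

open Real in
/-- The tail covariance is of order `tileNumber L ^ (-2)`: the products of two powers of the same
root cancel, and only the mixed products, whose value is `(-1) ^ L`, remain. -/
lemma classTail_eq (j : Finset ℕ) {L : ℕ} (hL : 7 ≤ L) (h0 : tileNumber L ≠ 0) :
    classTail j L = -(-1) ^ L *
      (goldenRatio ^ (1 - (configWord j 5 : ℕ) - (configWord j 0 : ℕ) - 5 : ℤ) +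
        goldenConj ^ (1 - (configWord j 5 : ℕ) - (configWord j 0 : ℕ) - 5 : ℤ)) /
      tileNumber L ^ 2 := by
  have h5 : (√5 : ℝ) ≠ 0 := by positivity
  -- the inverse of each root is minus its conjugate, so the exponents can be aligned
  have h7 : ∀ (x y : ℝ), x ≠ 0 → x⁻¹ = -y →
      x ^ (1 - (configWord j 5 : ℕ) - (configWord j 0 : ℕ) - 7 : ℤ) =
      x ^ (1 - (configWord j 5 : ℕ) - (configWord j 0 : ℕ) - 5 : ℤ) * y ^ 2 := by
    intro x y hx hxy
    have : y ^ 2 = x ^ (-2 : ℤ) := by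
      rw [← neg_sq, ← hxy, zpow_neg, inv_pow]
      norm_cast
    rw [this, ← zpow_add₀ hx]
    congr 1
    ring
  have e5 := transfer_pow_sub_apply (k := 5) (L := L) (by lia) (configWord j 5) (configWord j 0)
  have e7 := transfer_pow_sub_apply (k := 7) (L := L) (by lia) (configWord j 5) (configWord j 0)
  have e0 := transfer_pow_apply L 1 1
  have hN := tileNumber_eq L
  push_cast at e5 e7
  rw [h7 _ _ goldenRatio_ne_zero inv_goldenRatio, h7 _ _ goldenConj_ne_zero inv_goldenConj] at e7
  simp only [Fin.val_one, Nat.cast_one, sub_self, zero_sub, zpow_neg, zpow_one, inv_goldenRatio,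
    inv_goldenConj] at e0
  have hPQ : goldenRatio ^ L * goldenConj ^ L = (-1) ^ L := by
    rw [← mul_pow, goldenRatio_mul_goldenConj]
  rw [classTail, classDensity, edgeDensity, e5, e7, e0, ← hPQ]
  generalize goldenRatio ^ (1 - (configWord j 5 : ℕ) - (configWord j 0 : ℕ) - 5 : ℤ) = u
  generalize goldenConj ^ (1 - (configWord j 5 : ℕ) - (configWord j 0 : ℕ) - 5 : ℤ) = v
  have hs := goldenRatio_sub_goldenConj
  have hd2 : (√5 : ℝ) ^ 2 = 5 := Real.sq_sqrt (by norm_num)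
  have hadd := goldenRatio_add_goldenConj
  have hmul := goldenRatio_mul_goldenConj
  generalize √5 = d at *
  generalize goldenRatio ^ L = P at *
  generalize goldenConj ^ L = Q at *
  generalize goldenRatio = r at *
  generalize goldenConj = s at *
  generalize tileNumber L = l at *
  have hs2 : 1 + s ^ 2 = -(d * s) := by rw [← hs]; linear_combination hmul
  have hr2 : 1 + r ^ 2 = d * r := by rw [← hs]; linear_combination hmul
  rw [← hd2]
  field_simp
  rw [hN]
  linear_combination P * u * (P + Q) * hs2 - Q * v * (P + Q) * hr2 - d * P * Q * (u + v) * hadd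

open Real in
lemma tendsto_mul_classTail (j : Finset ℕ) :
    Tendsto (fun L : ℕ => (L : ℝ) * classTail j L) atTop (𝓝 0) := by
  set C : ℝ := |goldenRatio ^ (1 - (configWord j 5 : ℕ) - (configWord j 0 : ℕ) - 5 : ℤ) +
    goldenConj ^ (1 - (configWord j 5 : ℕ) - (configWord j 0 : ℕ) - 5 : ℤ)| with hC
  have h := (tendsto_div_tileNumber.mul tendsto_tileNumber_inv).mul_const C
  rw [zero_mul, zero_mul] at h
  refine squeeze_zero_norm' ?_ h
  filter_upwards [eventually_ge_atTop 7] with L hL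
  have : NeZero L := ⟨by lia⟩
  have hpos := tileNumber_pos (L := L) (by lia)
  rw [classTail_eq j hL hpos.ne', norm_mul, norm_div, norm_mul, norm_neg, norm_pow, norm_neg,
    norm_one, one_pow, one_mul, Real.norm_eq_abs (_ + _), ← hC, norm_pow,
    Real.norm_of_nonneg hpos.le, Real.norm_of_nonneg (Nat.cast_nonneg _)]
  refine le_of_eq ?_
  field_simp

/-- The limit of `classDensity`. -/
def limitDensity (j : Finset ℕ) : ℝ :=
  Real.goldenRatio ^ (1 - (configWord j 5 : ℕ) - (configWord j 0 : ℕ) - 5 : ℤ) / √5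

/-- The letter of a configuration, as a real number. -/
def letter (j : Finset ℕ) (e : ℕ) : ℝ := ((configWord j e : ℕ) : ℝ)

lemma tendsto_classDensity (j : Finset ℕ) :
    Tendsto (classDensity j) atTop (𝓝 (limitDensity j)) :=
  tendsto_transfer_pow_div 5 _ _

open Real in
lemma tendsto_edgeDensity : Tendsto edgeDensity atTop (𝓝 (goldenRatio⁻¹ / √5)) := by
  have h := tendsto_transfer_pow_div 0 1 1
  have e : (1 - ((1 : Fin 2) : ℕ) - ((1 : Fin 2) : ℕ) - (0 : ℕ) : ℤ) = -1 := by simp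
  rw [e, zpow_neg_one] at h
  exact h

lemma letter_eq_ite (j : Finset ℕ) (e : ℕ) : letter j e = if configWord j e = 1 then 1 else 0 := by
  have : ∀ a : Fin 2, ((a : ℕ) : ℝ) = if a = 1 then 1 else 0 := by
    intro a
    fin_cases a <;> simp
  exact this _

lemma tendsto_classEdgeCov_of_le (j : Finset ℕ) {e : ℕ} (he : e ≤ 5) :
    Tendsto (fun L => classEdgeCov j L e) atTop
      (𝓝 (limitDensity j * (letter j e - Real.goldenRatio⁻¹ / √5))) := by
  have h := (tendsto_classDensity j).mul (tendsto_edgeDensity.const_sub (letter j e))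
  refine h.congr fun L => ?_
  have hnum : classEdgeNumber j L e =
      letter j e * (transfer ^ (L - 5)) (configWord j 5) (configWord j 0) := by
    rw [letter_eq_ite, ite_mul, one_mul, zero_mul]
    rcases Nat.lt_or_ge e 5 with h | h
    · rw [classEdgeNumber, if_pos h]
    · rw [show e = 5 by lia, classEdgeNumber_five]
  rw [classEdgeCov, hnum, classDensity]
  ring

open Real in
lemma limitDensity_mul_inv_sq (j : Finset ℕ) :
    limitDensity j * goldenRatio⁻¹ ^ 2 = goldenRatio ^
      (1 - (configWord j 5 : ℕ) - (configWord j 0 : ℕ) - 7 : ℤ) / √5 := by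
  rw [limitDensity, inv_pow, ← zpow_natCast, ← zpow_neg, div_mul_eq_mul_div,
    ← zpow_add₀ goldenRatio_ne_zero]
  congr 2
  push_cast
  ring

lemma tendsto_classEdgeCov_six (j : Finset ℕ) :
    Tendsto (fun L => classEdgeCov j L 6) atTop (𝓝 (limitDensity j *
      ((1 - letter j 5) * Real.goldenRatio⁻¹ ^ 2 - Real.goldenRatio⁻¹ / √5))) := by
  have h1 : Tendsto (fun L => (transfer ^ 1) (configWord j 5) 1 *
      ((transfer ^ (L - 6)) 1 (configWord j 0) / tileNumber L)) atTop
      (𝓝 ((1 - letter j 5) * (limitDensity j * Real.goldenRatio⁻¹ ^ 2))) := by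
    rw [letter_eq_ite, limitDensity_mul_inv_sq]
    by_cases h5 : configWord j 5 = 1
    · simp [h5, transfer_apply]
    · have h0 : configWord j 5 = 0 := by
        revert h5
        generalize configWord j 5 = a
        revert a
        decide
      simp only [h0, pow_one, transfer_apply]
      have := tendsto_transfer_pow_div 6 1 (configWord j 0)
      simp only [zero_ne_one, false_and, if_false, one_mul, sub_zero]
      convert this using 3
      simp
      ring_nf
  have h2 := h1.sub ((tendsto_classDensity j).mul tendsto_edgeDensity)
  rw [mul_sub, show limitDensity j * ((1 - letter j 5) * Real.goldenRatio⁻¹ ^ 2) =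
    (1 - letter j 5) * (limitDensity j * Real.goldenRatio⁻¹ ^ 2) by ring]
  refine h2.congr fun L => ?_
  rw [classEdgeCov, classEdgeNumber, if_neg (by lia), mul_div_assoc]

lemma tendsto_classEdgeCov_last (j : Finset ℕ) :
    Tendsto (fun L => classEdgeCov j L (L - 1)) atTop (𝓝 (limitDensity j *
      ((1 - letter j 0) * Real.goldenRatio⁻¹ ^ 2 - Real.goldenRatio⁻¹ / √5))) := by
  have h1 : Tendsto (fun L => (transfer ^ 1) 1 (configWord j 0) *
      ((transfer ^ (L - 6)) (configWord j 5) 1 / tileNumber L)) atTop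
      (𝓝 ((1 - letter j 0) * (limitDensity j * Real.goldenRatio⁻¹ ^ 2))) := by
    rw [letter_eq_ite, limitDensity_mul_inv_sq]
    by_cases h5 : configWord j 0 = 1
    · simp [h5, transfer_apply]
    · have h0 : configWord j 0 = 0 := by
        revert h5
        generalize configWord j 0 = a
        revert a
        decide
      simp only [h0, pow_one, transfer_apply]
      have := tendsto_transfer_pow_div 6 (configWord j 5) 1
      simp only [zero_ne_one, and_false, if_false, one_mul, sub_zero]
      convert this using 3
      simp
      ring_nf
  have h2 := h1.sub ((tendsto_classDensity j).mul tendsto_edgeDensity)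
  rw [mul_sub, show limitDensity j * ((1 - letter j 0) * Real.goldenRatio⁻¹ ^ 2) =
    (1 - letter j 0) * (limitDensity j * Real.goldenRatio⁻¹ ^ 2) by ring]
  refine h2.congr' ?_
  filter_upwards [eventually_ge_atTop 7] with L hL
  rw [classEdgeCov, classEdgeNumber, if_neg (by lia), show L - 1 - 5 = L - 6 by lia,
    show L - (L - 1) = 1 by lia]
  ring

/-- The contribution of the six window edges to the regression sum. -/
def windowSum (j : Finset ℕ) (L : ℕ) : ℝ :=
  ∑ e ∈ Finset.range 6, classEdgeCov j L e * (classEdgeCov j L (e + 1) +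
    classEdgeCov j L (if e = 0 then L - 1 else e - 1) + 3 * classEdgeCov j L e)

/-- The sum of squares explained by the regression, split into the contributions of the window, of
the other edges and of the rank-one correction. -/
lemma sum_regressionCoeff_mul {L : ℕ} [NeZero L] (hL : 7 ≤ L) (j : Finset ℕ) :
    ∑ e : Fin L, regressionCoeff (fun e : Fin L => classEdgeCov j L e) e * classEdgeCov j L e =
      tileNumber L / (transfer ^ L) 0 1 * (windowSum j L +
        classTail j L * ∑ e ∈ Finset.Ico 6 L, classEdgeCov j L e +
        5 * (∑ e ∈ Finset.range L, classEdgeCov j L e) ^ 2 /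
          ((transfer ^ L) 0 1 * tileNumber L - L)) := by
  have h1 : ∑ e : Fin L, neighbourSum (fun e : Fin L => classEdgeCov j L e) e *
      classEdgeCov j L e = windowSum j L + classTail j L *
        ∑ e ∈ Finset.Ico 6 L, classEdgeCov j L e := by
    simp_rw [neighbourSum_classEdgeCov hL j]
    rw [Fin.sum_univ_eq_sum_range (fun e => (classEdgeCov j L (e + 1) +
      classEdgeCov j L (if e = 0 then L - 1 else e - 1) + 3 * classEdgeCov j L e) *
      classEdgeCov j L e) L, ← Finset.sum_range_add_sum_Ico _ (show 6 ≤ L by lia), windowSum,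
      Finset.mul_sum]
    congr 1
    · exact Finset.sum_congr rfl fun e _ => mul_comm _ _
    · refine Finset.sum_congr rfl fun e he => ?_
      rw [Finset.mem_Ico] at he
      rw [if_neg (by lia), classEdgeCov_neighbours j he.1 he.2]
  have h2 : ∑ e : Fin L, classEdgeCov j L e = ∑ e ∈ Finset.range L, classEdgeCov j L e :=
    Fin.sum_univ_eq_sum_range (fun e => classEdgeCov j L e) L
  rw [← h1, ← h2]
  simp only [regressionCoeff]
  set S := ∑ e : Fin L, classEdgeCov j L e
  have h3 (κ : ℝ) : ∑ e : Fin L, tileNumber L / (transfer ^ L) 0 1 *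
      (neighbourSum (fun e : Fin L => classEdgeCov j L e) e + κ) * classEdgeCov j L e =
      tileNumber L / (transfer ^ L) 0 1 *
        (∑ e : Fin L, neighbourSum (fun e : Fin L => classEdgeCov j L e) e *
          classEdgeCov j L e + κ * S) := by
    rw [Finset.mul_sum, ← Finset.sum_add_distrib, Finset.mul_sum]
    exact Finset.sum_congr rfl fun e _ => by ring
  rw [h3]
  ring

lemma abs_sum_classEdgeCov_le {L : ℕ} (hL : 7 ≤ L) {j : Finset ℕ} (hj : IsLocalConfig j)
    {s : Finset ℕ} (hs : s ⊆ Finset.range L) : |∑ e ∈ s, classEdgeCov j L e| ≤ L := by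
  have : NeZero L := ⟨by lia⟩
  refine (Finset.abs_sum_le_sum_abs _ _).trans ?_
  calc _ ≤ ∑ e ∈ s, (1 : ℝ) := Finset.sum_le_sum fun e he =>
        abs_classEdgeCov_le_one hL hj ⟨e, Finset.mem_range.1 (hs he)⟩
    _ ≤ _ := by
        have := Finset.card_le_card hs
        simp at this ⊢
        exact_mod_cast this

/-- Here `goldenRatio⁻¹ / √5` is the limiting edge density and `goldenRatio⁻¹ ^ 2` is the limiting
probability of an edge next to the window, given that the end edge of the window is absent. -/
lemma tendsto_windowSum {j : Finset ℕ} (hj : IsLocalConfig j) :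
    Tendsto (windowSum j) atTop (𝓝 (limitDensity j ^ 2 *
      ((letter j 0 + letter j 1 + letter j 2 + letter j 3 + letter j 4 + letter j 5) *
          (3 - 10 * (Real.goldenRatio⁻¹ / √5)) -
        Real.goldenRatio⁻¹ / √5 * (Real.goldenRatio⁻¹ ^ 2 * (2 - (letter j 0 + letter j 5)) -
          (letter j 0 + letter j 5)) + 30 * (Real.goldenRatio⁻¹ / √5) ^ 2))) := by
  have h0 := tendsto_classEdgeCov_of_le j (e := 0) (by lia)
  have h1 := tendsto_classEdgeCov_of_le j (e := 1) (by lia)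
  have h2 := tendsto_classEdgeCov_of_le j (e := 2) (by lia)
  have h3 := tendsto_classEdgeCov_of_le j (e := 3) (by lia)
  have h4 := tendsto_classEdgeCov_of_le j (e := 4) (by lia)
  have h5 := tendsto_classEdgeCov_of_le j (e := 5) (by lia)
  have h6 := tendsto_classEdgeCov_six j
  have hl := tendsto_classEdgeCov_last j
  have key := (((((h0.mul ((h1.add hl).add (h0.const_mul 3))).add
    (h1.mul ((h2.add h0).add (h1.const_mul 3)))).add
    (h2.mul ((h3.add h1).add (h2.const_mul 3)))).add
    (h3.mul ((h4.add h2).add (h3.const_mul 3)))).add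
    (h4.mul ((h5.add h3).add (h4.const_mul 3)))).add
    (h5.mul ((h6.add h4).add (h5.const_mul 3)))
  -- letters are idempotent, and products of adjacent letters vanish
  have hsq : ∀ e, letter j e ^ 2 = letter j e := by
    intro e
    rw [letter_eq_ite]
    split_ifs <;> simp
  have hadj : ∀ e < 5, letter j e * letter j (e + 1) = 0 := by
    intro e he
    have := configWord_adjacent hj e he
    rw [letter_eq_ite, letter_eq_ite]
    split_ifs <;> simp_all
  refine (key.congr fun L => ?_).trans (le_of_eq (congrArg _ ?_))
  · simp [windowSum, Finset.sum_range_succ]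
  · have s0 := hsq 0
    have s1 := hsq 1
    have s2 := hsq 2
    have s3 := hsq 3
    have s4 := hsq 4
    have s5 := hsq 5
    have a0 : letter j 0 * letter j 1 = 0 := hadj 0 (by lia)
    have a1 : letter j 1 * letter j 2 = 0 := hadj 1 (by lia)
    have a2 : letter j 2 * letter j 3 = 0 := hadj 2 (by lia)
    have a3 : letter j 3 * letter j 4 = 0 := hadj 3 (by lia)
    have a4 : letter j 4 * letter j 5 = 0 := hadj 4 (by lia)
    generalize Real.goldenRatio⁻¹ / √5 = p
    generalize Real.goldenRatio⁻¹ ^ 2 = q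
    generalize letter j 0 = i0 at *
    generalize letter j 1 = i1 at *
    generalize letter j 2 = i2 at *
    generalize letter j 3 = i3 at *
    generalize letter j 4 = i4 at *
    generalize letter j 5 = i5 at *
    generalize limitDensity j = m
    linear_combination m ^ 2 * (2 * (a0 + a1 + a2 + a3 + a4) +
      3 * (s0 + s1 + s2 + s3 + s4 + s5) - q * s0 - q * s5)

end LongCycles

section Limits

/-! ### The limits of the mean and of the variance -/

lemma letter_eq_indicator (j : Finset ℕ) (e : ℕ) : letter j e = if e ∈ j then 1 else 0 := by
  rw [letter_eq_ite]
  by_cases h : e ∈ j <;> simp [configWord, h]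

lemma edgeNumber_eq {j : Finset ℕ} (hj : j ⊆ Finset.range 6) : (edgeNumber j : ℝ) =
    letter j 0 + letter j 1 + letter j 2 + letter j 3 + letter j 4 + letter j 5 := by
  have h : (edgeNumber j : ℝ) = ∑ e ∈ Finset.range 6, letter j e := by
    simp only [letter_eq_indicator]
    rw [Finset.sum_boole, Finset.filter_mem_eq_inter, Finset.inter_eq_right.2 hj, edgeNumber]
  rw [h]
  simp [Finset.sum_range_succ]

lemma endNumber_eq (j : Finset ℕ) :
    endNumber j = (configWord j 0 : ℕ) + (configWord j 5 : ℕ) := by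
  rw [endNumber, Finset.inter_comm, ← Finset.filter_mem_eq_inter]
  by_cases h0 : 0 ∈ j <;> by_cases h5 : 5 ∈ j <;>
    simp [configWord, h0, h5, Finset.filter_insert, Finset.filter_singleton]

lemma limitDensity_eq (j : Finset ℕ) :
    limitDensity j = Real.goldenRatio ^ (-(endNumber j : ℤ) - 4) / √5 := by
  rw [limitDensity, endNumber_eq]
  congr 2
  push_cast
  ring

/-- Only the window contributes in the limit: the tail and the rank-one correction are exponentially
small. -/
lemma tendsto_sum_regressionCoeff_mul {j : Finset ℕ} (hj : IsLocalConfig j) {W : ℝ}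
    (hW : Tendsto (windowSum j) atTop (𝓝 W)) :
    Tendsto (fun L => tileNumber L / (transfer ^ L) 0 1 * (windowSum j L +
        classTail j L * ∑ e ∈ Finset.Ico 6 L, classEdgeCov j L e +
        5 * (∑ e ∈ Finset.range L, classEdgeCov j L e) ^ 2 /
          ((transfer ^ L) 0 1 * tileNumber L - L))) atTop (𝓝 (√5 * W)) := by
  have h5 : (√5 : ℝ) ≠ 0 := by positivity
  have hF : Tendsto (fun L => (transfer ^ L) 0 1 / tileNumber L) atTop (𝓝 (1 / √5)) := by
    have h := tendsto_transfer_pow_div 0 0 1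
    simpa using h
  have hF' : Tendsto (fun L => tileNumber L / (transfer ^ L) 0 1) atTop (𝓝 √5) := by
    have h := hF.inv₀ (by positivity)
    simpa using h
  have htail : Tendsto (fun L => classTail j L * ∑ e ∈ Finset.Ico 6 L, classEdgeCov j L e)
      atTop (𝓝 0) := by
    refine squeeze_zero_norm' ?_ (abs_zero (α := ℝ) ▸ (tendsto_mul_classTail j).abs)
    filter_upwards [eventually_ge_atTop 7] with L hL
    rw [norm_mul, abs_mul, mul_comm, Nat.abs_cast, Real.norm_eq_abs, Real.norm_eq_abs]
    refine mul_le_mul_of_nonneg_right (abs_sum_classEdgeCov_le hL hj fun e he => ?_)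
      (abs_nonneg _)
    simp at he ⊢
    exact he.2
  have hsum : Tendsto (fun L => (∑ e ∈ Finset.range L, classEdgeCov j L e) / tileNumber L)
      atTop (𝓝 0) := by
    refine squeeze_zero_norm' ?_ tendsto_div_tileNumber
    filter_upwards [eventually_ge_atTop 7] with L hL
    have : NeZero L := ⟨by lia⟩
    have hpos := tileNumber_pos (L := L) (by lia)
    rw [norm_div, Real.norm_eq_abs, Real.norm_of_nonneg hpos.le]
    gcongr
    exact abs_sum_classEdgeCov_le hL hj subset_rfl
  have hκ : Tendsto (fun L : ℕ => 5 * (∑ e ∈ Finset.range L, classEdgeCov j L e) ^ 2 /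
      ((transfer ^ L) 0 1 * tileNumber L - L)) atTop (𝓝 0) := by
    have h := ((hsum.pow 2).const_mul 5).div
      (hF.sub (tendsto_div_tileNumber.mul tendsto_tileNumber_inv))
      (by simp)
    simp only [ne_eq, OfNat.ofNat_ne_zero, not_false_eq_true, zero_pow, mul_zero, zero_div] at h
    refine h.congr' ?_
    filter_upwards [eventually_ge_atTop 7] with L hL
    have : NeZero L := ⟨by lia⟩
    have hpos := (tileNumber_pos (L := L) (by lia)).ne'
    simp only [Pi.div_apply]
    have e : (transfer ^ L) 0 1 / tileNumber L - (L : ℝ) / tileNumber L * (1 / tileNumber L) =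
        ((transfer ^ L) 0 1 * tileNumber L - L) / tileNumber L ^ 2 := by
      field_simp
    rw [e, div_pow, ← mul_div_assoc, div_div_div_cancel_right₀ (by positivity)]
  simpa using hF'.mul ((hW.add htail).add hκ)

/-- The variance `σ_j²(L)`, with a junk value at `L = 0`. -/
def limitVariance (j : Finset ℕ) (L : ℕ) : ℝ :=
  if h : L = 0 then 0 else
    haveI : NeZero L := ⟨h⟩
    classVariance j L

lemma limitVariance_eq (j : Finset ℕ) (L : ℕ) [NeZero L] :
    limitVariance j L = classVariance j L := by
  rw [limitVariance, dif_neg (NeZero.ne L)]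

/-- The final evaluation of the variance. After division by `m` both sides lie in `ℚ(s)`, with `s`
a square root of `5`, `g` the golden ratio and `m = g ^ (-k-4) / s`; it is applied with `ε = k`. -/
lemma limit_identity (m s f ε g : ℝ) (hs : s ^ 2 = 5) (k : ℕ)
    (hg : g = (1 + s) / 2) (hm : m * (s * g ^ (k + 4)) = 1) (hgk : g ^ (k + 4) ≠ 0) :
    m - m ^ 2 - s * (m ^ 2 * (f * (3 - 10 * (g⁻¹ / s)) - g⁻¹ / s * (g⁻¹ ^ 2 * (2 - ε) - ε) +
      30 * (g⁻¹ / s) ^ 2)) =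
    m * (1 - (ε + g⁻¹ * f + (11 + s) / 2) / g ^ (k + 6)) := by
  have hs0 : s ≠ 0 := by
    rintro rfl
    norm_num at hs
  have hginv : g⁻¹ = (s - 1) / 2 := by
    rw [inv_eq_iff_eq_inv, eq_comm]
    refine inv_eq_of_mul_eq_one_left ?_
    rw [hg]
    linear_combination hs / 4
  have hp : g⁻¹ / s = (5 - s) / 10 := by
    rw [hginv, div_eq_iff hs0]
    linear_combination hs / 10
  have hg2 : g ^ 2 * ((3 - s) / 2) = 1 := by
    rw [hg]
    linear_combination (-s - 1) / 8 * hs + (2 : ℝ) / 8 * hs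
  have hq : g ^ (k + 6) = g ^ (k + 4) * g ^ 2 := by rw [← pow_add]
  have hg20 : g ^ 2 ≠ 0 := left_ne_zero_of_mul_eq_one hg2
  have hdiv : ∀ x : ℝ, x / g ^ (k + 6) = x * (m * s * ((3 - s) / 2)) := by
    intro x
    rw [div_eq_iff (by rw [hq]; exact mul_ne_zero hgk hg20), hq]
    linear_combination (-x) * hm - x * m * s * g ^ (k + 4) * hg2
  rw [hdiv, hp, hginv]
  have key : 1 + s * (f * (3 - 10 * ((5 - s) / 10)) -
      (5 - s) / 10 * (((s - 1) / 2) ^ 2 * (2 - ε) - ε) + 30 * ((5 - s) / 10) ^ 2) =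
      (ε + (s - 1) / 2 * f + (11 + s) / 2) * (s * ((3 - s) / 2)) := by
    obtain ⟨h3, h4⟩ : s ^ 3 = 5 * s ∧ s ^ 4 = 25 :=
      ⟨by linear_combination s * hs, by linear_combination (s ^ 2 + 5) * hs⟩
    ring_nf
    rw [hs, h3, h4]
    ring
  linear_combination -m ^ 2 * key

open Real in
lemma tendsto_limitVariance {j : Finset ℕ} (hj : IsLocalConfig j) :
    Tendsto (limitVariance j) atTop (𝓝 (goldenRatio ^ (-(endNumber j : ℤ) - 4) / √5 *
      (1 - ((endNumber j : ℝ) + goldenRatio⁻¹ * (edgeNumber j : ℝ) + (11 + √5) / 2) /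
        goldenRatio ^ (endNumber j + 6)))) := by
  have h1 := tendsto_sum_regressionCoeff_mul hj (tendsto_windowSum hj)
  have h2 := ((tendsto_classDensity j).sub ((tendsto_classDensity j).pow 2)).sub h1
  have h3 : letter j 0 + letter j 5 = endNumber j := by
    rw [endNumber_eq, letter, letter]
    push_cast
    rfl
  rw [← edgeNumber_eq hj.1, h3] at h2
  have h4 : limitDensity j * (√5 * goldenRatio ^ (endNumber j + 4)) = 1 := by
    rw [limitDensity_eq, ← neg_add', zpow_neg]
    have : (√5 : ℝ) ≠ 0 := by positivity
    have hg : goldenRatio ^ (endNumber j + 4) ≠ 0 := pow_ne_zero _ goldenRatio_ne_zero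
    rw [show ((endNumber j : ℤ) + 4) = ((endNumber j + 4 : ℕ) : ℤ) by push_cast; rfl,
      zpow_natCast]
    generalize goldenRatio ^ (endNumber j + 4) = x at *
    field_simp
  have h5 := limit_identity (limitDensity j) √5 (edgeNumber j) (endNumber j) goldenRatio
    (Real.sq_sqrt (by norm_num)) (endNumber j) rfl h4 (pow_ne_zero _ goldenRatio_ne_zero)
  rw [h5, limitDensity_eq] at h2
  refine h2.congr' ?_
  filter_upwards [eventually_ge_atTop 7] with L hL
  have : NeZero L := ⟨by lia⟩
  rw [limitVariance_eq, classVariance, sum_regressionCoeff_mul hL]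

lemma tendsto_classDensity_endNumber (j : Finset ℕ) :
    Tendsto (classDensity j) atTop
      (𝓝 (Real.goldenRatio ^ (-(endNumber j : ℤ) - 4) / √5)) :=
  limitDensity_eq j ▸ tendsto_classDensity j

end Limits

section ClassRegression

/-! ### Regression of a local configuration on the edges -/

variable {L : ℕ} [NeZero L]

/-- The residual of the class indicator is uncorrelated with the edges. -/
lemma configInd_residual (hL : 7 ≤ L) (hodd : Odd L) {j : Finset ℕ} (hj : IsLocalConfig j) :
    (∀ i, ∑ t, (configInd j t - ∑ e, regressionCoeff (fun e : Fin L => classEdgeCov j L e) e *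
      edgeVec t e) * (edgeVec t i - edgeDensity L) = 0) ∧
    (Fintype.card (Tile (SimpleGraph.cycleGraph L)) : ℝ)⁻¹ * ∑ t, (configInd j t -
        ∑ e, regressionCoeff (fun e : Fin L => classEdgeCov j L e) e * edgeVec t e) ^ 2 -
      ((Fintype.card (Tile (SimpleGraph.cycleGraph L)) : ℝ)⁻¹ * ∑ t, (configInd j t -
        ∑ e, regressionCoeff (fun e : Fin L => classEdgeCov j L e) e * edgeVec t e)) ^ 2 =
      classVariance j L := by
  have hpos := transfer_mul_tileNumber_sub_pos hL
  have hF := le_transfer_pow_zero_one hL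
  have hLpos : (0 : ℝ) < L := by positivity
  have hcard := card_tile (L := L) (by lia)
  have hne : Nonempty (Tile (SimpleGraph.cycleGraph L)) := ⟨⟨∅, by simp, by simp⟩⟩
  have h := residual_variance (configInd (L := L) j) (fun t e => (edgeVec t e : ℝ))
    (regressionCoeff fun e : Fin L => classEdgeCov j L e) (fun e => classEdgeCov j L e)
    (fun _ => edgeDensity L) (fun e i => edgeCov L (i - e : Fin L)) (classDensity j L)
    (by rw [hcard, sum_configInd hL hj, classDensity, inv_mul_eq_div, tileNumber])
    (fun i => by rw [hcard, sum_edge (by lia), edgeDensity, inv_mul_eq_div, tileNumber])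
    (fun i => by
      rw [hcard, sum_configInd_mul_edge hL hj, classEdgeCov, inv_mul_eq_div, tileNumber])
    (fun e i => by
      rw [hcard, sum_edge_mul_edge (by lia), edgeCov, inv_mul_eq_div, tileNumber]
      ring)
    (sum_regressionCoeff_mul_edgeCov (by lia) hodd (by linarith) hpos.ne' _)
  refine ⟨h.1, h.2.trans ?_⟩
  have hsq : ∀ t : Tile (SimpleGraph.cycleGraph L), configInd j t ^ 2 = configInd j t := by
    intro t
    rw [configInd]
    split_ifs <;> simp
  rw [Finset.sum_congr rfl fun t _ => hsq t, hcard, sum_configInd hL hj, inv_mul_eq_div,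
    classVariance, classDensity, tileNumber]

end ClassRegression

section EdgeMultiplicities

/-! ### Edge multiplicities on an odd cycle -/

variable {L : ℕ} [NeZero L]

lemma spanning_edgeVec (hL : 3 ≤ L) :
    Spanning (edgeVec : Tile (SimpleGraph.cycleGraph L) → Fin L → ℤ) where
  exists_zero := by
    obtain ⟨t, ht⟩ := exists_tile_word_eq hL (fun _ => 0) (by simp)
    exact ⟨t, fun i => by simp [edgeVec, ht]⟩
  exists_single i := by
    obtain ⟨t, ht⟩ := exists_tile_word_eq hL (fun e => if e = i then 1 else 0) (by
      intro e
      have := one_ne_zero_fin hL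
      by_cases h : e = i
      · subst h
        simp [this]
      · simp [h])
    exact ⟨t, fun e => by by_cases h : e = i <;> simp [edgeVec, ht, h]⟩

lemma covers_iff (hL : 3 ≤ L) (t : Tile (SimpleGraph.cycleGraph L)) (v : Fin L) :
    Covers t v ↔ word t (v - 1) = 1 ∨ word t v = 1 := by
  simp only [word_eq_one_iff]
  constructor
  · rintro ⟨s, hs, hv⟩
    obtain ⟨e, rfl⟩ := (mem_edgeSet_cycleGraph hL s).1 (t.2.1 s hs)
    rw [cycleEdge, Sym2.mem_iff] at hv
    rcases hv with rfl | rfl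
    · exact Or.inr hs
    · exact Or.inl (by simpa using hs)
  · rintro (h | h)
    · exact ⟨_, h, by simp [cycleEdge]⟩
    · exact ⟨_, h, by simp [cycleEdge]⟩

open Classical in
/-- A vertex is covered through at most one of its two edges. -/
lemma ite_covers (hL : 3 ≤ L) (t : Tile (SimpleGraph.cycleGraph L)) (v : Fin L) :
    (if Covers t v then (1 : ℤ) else 0) = edgeVec t (v - 1) + edgeVec t v := by
  have h := word_adjacent hL t (v - 1)
  rw [sub_add_cancel] at h
  simp only [covers_iff hL, edgeVec]
  by_cases h1 : word t (v - 1) = 1 <;> by_cases h2 : word t v = 1 <;> simp_all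

open Classical in
lemma card_covers (hL : 3 ≤ L) {N : ℕ} (m : Fin N → Tile (SimpleGraph.cycleGraph L)) (v : Fin L) :
    ((Finset.univ.filter fun c => Covers (m c) v).card : ℤ) =
      ∑ c, edgeVec (m c) (v - 1) + ∑ c, edgeVec (m c) v := by
  rw [← Finset.sum_add_distrib, ← Finset.sum_boole]
  exact Finset.sum_congr rfl fun c _ => ite_covers hL _ _

/-- On an odd cycle a function on the edges is determined by its sums at the vertices. -/
lemma two_mul_eq_alternating_sum {R : Type*} [CommRing R] (hodd : Odd L) {x n : Fin L → R}
    (h : ∀ v, n v = x (v - 1) + x v) (v : Fin L) :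
    2 * x v = ∑ i ∈ Finset.range L, (-1) ^ i * n (v - Fin.ofNat L i) := by
  have hsucc : ∀ k, Fin.ofNat L (k + 1) = Fin.ofNat L k + 1 := by
    intro k
    ext
    simp [Fin.val_add]
  have hself : Fin.ofNat L L = 0 := by
    ext
    simp
  -- going once around the cycle returns to `v` with the sign `(-1) ^ L = -1`
  have key : ∀ k : ℕ, x v = ∑ i ∈ Finset.range k, (-1) ^ i * n (v - Fin.ofNat L i) +
      (-1) ^ k * x (v - Fin.ofNat L k) := by
    intro k
    induction k with
    | zero => simp
    | succ k ih =>
      rw [Finset.sum_range_succ, h (v - Fin.ofNat L k), sub_sub, ← hsucc]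
      rw [ih]
      ring
  have h1 := key L
  rw [hodd.neg_one_pow, hself, sub_zero] at h1
  linear_combination h1

open Classical in
/-- The multiwebs on an odd cycle form a single fiber of the edge indicators. -/
lemma multiweb_iff_mem_fiber (hL : 3 ≤ L) (hodd : Odd L) {n : Fin L → ℕ} {N : ℕ}
    (m₀ : Multiweb (SimpleGraph.cycleGraph L) n N) (m : Fin N → Tile (SimpleGraph.cycleGraph L)) :
    m ∈ fiber edgeVec N (fun e => ∑ c, edgeVec (m₀.1 c) e) ↔
      ∀ v, (Finset.univ.filter fun c => Covers (m c) v).card = n v := by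
  have h0 : ∀ v, (n v : ℤ) = ∑ c, edgeVec (m₀.1 c) (v - 1) + ∑ c, edgeVec (m₀.1 c) v := by
    intro v
    rw [← card_covers hL, ← m₀.2 v]
  simp only [fiber, Finset.mem_filter, Finset.mem_univ, true_and]
  constructor
  · intro h v
    have h1 := card_covers hL m v
    rw [h, h, ← h0] at h1
    exact_mod_cast h1
  · intro h e
    have h1 : ∀ v, (n v : ℤ) = ∑ c, edgeVec (m c) (v - 1) + ∑ c, edgeVec (m c) v := by
      intro v
      rw [← card_covers hL, ← h v]
    have h2 := two_mul_eq_alternating_sum hodd (n := fun v => (n v : ℤ))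
      (x := fun e => ∑ c, edgeVec (m₀.1 c) e) h0 e
    rw [← two_mul_eq_alternating_sum hodd (n := fun v => (n v : ℤ))
      (x := fun e => ∑ c, edgeVec (m c) e) h1 e] at h2
    linarith

open Real in
/-- The critical vertex density is the vertex density of a uniform tile: each vertex has two
edges. -/
lemma criticalDensity_eq (hL : 3 ≤ L) : criticalDensity L = 2 * edgeDensity L := by
  have h5 : (√5 : ℝ) ≠ 0 := by positivity
  have e0 := transfer_pow_apply L 1 1
  simp only [Fin.val_one, Nat.cast_one, sub_self, zero_sub, zpow_neg, zpow_one, inv_goldenRatio,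
    inv_goldenConj] at e0
  have hpos := (tileNumber_pos hL).ne'
  have hN := tileNumber_eq L
  have hs := goldenRatio_sub_goldenConj
  have hadd := goldenRatio_add_goldenConj
  rw [criticalDensity, edgeDensity, e0, ← hN]
  generalize √5 = d at *
  generalize goldenRatio ^ L = P at *
  generalize goldenConj ^ L = Q at *
  generalize goldenRatio = r at *
  generalize goldenConj = s at *
  generalize tileNumber L = l at *
  field_simp
  rw [hN]
  linear_combination (-P - Q) * hs + (P - Q) * hadd

/-- In a critical regime the edge multiplicities are asymptotic to those of uniform tiles. -/
lemma tendsto_edge_multiplicity (hL : 3 ≤ L) (hodd : Odd L) {n : ℕ → Fin L → ℕ} {N : ℕ → ℕ}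
    (hn : ∀ v, Tendsto (fun k => (n k v : ℝ) / N k) atTop (𝓝 (criticalDensity L)))
    (m₀ : ∀ k, Multiweb (SimpleGraph.cycleGraph L) (n k) (N k)) (e : Fin L) :
    Tendsto (fun k => ((∑ c, edgeVec ((m₀ k).1 c) e : ℤ) : ℝ) / N k) atTop
      (𝓝 (edgeDensity L)) := by
  have h1 : Tendsto (fun k => ∑ i ∈ Finset.range L,
      (-1) ^ i * ((n k (e - Fin.ofNat L i) : ℝ) / N k)) atTop
      (𝓝 (∑ i ∈ Finset.range L, (-1) ^ i * criticalDensity L)) :=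
    tendsto_finsetSum _ fun i _ => (hn _).const_mul _
  rw [← two_mul_eq_alternating_sum (x := fun _ => edgeDensity L)
    (n := fun _ => criticalDensity L) hodd
    (fun _ => by rw [criticalDensity_eq hL, two_mul]) e] at h1
  have h2 := h1.const_mul (1 / 2)
  rw [← mul_assoc, one_div, inv_mul_cancel₀ two_ne_zero, one_mul] at h2
  refine h2.congr fun k => ?_
  have h3 := two_mul_eq_alternating_sum (R := ℝ) (L := L) hodd
    (x := fun e => ((∑ c, edgeVec ((m₀ k).1 c) e : ℤ) : ℝ) / N k)
    (n := fun v => (n k v : ℝ) / N k) (fun v => by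
      have h4 := card_covers hL (m₀ k).1 v
      rw [(m₀ k).2 v] at h4
      rw [← add_div]
      congr 1
      exact_mod_cast h4) e
  rw [← h3]
  ring

end EdgeMultiplicities

section UniformLaw

/-! ### The uniform law on multiwebs -/

variable {L : ℕ}

/-- For the weight function `1` the law of the random multiweb is uniform. -/
lemma integral_cycleMeasure {n : Fin L → ℕ} {N : ℕ}
    (F : Multiweb (SimpleGraph.cycleGraph L) n N → ℝ) :
    ∫ m, F m ∂cycleMeasure L n N =
      (∑ m, F m) / Fintype.card (Multiweb (SimpleGraph.cycleGraph L) n N) := by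
  have hd : DiscreteMeasurableSpace (Multiweb (SimpleGraph.cycleGraph L) n N) :=
    ⟨fun _ => trivial⟩
  rw [cycleMeasure, multiwebMeasure, integral_finsetSum_measure]
  · simp only [integral_smul_measure, integral_dirac, partitionFunction, weight, one_pow,
      Finset.prod_const_one, Finset.sum_const, Finset.card_univ, nsmul_eq_mul, mul_one]
    rw [Finset.sum_div]
    refine Finset.sum_congr rfl fun m _ => ?_
    rw [ENNReal.toReal_ofReal (by positivity), smul_eq_mul, one_div, inv_mul_eq_div]
  · intro m _
    exact (integrable_dirac (by finiteness)).smul_measure ENNReal.ofReal_ne_top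

lemma isProbabilityMeasure_cycleMeasure {n : Fin L → ℕ} {N : ℕ}
    (h : Nonempty (Multiweb (SimpleGraph.cycleGraph L) n N)) :
    IsProbabilityMeasure (cycleMeasure L n N) := by
  constructor
  simp only [cycleMeasure, multiwebMeasure, partitionFunction, weight, one_pow,
    Finset.prod_const_one, Finset.sum_const, Finset.card_univ, nsmul_eq_mul, mul_one,
    Measure.finsetSum_apply, Measure.smul_apply, measure_univ, smul_eq_mul]
  rw [one_div, ENNReal.ofReal_inv_of_pos (by positivity), ENNReal.ofReal_natCast,
    ENNReal.mul_inv_cancel (by simp) (by simp)]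

variable [NeZero L]

lemma localCount_eq {n : Fin L → ℕ} {N : ℕ} (j : Finset ℕ)
    (m : Multiweb (SimpleGraph.cycleGraph L) n N) :
    (localCount j m : ℝ) = ∑ c, configInd j (m.1 c) := by
  classical
  simp only [localCount, tileCount, configInd]
  push_cast
  simp_rw [← Finset.sum_boole]
  rw [Finset.sum_comm]
  refine Finset.sum_congr rfl fun c _ => ?_
  by_cases h : localConfig (m.1 c) = j
  · rw [if_pos h]
    exact (Finset.sum_eq_single_of_mem (m.1 c) (Finset.mem_filter.2 ⟨Finset.mem_univ _, h⟩)
      fun t _ ht => if_neg ht.symm).trans (if_pos rfl)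
  · rw [if_neg h]
    refine Finset.sum_eq_zero fun t ht => if_neg ?_
    rintro rfl
    exact h (Finset.mem_filter.1 ht).2

open Classical in
lemma integral_eq_fiberMean (hL : 3 ≤ L) (hodd : Odd L) {n : Fin L → ℕ} {N : ℕ}
    (m₀ : Multiweb (SimpleGraph.cycleGraph L) n N)
    (F : (Fin N → Tile (SimpleGraph.cycleGraph L)) → ℝ) :
    ∫ m, F m.1 ∂cycleMeasure L n N =
      fiberMean edgeVec N (fun e => ∑ c, edgeVec (m₀.1 c) e) F := by
  have h := multiweb_iff_mem_fiber hL hodd m₀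
  rw [integral_cycleMeasure, fiberMean, Finset.sum_subtype _ h F, Fintype.card_of_subtype _ h]

lemma variance_eq_fiberVariance (hL : 3 ≤ L) (hodd : Odd L) {n : Fin L → ℕ} {N : ℕ}
    (m₀ : Multiweb (SimpleGraph.cycleGraph L) n N)
    (F : (Fin N → Tile (SimpleGraph.cycleGraph L)) → ℝ) :
    variance (fun m => F m.1) (cycleMeasure L n N) =
      fiberVariance edgeVec N (fun e => ∑ c, edgeVec (m₀.1 c) e) F := by
  have hd : DiscreteMeasurableSpace (Multiweb (SimpleGraph.cycleGraph L) n N) :=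
    ⟨fun _ => trivial⟩
  have := isProbabilityMeasure_cycleMeasure ⟨m₀⟩
  rw [variance_eq_sub MemLp.of_discrete, fiberVariance, ← integral_eq_fiberMean hL hodd,
    ← integral_eq_fiberMean hL hodd]
  rfl

/-- The mean and variance per color in a critical regime, at a fixed odd length. -/
theorem tendsto_mean_and_variance (hL : 7 ≤ L) (hodd : Odd L) {j : Finset ℕ}
    (hj : IsLocalConfig j) {n : ℕ → Fin L → ℕ} {N : ℕ → ℕ} (h : CriticalRegime L n N) :
    Tendsto (fun k => (∫ m, (localCount j m : ℝ) ∂cycleMeasure L (n k) (N k)) / (N k : ℝ))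
      atTop (𝓝 (classDensity j L)) ∧
    Tendsto (fun k => variance (fun m => (localCount j m : ℝ)) (cycleMeasure L (n k) (N k)) /
      (N k : ℝ)) atTop (𝓝 (limitVariance j L)) := by
  obtain ⟨hN, -, hfeas, hn⟩ := h
  have hL3 : 3 ≤ L := by lia
  have m₀ : ∀ k, Multiweb (SimpleGraph.cycleGraph L) (n k) (N k) :=
    fun k => Classical.choice (hfeas k)
  have hne : Nonempty (Tile (SimpleGraph.cycleGraph L)) := ⟨⟨∅, by simp, by simp⟩⟩
  have hcard := card_tile hL3
  obtain ⟨h1, h2⟩ := configInd_residual hL hodd hj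
  have key := tendsto_fiberMean_and_fiberVariance (X := edgeVec (L := L)) (N := N)
    (x := fun k e => ∑ c, edgeVec ((m₀ k).1 c) e) (η := fun _ => edgeDensity L)
    (spanning_edgeVec hL3) hN
    (fun i => by rw [hcard, sum_edge hL3, edgeDensity, inv_mul_eq_div, tileNumber])
    (tendsto_edge_multiplicity hL3 hodd hn m₀)
    (fun k => ⟨(m₀ k).1, (multiweb_iff_mem_fiber hL3 hodd (m₀ k) _).2 (m₀ k).2⟩)
    (configInd j) _ h1
  rw [h2, hcard, sum_configInd hL hj, inv_mul_eq_div] at key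
  simp only [localCount_eq, limitVariance_eq]
  refine ⟨key.1.congr fun k => ?_, key.2.congr fun k => ?_⟩
  · rw [← integral_eq_fiberMean hL3 hodd (m₀ k)]
  · rw [← variance_eq_fiberVariance hL3 hodd (m₀ k)]

end UniformLaw

end ColoredMultiweb

end

theorem mainTheorem6 (j : Finset ℕ) (hj : ColoredMultiweb.IsLocalConfig j) :
    ∃ μ σ2 : ℕ → ℝ,
      (∀ (L : ℕ) [NeZero L], Odd L → 7 ≤ L →
        ∀ (n : ℕ → Fin L → ℕ) (N : ℕ → ℕ), ColoredMultiweb.CriticalRegime L n N →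
          Tendsto
            (fun k => (∫ m, (ColoredMultiweb.localCount j m : ℝ)
              ∂(ColoredMultiweb.cycleMeasure L (n k) (N k))) / (N k : ℝ))
            atTop (𝓝 (μ L)) ∧
          Tendsto
            (fun k => variance (fun m => (ColoredMultiweb.localCount j m : ℝ))
              (ColoredMultiweb.cycleMeasure L (n k) (N k)) / (N k : ℝ))
            atTop (𝓝 (σ2 L))) ∧
      Tendsto μ (atTop ⊓ 𝓟 {L : ℕ | Odd L})
        (𝓝 (Real.goldenRatio ^ (-(ColoredMultiweb.endNumber j : ℤ) - 4) / √5)) ∧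
      Tendsto σ2 (atTop ⊓ 𝓟 {L : ℕ | Odd L})
        (𝓝 (Real.goldenRatio ^ (-(ColoredMultiweb.endNumber j : ℤ) - 4) / √5 *
          (1 - ((ColoredMultiweb.endNumber j : ℝ) +
              Real.goldenRatio⁻¹ * (ColoredMultiweb.edgeNumber j : ℝ) + (11 + √5) / 2) /
            Real.goldenRatio ^ (ColoredMultiweb.endNumber j + 6)))) :=
  ⟨ColoredMultiweb.classDensity j, ColoredMultiweb.limitVariance j,
    fun _ _ hodd hL _ _ h => ColoredMultiweb.tendsto_mean_and_variance hL hodd hj h,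
    (ColoredMultiweb.tendsto_classDensity_endNumber j).mono_left inf_le_left,
    (ColoredMultiweb.tendsto_limitVariance hj).mono_left inf_le_left⟩
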